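/- Let $G$ be a compact connected Lie group with Lie algebra $\mathfrak g$ and Killing form $B$, let $H<G$ be a closed connected subgroup with Lie algebra $\mathfrak h$, and suppose $M=G/H$ has dimension at least $3$. Let $Q$ be the scalar product on $\mathfrak g$ induced by a bi-invariant Riemannian metric on $G$. For subspaces $\mathfrak v,\mathfrak u\subset\mathfrak g$, let $\mathfrak u\ominus\mathfrak v$ be the $Q$-orthogonal complement of $\mathfrak v$ in $\mathfrak u$ and let $\pi_{\mathfrak u}$ be the $Q$-orthogonal projection onto $\mathfrak u$. For a scalar product $X$ and a bilinear form $Y$, $\operatorname{tr}_XY$ is the trace of $Y$ with respect to $X$. Set $\mathfrak m=\mathfrak g\ominus\mathfrak h$, identified with $T_HM$. Fix a $G$-invariant Riemannian metric $T$ on $M$; it is also regarded as an $\mathrm{Ad}(H)$-invariant scalar product on $\mathfrak m$. Let $\mathcal M_T$ be the set of $G$-invariant Riemannian metrics $g$ on $M$ with $\operatorname{tr}_gT=1$, and let $S(g)$ denote the (constant) scalar curvature of a $G$-invariant metric $g$. For subspaces $\mathfrak u_1,\mathfrak u_2,\mathfrak u_3$ of $\mathfrak m$ let $\Delta(\mathfrak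 u_1,\mathfrak u_2,\mathfrak u_3)\in\mathfrak u_1\otimes\mathfrak u_2^*\otimes\mathfrak u_3^*$ be given by $\Delta(\mathfrak u_1,\mathfrak u_2,\mathfrak u_3)(X,Y)=\pi_{\mathfrak u_1}[X,Y]$ for $X\in\mathfrak u_2$, $Y\in\mathfrak u_3$, and let $\langle\mathfrak u_1\mathfrak u_2\mathfrak u_3\rangle$ be its squared norm with respect to $Q$. Let $\mathfrak k$ be a Lie subalgebra of $\mathfrak g$ containing $\mathfrak h$ properly; set $\mathfrak n=\mathfrak k\ominus\mathfrak h$ and $\mathfrak l=\mathfrak g\ominus\mathfrak k$. Let $\mathcal M_T(\mathfrak k)$ be the set of $\mathrm{Ad}(H)$-invariant scalar products $h$ on $\mathfrak n$ with $\operatorname{tr}_hT|_{\mathfrak n}=1$. For such $h$ put $$\hat S(h)=-\tfrac12\operatorname{tr}_hB|_{\mathfrak n}-\tfrac12|\Delta(\mathfrak l,\mathfrak n,\mathfrak l)|^2_{\mathrm{mix}}-\tfrac14|\Delta(\mathfrak n,\mathfrak n,\mathfrak n)|_h^2,$$ where $|\cdot|_{\mathrm{mix}}$ is the norm induced by $Q|_{\mathfrak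 l}$ and $h$ on $\mathfrak l\otimes\mathfrak n^*\otimes\mathfrak l^*$ and $|\cdot|_h$ the norm induced by $h$ on $\mathfrak n\otimes\mathfrak n^*\otimes\mathfrak n^*$, and let $\sigma(\mathfrak k,T)=\sup\{\hat S(h): h\in\mathcal M_T(\mathfrak k)\}$. The subalgebra $\mathfrak k$ is called $T$-apical if $\mathfrak k\ne\mathfrak g$, if $\hat S(h)=\sigma(\mathfrak k,T)$ for some $h\in\mathcal M_T(\mathfrak k)$, and if $\sigma(\mathfrak s,T)\le\sigma(\mathfrak k,T)$ for every maximal Lie subalgebra $\mathfrak s$ of $\mathfrak g$ containing $\mathfrak h$. Assume that for every maximal Lie subalgebra $\mathfrak s$ of $\mathfrak g$ with $\mathfrak h\subset\mathfrak s$ and all non-zero $\mathrm{Ad}(H)$-invariant subspaces $\mathfrak u\subset\mathfrak s\ominus\mathfrak h$ and $\mathfrak v\subset\mathfrak g\ominus\mathfrak s$, the representations $\mathrm{Ad}(H)|_{\mathfrak u}$ and $\mathrm{Ad}(H)|_{\mathfrak v}$ are inequivalent. Let $\mathfrak k$ be a $T$-apical subalgebra of $\mathfrak g$ and $\mathfrak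 l=\mathfrak g\ominus\mathfrak k$. If $$4\,\sigma(\mathfrak k,T)\operatorname{tr}_QT|_{\mathfrak l}<-2\operatorname{tr}_QB|_{\mathfrak l}-\langle\mathfrak l\mathfrak l\mathfrak l\rangle,$$ then there exists $g\in\mathcal M_T$ such that $S(g)\ge S(g')$ for all $g'\in\mathcal M_T$, and the Ricci curvature of $g$ equals $cT$ for some $c>0$. -/

import Mathlib

open scoped Manifold ContDiff

noncomputable section

namespace HomRicci

/-! ## Traces of bilinear forms -/

section LinearAlgebra

variable {V : Type*} [AddCommGroup V] [Module ℝ V] [Module.Finite ℝ V]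

/-- The Gram matrix of a bilinear form `X` in a fixed basis of `V`. -/
def gram (X : V → V → ℝ) :
    Matrix (Fin (Module.finrank ℝ V)) (Fin (Module.finrank ℝ V)) ℝ :=
  Matrix.of fun i j => X (Module.finBasis ℝ V i) (Module.finBasis ℝ V j)

/-- `tr_X Y`, the trace of the bilinear form `Y` with respect to the scalar product `X`, that is,
the trace of the endomorphism `A` with `X (A u) v = Y u v`. Equivalently, `∑ i, Y (e i) (e i)` for
an `X`-orthonormal basis `e`. -/
def trForm (X Y : V → V → ℝ) : ℝ :=
  ((gram X)⁻¹ * gram Y).trace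

end LinearAlgebra

/-! ## Lie-algebraic quantities

Here `L` is a finite-dimensional real Lie algebra with a scalar product `Q`, and `A : ι → L → L` is
the family of maps `Ad h`, `h ∈ H`. The subspace `h₀` plays the role of the Lie algebra of `H`. -/

section LieAlgebraic

variable {L : Type*} [LieRing L] [LieAlgebra ℝ L]

/-- `U ⊖ W`: the `Q`-orthogonal complement of `W` in `U`. -/
def ominus (Q : LinearMap.BilinForm ℝ L) (U W : Submodule ℝ L) : Submodule ℝ L :=
  U ⊓ Q.orthogonal W

/-- The restriction of a bilinear form to a subspace. -/
def restr (X : LinearMap.BilinForm ℝ L) (U : Submodule ℝ L) : U → U → ℝ :=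
  fun u v => X u v

/-- The `Q`-orthogonal projection `π_U x`: the (unique) `y ∈ U` with `x - y` orthogonal to `U`. -/
def proj (Q : LinearMap.BilinForm ℝ L) (U : Submodule ℝ L) (x : L) : U :=
  Classical.epsilon fun y : U => ∀ u : U, Q (x - y) u = 0

/-- `U` is invariant under the maps `A a`. -/
def IsInvariant {ι : Type*} (A : ι → L → L) (U : Submodule ℝ L) : Prop :=
  ∀ a, ∀ x ∈ U, A a x ∈ U

/-- The representations `A|_U` and `A|_W` on two invariant subspaces are equivalent: there is a
linear isomorphism `U ≃ W` intertwining them. -/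
def AreEquivalent {ι : Type*} (A : ι → L → L) (U W : Submodule ℝ L) : Prop :=
  ∃ φ : U ≃ₗ[ℝ] W, ∀ a, ∀ x y : U, (y : L) = A a x → (φ y : L) = A a (φ x)

/-- Every maximal Lie subalgebra `s` of `L` containing `h₀` is such that no nonzero
invariant `U ⊆ s ⊖ h₀` is equivalent to a nonzero invariant `W ⊆ L ⊖ s`. -/
def MaximalInequivalence {ι : Type*} (A : ι → L → L) (Q : LinearMap.BilinForm ℝ L)
    (h₀ : Submodule ℝ L) : Prop :=
  ∀ s : LieSubalgebra ℝ L, IsCoatom s → h₀ ≤ s.toSubmodule →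
    ∀ U W : Submodule ℝ L,
      U ≤ ominus Q s.toSubmodule h₀ → W ≤ ominus Q ⊤ s.toSubmodule →
      U ≠ ⊥ → W ≠ ⊥ → IsInvariant A U → IsInvariant A W → ¬ AreEquivalent A U W

variable [Module.Finite ℝ L]

/-- The squared norm of the tensor `Δ(U₁, U₂, U₃) : U₂ × U₃ → U₁`, `(x, y) ↦ π_{U₁} ⁅x, y⁆`, in
`U₁ ⊗ U₂* ⊗ U₃*`, with respect to scalar products `X₁`, `X₂`, `X₃` on `U₁`, `U₂`, `U₃`: the sum
of `X₁(Δ(e, f), Δ(e, f))` with `e`, `f` running over `X₂`- and `X₃`-orthonormal bases. -/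
def deltaNormSq (Q : LinearMap.BilinForm ℝ L) (U₁ U₂ U₃ : Submodule ℝ L)
    (X₁ : U₁ → U₁ → ℝ) (X₂ : U₂ → U₂ → ℝ) (X₃ : U₃ → U₃ → ℝ) : ℝ :=
  trForm X₂ fun u u' => trForm X₃ fun w w' =>
    X₁ (proj Q U₁ ⁅(u : L), (w : L)⁆) (proj Q U₁ ⁅(u' : L), (w' : L)⁆)

/-- `⟨U₁ U₂ U₃⟩`: the squared norm of `Δ(U₁, U₂, U₃)` with respect to `Q`. -/
def structConst (Q : LinearMap.BilinForm ℝ L) (U₁ U₂ U₃ : Submodule ℝ L) : ℝ :=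
  deltaNormSq Q U₁ U₂ U₃ (restr Q U₁) (restr Q U₂) (restr Q U₃)

/-- `h` is an `A`-invariant scalar product on the subspace `N`. -/
structure IsInvariantScalarProduct {ι : Type*} (A : ι → L → L) (N : Submodule ℝ L)
    (h : LinearMap.BilinForm ℝ N) : Prop where
  symm : ∀ x y, h x y = h y x
  pos : ∀ x, x ≠ 0 → 0 < h x x
  invariant : ∀ a, ∀ x y x' y' : N, (x' : L) = A a x → (y' : L) = A a y → h x' y' = h x y

/-- `Ŝ(h)` for a scalar product `h` on `n = k ⊖ h₀`; here `l = L ⊖ k` and `B` is the Killing form: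
`-½ tr_h B|_n - ½ |Δ(l, n, l)|²_mix - ¼ |Δ(n, n, n)|²_h`. -/
def Shat (Q : LinearMap.BilinForm ℝ L) (h₀ : Submodule ℝ L) (k : LieSubalgebra ℝ L)
    (h : LinearMap.BilinForm ℝ (ominus Q k.toSubmodule h₀)) : ℝ :=
  -((1 / 2) * trForm (fun x y => h x y)
        (restr (killingForm ℝ L) (ominus Q k.toSubmodule h₀)))
    - (1 / 2) * deltaNormSq Q (ominus Q ⊤ k.toSubmodule) (ominus Q k.toSubmodule h₀)
        (ominus Q ⊤ k.toSubmodule) (restr Q _) (fun x y => h x y) (restr Q _)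
    - (1 / 4) * deltaNormSq Q (ominus Q k.toSubmodule h₀) (ominus Q k.toSubmodule h₀)
        (ominus Q k.toSubmodule h₀) (fun x y => h x y) (fun x y => h x y) (fun x y => h x y)

/-- `M_T(k)`: the invariant scalar products `h` on `k ⊖ h₀` with `tr_h T|_{k ⊖ h₀} = 1`. -/
def MTk {ι : Type*} (A : ι → L → L) (Q T : LinearMap.BilinForm ℝ L) (h₀ : Submodule ℝ L)
    (k : LieSubalgebra ℝ L) : Set (LinearMap.BilinForm ℝ (ominus Q k.toSubmodule h₀)) :=
  {h | IsInvariantScalarProduct A (ominus Q k.toSubmodule h₀) h ∧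
    trForm (fun x y => h x y) (restr T (ominus Q k.toSubmodule h₀)) = 1}

/-- `σ(k, T)`, the supremum of `Ŝ` over `M_T(k)`. -/
def sigma {ι : Type*} (A : ι → L → L) (Q T : LinearMap.BilinForm ℝ L) (h₀ : Submodule ℝ L)
    (k : LieSubalgebra ℝ L) : ℝ :=
  sSup (Shat Q h₀ k '' MTk A Q T h₀ k)

/-- `k` is a `T`-apical subalgebra: `k` contains `h₀` properly, is not everything, `σ(k, T)` is
attained, and `σ(s, T) ≤ σ(k, T)` for all maximal Lie subalgebras `s` containing `h₀`. -/
structure IsApical {ι : Type*} (A : ι → L → L) (Q T : LinearMap.BilinForm ℝ L)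
    (h₀ : Submodule ℝ L) (k : LieSubalgebra ℝ L) : Prop where
  lt : h₀ < k.toSubmodule
  ne_top : k ≠ ⊤
  attained : ∃ h ∈ MTk A Q T h₀ k, Shat Q h₀ k h = sigma A Q T h₀ k
  sigma_le : ∀ s : LieSubalgebra ℝ L, IsCoatom s → h₀ ≤ s.toSubmodule →
    sigma A Q T h₀ s ≤ sigma A Q T h₀ k

end LieAlgebraic

/-! ## Curvature in a chart

`G y` is a smooth family of scalar products on `ℝⁿ`, i.e. a Riemannian metric on an open set. -/

section ChartCurvature

variable {n : ℕ}

local notation "𝔼" => EuclideanSpace ℝ (Fin n)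

/-- The Christoffel symbol `Γ_y(v, w)` of the Levi-Civita connection, i.e. the vector with
`G_y(Γ_y(v, w), z) = ½ (∂_v G(w, z) + ∂_w G(v, z) - ∂_z G(v, w))` for all `z`. -/
def christoffel (G : 𝔼 → 𝔼 →L[ℝ] 𝔼 →L[ℝ] ℝ) (y v w : 𝔼) : 𝔼 :=
  (G y).inverse ((1 / 2 : ℝ) •
    (fderiv ℝ G y v w + fderiv ℝ G y w v - ((fderiv ℝ G y).flip v).flip w))

/-- The curvature `R(u, v)w = ∇_u ∇_v w - ∇_v ∇_u w` for constant fields `u`, `v`, `w`. -/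
def chartCurvature (G : 𝔼 → 𝔼 →L[ℝ] 𝔼 →L[ℝ] ℝ) (y u v w : 𝔼) : 𝔼 :=
  fderiv ℝ (fun z => christoffel G z v w) y u - fderiv ℝ (fun z => christoffel G z u w) y v
    + christoffel G y u (christoffel G y v w) - christoffel G y v (christoffel G y u w)

/-- `Ric(v, w)`, the trace of `u ↦ R(u, v)w`. -/
def chartRicci (G : 𝔼 → 𝔼 →L[ℝ] 𝔼 →L[ℝ] ℝ) (y v w : 𝔼) : ℝ :=
  ∑ i, chartCurvature G y (EuclideanSpace.single i 1) v w i

end ChartCurvature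

/-! ## Curvature of Riemannian manifolds -/

section Riemannian

/-- Smooth Riemannian metrics on an `n`-dimensional manifold `M`. -/
abbrev SmoothMetric (n : ℕ) (M : Type*) [TopologicalSpace M]
    [ChartedSpace (EuclideanSpace ℝ (Fin n)) M] [IsManifold (𝓡 n) ∞ M] :=
  Bundle.ContMDiffRiemannianMetric (𝓡 n) ∞ (EuclideanSpace ℝ (Fin n))
    (fun x : M => TangentSpace (𝓡 n) x)

variable {n : ℕ} {M : Type*} [TopologicalSpace M]
  [ChartedSpace (EuclideanSpace ℝ (Fin n)) M] [IsManifold (𝓡 n) ∞ M]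

/-- The coordinate expression of a metric in the preferred chart around `x`: the pullback of `g`
under the inverse of the chart. (`TangentSpace (𝓡 n) z` is by definition a copy of `ℝⁿ`.) -/
def metricInChart (g : SmoothMetric n M) (x : M) (y : EuclideanSpace ℝ (Fin n)) :
    EuclideanSpace ℝ (Fin n) →L[ℝ] EuclideanSpace ℝ (Fin n) →L[ℝ] ℝ :=
  let D : EuclideanSpace ℝ (Fin n) →L[ℝ] EuclideanSpace ℝ (Fin n) :=
    mfderiv 𝓘(ℝ, EuclideanSpace ℝ (Fin n)) (𝓡 n) (extChartAt (𝓡 n) x).symm y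
  let B : EuclideanSpace ℝ (Fin n) →L[ℝ] EuclideanSpace ℝ (Fin n) →L[ℝ] ℝ :=
    g.inner ((extChartAt (𝓡 n) x).symm y)
  B.bilinearComp D D

/-- The Ricci curvature of `g` at `x`, computed in the preferred chart around `x`. -/
def ricci (g : SmoothMetric n M) (x : M) (v w : TangentSpace (𝓡 n) x) : ℝ :=
  chartRicci (metricInChart g x) (extChartAt (𝓡 n) x x)
    (mfderiv (𝓡 n) 𝓘(ℝ, EuclideanSpace ℝ (Fin n)) (extChartAt (𝓡 n) x) x v)
    (mfderiv (𝓡 n) 𝓘(ℝ, EuclideanSpace ℝ (Fin n)) (extChartAt (𝓡 n) x) x w)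

instance (x : M) : Module.Finite ℝ (TangentSpace (𝓡 n) x) :=
  inferInstanceAs (Module.Finite ℝ (EuclideanSpace ℝ (Fin n)))

/-- `tr_g T` at the point `x`, for two Riemannian metrics `g` and `T`. -/
def metricTrace (g T : SmoothMetric n M) (x : M) : ℝ :=
  trForm (V := TangentSpace (𝓡 n) x) (fun v w => g.inner x v w) (fun v w => T.inner x v w)

/-- The scalar curvature of `g` at `x`: the trace of the Ricci curvature with respect to `g`. -/
def scalarCurvature (g : SmoothMetric n M) (x : M) : ℝ :=
  trForm (V := TangentSpace (𝓡 n) x) (fun v w => g.inner x v w) (fun v w => ricci g x v w)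

end Riemannian

/-! ## Lie groups -/

section LieGroups

variable {d : ℕ} {G : Type*} [TopologicalSpace G] [ChartedSpace (EuclideanSpace ℝ (Fin d)) G]
  [Group G] [LieGroup (𝓡 d) ∞ G]

instance : LieGroup (𝓡 d) (minSmoothness ℝ 3) G := by
  rw [minSmoothness_of_isRCLikeNormedField]
  infer_instance

instance : Module.Finite ℝ (GroupLieAlgebra (𝓡 d) G) :=
  inferInstanceAs (Module.Finite ℝ (EuclideanSpace ℝ (Fin d)))

/-- The adjoint representation: `Ad a` is the derivative at `1` of `x ↦ a x a⁻¹`. -/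
def Ad (d : ℕ) {G : Type*} [TopologicalSpace G] [ChartedSpace (EuclideanSpace ℝ (Fin d)) G]
    [Group G] (a : G) (X : GroupLieAlgebra (𝓡 d) G) : GroupLieAlgebra (𝓡 d) G :=
  mfderiv (𝓡 d) (𝓡 d) (fun x : G => a * x * a⁻¹) 1 X

/-- The Riemannian metric `q` on `G` is invariant under left and right translations. -/
structure IsBiinvariant (q : SmoothMetric d G) : Prop where
  left : ∀ (a x : G) (v w : TangentSpace (𝓡 d) x),
    q.inner (a * x) (mfderiv (𝓡 d) (𝓡 d) (fun y : G => a * y) x v)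
      (mfderiv (𝓡 d) (𝓡 d) (fun y : G => a * y) x w) = q.inner x v w
  right : ∀ (a x : G) (v w : TangentSpace (𝓡 d) x),
    q.inner (x * a) (mfderiv (𝓡 d) (𝓡 d) (fun y : G => y * a) x v)
      (mfderiv (𝓡 d) (𝓡 d) (fun y : G => y * a) x w) = q.inner x v w

/-- The scalar product on the Lie algebra of `G` induced by a Riemannian metric on `G`. -/
def inducedForm (q : SmoothMetric d G) : LinearMap.BilinForm ℝ (GroupLieAlgebra (𝓡 d) G) :=
  LinearMap.mk₂ ℝ (fun X Y => q.inner 1 X Y) (by simp) (by simp) (by simp) (by simp)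

end LieGroups

/-! ## Homogeneous spaces -/

section HomogeneousSpaces

variable {d n : ℕ} {G : Type*} [TopologicalSpace G] [ChartedSpace (EuclideanSpace ℝ (Fin d)) G]
  [Group G] (H : Subgroup G) [ChartedSpace (EuclideanSpace ℝ (Fin n)) (G ⧸ H)]

/-- The smooth structure of `G ⧸ H` is the one of a homogeneous space: the quotient map
`G → G ⧸ H` is a smooth submersion. (For `H` closed there is exactly one such structure.) -/
structure IsHomogeneousStructure (d n : ℕ) {G : Type*} [TopologicalSpace G]
    [ChartedSpace (EuclideanSpace ℝ (Fin d)) G] [Group G] (H : Subgroup G)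
    [ChartedSpace (EuclideanSpace ℝ (Fin n)) (G ⧸ H)] : Prop where
  contMDiff : ContMDiff (𝓡 d) (𝓡 n) ∞ (fun a : G => (a : G ⧸ H))
  surjective : ∀ a : G, Function.Surjective (mfderiv (𝓡 d) (𝓡 n) (fun a : G => (a : G ⧸ H)) a)

/-- The derivative at `1` of the quotient map `G → G ⧸ H`. Its restriction to the orthogonal
complement `m` of its kernel is the standard identification of `m` with `T_H(G ⧸ H)`. -/
def quotientDeriv (d n : ℕ) {G : Type*} [TopologicalSpace G]
    [ChartedSpace (EuclideanSpace ℝ (Fin d)) G] [Group G] (H : Subgroup G)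
    [ChartedSpace (EuclideanSpace ℝ (Fin n)) (G ⧸ H)] :
    GroupLieAlgebra (𝓡 d) G →L[ℝ] TangentSpace (𝓡 n) ((1 : G) : G ⧸ H) :=
  mfderiv (𝓡 d) (𝓡 n) (fun a : G => (a : G ⧸ H)) 1

/-- The Lie algebra of `H` inside that of `G`: the tangent space at `1` of `H`, which is the fibre
of the submersion `G → G ⧸ H` through `1`. -/
def isotropyAlgebra (d n : ℕ) {G : Type*} [TopologicalSpace G]
    [ChartedSpace (EuclideanSpace ℝ (Fin d)) G] [Group G] (H : Subgroup G)
    [ChartedSpace (EuclideanSpace ℝ (Fin n)) (G ⧸ H)] :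
    Submodule ℝ (GroupLieAlgebra (𝓡 d) G) :=
  LinearMap.ker (quotientDeriv d n H).toLinearMap

variable {H} [IsManifold (𝓡 n) ∞ (G ⧸ H)]

/-- The metric `g` on `G ⧸ H` is `G`-invariant. -/
def IsInvariantMetric (g : SmoothMetric n (G ⧸ H)) : Prop :=
  ∀ (a : G) (x : G ⧸ H) (v w : TangentSpace (𝓡 n) x),
    g.inner (a • x) (mfderiv (𝓡 n) (𝓡 n) (fun y : G ⧸ H => a • y) x v)
      (mfderiv (𝓡 n) (𝓡 n) (fun y : G ⧸ H => a • y) x w) = g.inner x v w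

/-- `M_T`: the `G`-invariant metrics `g` on `G ⧸ H` with `tr_g T = 1`. -/
def MT (T : SmoothMetric n (G ⧸ H)) : Set (SmoothMetric n (G ⧸ H)) :=
  {g | IsInvariantMetric g ∧ ∀ x, metricTrace g T x = 1}

/-- The scalar curvature functional `S`; the scalar curvature of a `G`-invariant metric is constant
and `S` is its value, taken at the base point. -/
def scalarFunctional (g : SmoothMetric n (G ⧸ H)) : ℝ :=
  scalarCurvature g ((1 : G) : G ⧸ H)

/-- The form induced by `T` on the Lie algebra of `G` via the derivative of the quotient map. On `m`
it is the scalar product that corresponds to `T` under the identification of `m` with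
`T_H(G ⧸ H)`. -/
def liftedForm (d : ℕ) [ChartedSpace (EuclideanSpace ℝ (Fin d)) G] (T : SmoothMetric n (G ⧸ H)) :
    LinearMap.BilinForm ℝ (GroupLieAlgebra (𝓡 d) G) :=
  LinearMap.mk₂ ℝ
    (fun X Y => T.inner ((1 : G) : G ⧸ H) (quotientDeriv d n H X) (quotientDeriv d n H Y))
    (by simp) (by simp) (by simp) (by simp)

end HomogeneousSpaces

end HomRicci

end

/-!
A `G`-invariant metric on `G ⧸ H` is determined by the form which it induces on the Lie algebra.
For connected `H` these forms are the positive semidefinite forms with kernel the isotropy algebra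
`h₀` which are invariant under `ad h₀` (`IsInvForm`, `isInvForm_liftedForm`,
`exists_invariantMetric`); invariance under `Ad H` and under `ad h₀` agree by `isAdapted_Ad`. The
elements of the Lie algebra induce Killing fields on `G ⧸ H`, and the Ricci curvature in directions
of Killing fields depends only on the metric and on brackets (`chartRicci_eq`). So the Ricci and
scalar curvatures of an invariant metric are given by algebraic expressions `ricForm` and `scal` in
the induced form (`ricci_lieProj`, `scalarFunctional_eq`), and the problem is to find an invariant
form which maximizes `scal` among those with `tr_g T = 1`.

* The inequality for the apical subalgebra `k` says that the scalar curvature, along a family of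
  metrics whose component on `l` blows up and whose component on `n` tends to a maximum of `Ŝ`,
  approaches `σ(k, T)` from above. Hence some metric has scalar curvature greater than `σ(k, T)`
  (`exists_scal_gt`), and `σ(k, T) ≥ 0` (`sigma_nonneg`).
* A maximizing sequence, diagonalized simultaneously with `T`, converges after passing to a
  subsequence, in the sense that the orthonormal frames and the inverses of the eigenvalues converge.
  If some of the inverses tend to zero, then the boundedness of the scalar curvature shows that the
  remaining directions span, with `h₀`, a proper subalgebra, which lies in a maximal subalgebra `s`.
  By the inequivalence assumption all invariant forms are block diagonal with respect to `s`
  (`IsAdInvariant.eq_zero_of_maximal`), and then the scalar curvature is at most `σ(s, T)` up to an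
  error which tends to zero (`IsInvForm.scal_le`). Since `σ(s, T) ≤ σ(k, T)`, this contradicts the
  previous step. So the maximum is attained (`exists_scal_max`).
* By the first variation, the form which attains the maximum satisfies `Ric = c T`
  (`IsInvForm.ricForm_eq_of_isMax`). Taking traces, `c` is the maximal scalar curvature, which is
  greater than `σ(k, T) ≥ 0`.

The geometry is carried out in charts. The Lie bracket is the antisymmetrized second derivative of
the multiplication (`lie_eq_germBracket`), it is also the derivative of `Ad` (`hasFDerivAt_AdL`), and
the action of `G` on `G ⧸ H` is a local action on an open subset of a vector space, whose induced
fields are Killing fields and form an anti-homomorphism (`IsActionGerm.killing`,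
`IsActionGerm.bracket`).
-/

noncomputable section

namespace HomRicci

open Filter Topology

set_option maxSynthPendingDepth 3
set_option autoImplicit false

/-! ### Killing fields and the Levi-Civita connection in coordinates -/

section ChartCalculus

variable {n : ℕ}

local notation "𝔼" => EuclideanSpace ℝ (Fin n)

/-- The Christoffel symbol as a bilinear map depending on the point, with values
`christoffel G y v w`. -/
def christoffelMap (G : 𝔼 → 𝔼 →L[ℝ] 𝔼 →L[ℝ] ℝ) (y : 𝔼) : 𝔼 →L[ℝ] 𝔼 →L[ℝ] 𝔼 :=
  (ContinuousLinearMap.compL ℝ 𝔼 (𝔼 →L[ℝ] ℝ) 𝔼 (G y).inverse) ∘L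
    ((1 / 2 : ℝ) • (fderiv ℝ G y + (fderiv ℝ G y).flip
      - (ContinuousLinearMap.flipₗᵢ ℝ 𝔼 𝔼 ℝ).toContinuousLinearEquiv.toContinuousLinearMap ∘L
          (fderiv ℝ G y).flip))

/-- A metric on a neighbourhood of `y₀`: a family of scalar products, smooth near `y₀`. -/
structure IsMetricNear (G : 𝔼 → 𝔼 →L[ℝ] 𝔼 →L[ℝ] ℝ) (y₀ : 𝔼) : Prop where
  smooth : ∀ᶠ y in 𝓝 y₀, ContDiffAt ℝ ∞ G y
  symm : ∀ᶠ y in 𝓝 y₀, ∀ v w, G y v w = G y w v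
  pos : ∀ᶠ y in 𝓝 y₀, ∀ v, v ≠ 0 → 0 < G y v v

/-- The equation `L_X G = 0` in coordinates, near `y₀`. -/
structure IsKillingNear (G : 𝔼 → 𝔼 →L[ℝ] 𝔼 →L[ℝ] ℝ) (X : 𝔼 → 𝔼) (y₀ : 𝔼) : Prop where
  smooth : ∀ᶠ y in 𝓝 y₀, ContDiffAt ℝ ∞ X y
  eq : ∀ᶠ y in 𝓝 y₀, ∀ v w,
    fderiv ℝ G y (X y) v w + G y (fderiv ℝ X y v) w + G y v (fderiv ℝ X y w) = 0

lemma IsMetricNear.eventually {G : 𝔼 → 𝔼 →L[ℝ] 𝔼 →L[ℝ] ℝ} {y₀ : 𝔼} (h : IsMetricNear G y₀) :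
    ∀ᶠ y in 𝓝 y₀, IsMetricNear G y := by
  filter_upwards [h.smooth.eventually_nhds, h.symm.eventually_nhds, h.pos.eventually_nhds]
    with y h1 h2 h3 using ⟨h1, h2, h3⟩

lemma IsKillingNear.eventually {G : 𝔼 → 𝔼 →L[ℝ] 𝔼 →L[ℝ] ℝ} {X : 𝔼 → 𝔼} {y₀ : 𝔼}
    (h : IsKillingNear G X y₀) : ∀ᶠ y in 𝓝 y₀, IsKillingNear G X y := by
  filter_upwards [h.smooth.eventually_nhds, h.eq.eventually_nhds] with y h1 h2 using ⟨h1, h2⟩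

lemma IsMetricNear.exists_equiv {G : 𝔼 → 𝔼 →L[ℝ] 𝔼 →L[ℝ] ℝ} {y : 𝔼} (h : IsMetricNear G y) :
    ∃ e : 𝔼 ≃L[ℝ] (𝔼 →L[ℝ] ℝ), (e : 𝔼 →L[ℝ] 𝔼 →L[ℝ] ℝ) = G y := by
  have hinj : Function.Injective (G y).toLinearMap := by
    rw [← LinearMap.ker_eq_bot, LinearMap.ker_eq_bot']
    intro v hv
    by_contra hne
    have h1 := h.pos.self_of_nhds v hne
    have h2 : G y v = 0 := hv
    rw [h2] at h1
    simp at h1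
  have hd : Module.finrank ℝ 𝔼 = Module.finrank ℝ (𝔼 →L[ℝ] ℝ) := by
    rw [← (LinearMap.toContinuousLinearMap (𝕜 := ℝ) (E := 𝔼) (F' := ℝ)).finrank_eq]
    exact Subspace.dual_finrank_eq.symm
  refine ⟨(LinearEquiv.ofInjectiveOfFinrankEq _ hinj hd).toContinuousLinearEquiv, ?_⟩
  ext v w
  rfl

/-- The defining property of the Christoffel symbol. -/
lemma IsMetricNear.apply_christoffelMap {G : 𝔼 → 𝔼 →L[ℝ] 𝔼 →L[ℝ] ℝ} {y : 𝔼}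
    (h : IsMetricNear G y) (v w z : 𝔼) :
    G y (christoffelMap G y v w) z =
      (1 / 2) * (fderiv ℝ G y v w z + fderiv ℝ G y w v z - fderiv ℝ G y z v w) := by
  obtain ⟨e, he⟩ := h.exists_equiv
  have h1 : ∀ φ : 𝔼 →L[ℝ] ℝ, G y ((G y).inverse φ) = φ := by
    intro φ
    rw [← he, ContinuousLinearMap.inverse_equiv]
    exact e.apply_symm_apply φ
  change G y ((G y).inverse ((1 / 2 : ℝ) • (fderiv ℝ G y v w + fderiv ℝ G y w v
      - ((fderiv ℝ G y).flip v).flip w))) z = _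
  rw [h1]
  rfl

lemma IsMetricNear.contDiffAt_christoffelMap {G : 𝔼 → 𝔼 →L[ℝ] 𝔼 →L[ℝ] ℝ} {y : 𝔼}
    (h : IsMetricNear G y) : ContDiffAt ℝ ∞ (christoffelMap G) y := by
  obtain ⟨e, he⟩ := h.exists_equiv
  have hG := h.smooth.self_of_nhds
  have h1 : ContDiffAt ℝ ∞ (fun z => (G z).inverse) y := by
    have := contDiffAt_map_inverse (𝕜 := ℝ) (n := ∞) e
    rw [he] at this
    exact this.comp y hG
  have h2 : ContDiffAt ℝ ∞ (fderiv ℝ G) y := hG.fderiv_right (by simp)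
  unfold christoffelMap
  refine ContDiffAt.clm_comp (contDiffAt_const.clm_apply h1) ?_
  refine ContDiffAt.const_smul _ ?_
  have h3 : ContDiffAt ℝ ∞ (fun z => (fderiv ℝ G z).flip) y :=
    (ContinuousLinearMap.flipₗᵢ ℝ 𝔼 𝔼 (𝔼 →L[ℝ] ℝ)).toContinuousLinearEquiv.contDiff.contDiffAt.comp
      y h2
  exact (h2.add h3).sub (contDiffAt_const.clm_comp h3)

lemma IsMetricNear.fderiv_symm {G : 𝔼 → 𝔼 →L[ℝ] 𝔼 →L[ℝ] ℝ} {y : 𝔼}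
    (h : IsMetricNear G y) (u v w : 𝔼) : fderiv ℝ G y u v w = fderiv ℝ G y u w v := by
  have hG := (h.smooth.self_of_nhds.differentiableAt (by simp)).hasFDerivAt
  have h1 : HasFDerivAt (fun z => G z v w) (((fderiv ℝ G y).flip v).flip w) y :=
    (hG.clm_apply (hasFDerivAt_const v y)).clm_apply (hasFDerivAt_const w y) |>.congr_fderiv (by
      ext; simp)
  have h2 : HasFDerivAt (fun z => G z w v) (((fderiv ℝ G y).flip w).flip v) y :=
    (hG.clm_apply (hasFDerivAt_const w y)).clm_apply (hasFDerivAt_const v y) |>.congr_fderiv (by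
      ext; simp)
  have h3 : (fun z => G z v w) =ᶠ[𝓝 y] fun z => G z w v := by
    filter_upwards [h.symm] with z hz using hz v w
  have := h1.unique (h2.congr_of_eventuallyEq h3)
  exact DFunLike.congr_fun this u

lemma IsMetricNear.christoffelMap_symm {G : 𝔼 → 𝔼 →L[ℝ] 𝔼 →L[ℝ] ℝ} {y : 𝔼}
    (h : IsMetricNear G y) (v w : 𝔼) : christoffelMap G y v w = christoffelMap G y w v := by
  obtain ⟨e, he⟩ := h.exists_equiv
  apply e.injective
  ext z
  have h1 : ∀ x, e x = G y x := fun x => by rw [← he]; rfl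
  rw [h1, h1, h.apply_christoffelMap, h.apply_christoffelMap, h.fderiv_symm z v w]
  ring

/-- The Levi-Civita connection is compatible with the metric. -/
lemma IsMetricNear.compatible {G : 𝔼 → 𝔼 →L[ℝ] 𝔼 →L[ℝ] ℝ} {y : 𝔼}
    (h : IsMetricNear G y) (u v w : 𝔼) :
    fderiv ℝ G y u v w = G y (christoffelMap G y u v) w + G y v (christoffelMap G y u w) := by
  rw [h.symm.self_of_nhds v, h.apply_christoffelMap, h.apply_christoffelMap,
    h.fderiv_symm u w v]
  ring

lemma fderiv_fderiv_symm {E F : Type*} [NormedAddCommGroup E] [NormedSpace ℝ E]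
    [NormedAddCommGroup F] [NormedSpace ℝ F] {f : E → F} {y : E}
    (h : ContDiffAt ℝ ∞ f y) (u v : E) :
    fderiv ℝ (fderiv ℝ f) y u v = fderiv ℝ (fderiv ℝ f) y v u :=
  (h.isSymmSndFDerivAt (by
    rw [minSmoothness_of_isRCLikeNormedField]
    exact WithTop.coe_le_coe.2 (le_top : (2 : ℕ∞) ≤ ⊤))) u v

/-- The derivative of the Killing equation. -/
lemma IsKillingNear.fderiv_eq {G : 𝔼 → 𝔼 →L[ℝ] 𝔼 →L[ℝ] ℝ} {X : 𝔼 → 𝔼} {y : 𝔼}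
    (hG : IsMetricNear G y) (hX : IsKillingNear G X y) (a b c : 𝔼) :
    fderiv ℝ (fderiv ℝ G) y c (X y) a b + fderiv ℝ G y (fderiv ℝ X y c) a b
      + fderiv ℝ G y c (fderiv ℝ X y a) b + G y (fderiv ℝ (fderiv ℝ X) y c a) b
      + fderiv ℝ G y c a (fderiv ℝ X y b) + G y a (fderiv ℝ (fderiv ℝ X) y c b) = 0 := by
  have cG := hG.smooth.self_of_nhds
  have cX := hX.smooth.self_of_nhds
  have dG := (cG.differentiableAt (by simp)).hasFDerivAt
  have dX := (cX.differentiableAt (by simp)).hasFDerivAt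
  have ddG := ((cG.fderiv_right (m := ∞) (by simp)).differentiableAt (by simp)).hasFDerivAt
  have ddX := ((cX.fderiv_right (m := ∞) (by simp)).differentiableAt (by simp)).hasFDerivAt
  have e1 := ((ddG.clm_apply dX).clm_apply (hasFDerivAt_const a y)).clm_apply
    (hasFDerivAt_const b y)
  have e2 := (dG.clm_apply (ddX.clm_apply (hasFDerivAt_const a y))).clm_apply
    (hasFDerivAt_const b y)
  have e3 := (dG.clm_apply (hasFDerivAt_const a y)).clm_apply
    (ddX.clm_apply (hasFDerivAt_const b y))
  have e5 := ((e1.add e2).add e3).congr_of_eventuallyEq (f₁ := fun _ => (0 : ℝ)) (by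
    filter_upwards [hX.eq] with x hx
    exact (hx a b).symm)
  have := DFunLike.congr_fun (e5.unique (hasFDerivAt_const (0 : ℝ) y)) c
  simp only [add_apply, ContinuousLinearMap.comp_apply,
    ContinuousLinearMap.flip_apply, zero_apply, map_zero, zero_add] at this
  linarith

/-- The derivative of the defining equation of the Christoffel symbol. -/
lemma IsMetricNear.fderiv_christoffelMap {G : 𝔼 → 𝔼 →L[ℝ] 𝔼 →L[ℝ] ℝ} {y : 𝔼}
    (hG : IsMetricNear G y) (u v w z : 𝔼) :
    fderiv ℝ G y u (christoffelMap G y v w) z + G y (fderiv ℝ (christoffelMap G) y u v w) z =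
      (1 / 2) * (fderiv ℝ (fderiv ℝ G) y u v w z + fderiv ℝ (fderiv ℝ G) y u w v z
        - fderiv ℝ (fderiv ℝ G) y u z v w) := by
  have cG := hG.smooth.self_of_nhds
  have dG := (cG.differentiableAt (by simp)).hasFDerivAt
  have ddG := ((cG.fderiv_right (m := ∞) (by simp)).differentiableAt (by simp)).hasFDerivAt
  have dC := (hG.contDiffAt_christoffelMap.differentiableAt (by simp)).hasFDerivAt
  have l1 := (dG.clm_apply ((dC.clm_apply (hasFDerivAt_const v y)).clm_apply
    (hasFDerivAt_const w y))).clm_apply (hasFDerivAt_const z y)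
  have t : ∀ a b c : 𝔼, _ := fun a b c => ((ddG.clm_apply (hasFDerivAt_const a y)).clm_apply
    (hasFDerivAt_const b y)).clm_apply (hasFDerivAt_const c y)
  have r1 := (((t v w z).add (t w v z)).sub (t z v w)).const_mul (1 / 2)
  have r2 := r1.congr_of_eventuallyEq
    (f₁ := fun x => G x (christoffelMap G x v w) z) (by
      filter_upwards [hG.eventually] with x hx
      exact hx.apply_christoffelMap v w z)
  have := DFunLike.congr_fun (l1.unique r2) u
  simp only [add_apply, ContinuousLinearMap.comp_apply,
    ContinuousLinearMap.flip_apply, zero_apply, map_zero, zero_add,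
    smul_apply, sub_apply, smul_eq_mul] at this
  linarith

/-- A Killing field preserves the Levi-Civita connection: `L_X Γ = 0`. -/
lemma IsKillingNear.lieDeriv_christoffelMap {G : 𝔼 → 𝔼 →L[ℝ] 𝔼 →L[ℝ] ℝ} {X : 𝔼 → 𝔼} {y : 𝔼}
    (hG : IsMetricNear G y) (hX : IsKillingNear G X y) (v w : 𝔼) :
    fderiv ℝ (fderiv ℝ X) y v w + christoffelMap G y v (fderiv ℝ X y w)
      + christoffelMap G y (fderiv ℝ X y v) w - fderiv ℝ X y (christoffelMap G y v w)
      + fderiv ℝ (christoffelMap G) y (X y) v w = 0 := by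
  -- after pairing with `z`, the identity is a combination of three instances of the derivative of
  -- the Killing equation and of the derivative of the equation which defines the Christoffel symbol
  obtain ⟨e, he⟩ := hG.exists_equiv
  apply e.injective
  rw [map_zero]
  ext z
  have h1 : ∀ x, e x = G y x := fun x => by rw [← he]; rfl
  rw [h1]
  have keyC := hG.fderiv_christoffelMap (X y) v w z
  have k1 := hX.fderiv_eq hG w z v
  have k2 := hX.fderiv_eq hG v z w
  have k3 := hX.fderiv_eq hG v w z
  have k4 := hX.eq.self_of_nhds (christoffelMap G y v w) z
  have s : ∀ a b, G y a b = G y b a := hG.symm.self_of_nhds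
  have sG := fun a b => fderiv_fderiv_symm hG.smooth.self_of_nhds a b
  have sX := fun a b => fderiv_fderiv_symm hX.smooth.self_of_nhds a b
  have A := hG.apply_christoffelMap
  have a1 := A v (fderiv ℝ X y w) z
  have a2 := A (fderiv ℝ X y v) w z
  have a3 := A v w (fderiv ℝ X y z)
  rw [sG v] at k1
  rw [sG w, sX w v] at k2
  rw [sG z, sX z v, sX z w] at k3
  have s1 := s v (fderiv ℝ (fderiv ℝ X) y w z)
  have s2 := s w (fderiv ℝ (fderiv ℝ X) y v z)
  have s3 := s (fderiv ℝ X y z) (christoffelMap G y v w)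
  simp only [map_add, map_sub, add_apply, sub_apply,
    zero_apply]
  linarith

end ChartCalculus

/-! ### Orthonormal frames and traces -/

section Frames

variable {V : Type*} [AddCommGroup V] [Module ℝ V]

/-- `e` is a `g`-orthonormal frame of the subspace `U`. The form `g` may be degenerate outside
of `U`. -/
structure IsFrame {ι : Type*} [Fintype ι] [DecidableEq ι] (g : LinearMap.BilinForm ℝ V)
    (U : Submodule ℝ V) (e : ι → V) : Prop where
  mem : ∀ i, e i ∈ U
  orth : ∀ i j, g (e i) (e j) = if i = j then 1 else 0
  expand : ∀ x ∈ U, x = ∑ i, g x (e i) • e i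

/-- The spectral theorem for a symmetric form `φ` and a scalar product `g`. -/
theorem exists_frame_diag_top [Module.Finite ℝ V] (g φ : LinearMap.BilinForm ℝ V)
    (hs : ∀ x y, g x y = g y x) (hp : ∀ x, x ≠ 0 → 0 < g x x) (hφ : ∀ x y, φ x y = φ y x) :
    ∃ (e : Fin (Module.finrank ℝ V) → V) (κ : Fin (Module.finrank ℝ V) → ℝ),
      IsFrame g ⊤ e ∧ ∀ i j, φ (e i) (e j) = if i = j then κ i else 0 := by
  let core : InnerProductSpace.Core ℝ V :=
    { inner := fun x y => g x y
      conj_inner_symm := fun x y => by simpa using hs y x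
      re_inner_nonneg := fun x => by
        by_cases h : x = 0
        · simp [h]
        · simpa using (hp x h).le
      add_left := fun x y z => by simp
      smul_left := fun x y r => by simp
      definite := fun x h => by
        by_contra hne
        exact (hp x hne).ne' h }
  let _ : NormedAddCommGroup V := core.toNormedAddCommGroup
  let _ : InnerProductSpace ℝ V := InnerProductSpace.ofCore core.toCore
  have hin : ∀ x y : V, inner ℝ x y = g x y := fun x y => rfl
  have b := stdOrthonormalBasis ℝ V
  -- the self-adjoint operator which represents `φ`
  let A : V →ₗ[ℝ] V :=
    { toFun := fun x => ∑ i, φ x (b i) • b i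
      map_add' := fun x y => by simp [add_smul, Finset.sum_add_distrib]
      map_smul' := fun c x => by simp [mul_smul, Finset.smul_sum] }
  have hA : ∀ x y, inner ℝ (A x) y = φ x y := by
    intro x y
    conv_rhs => rw [← b.sum_repr' y]
    simp only [A, LinearMap.coe_mk, AddHom.coe_mk, sum_inner, inner_smul_left, map_sum, map_smul,
      smul_eq_mul]
    refine Finset.sum_congr rfl fun i _ => ?_
    simp [mul_comm]
  have hsymm : A.IsSymmetric := by
    intro x y
    rw [hA, real_inner_comm, hA, hφ]
  let f := hsymm.eigenvectorBasis rfl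
  refine ⟨f, hsymm.eigenvalues rfl, ⟨fun _ => trivial, ?_, ?_⟩, ?_⟩
  · intro i j
    rw [← hin]
    exact orthonormal_iff_ite.1 f.orthonormal i j
  · intro x _
    conv_lhs => rw [← f.sum_repr' x]
    refine Finset.sum_congr rfl fun i _ => ?_
    rw [hin, hs]
  · intro i j
    rw [← hA, hsymm.apply_eigenvectorBasis, inner_smul_left]
    rw [orthonormal_iff_ite.1 f.orthonormal i j]
    simp

/-- Simultaneous diagonalization of a scalar product and a symmetric form on a subspace. -/
theorem exists_frame_diag (g φ : LinearMap.BilinForm ℝ V) (U : Submodule ℝ V)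
    [Module.Finite ℝ U]
    (hs : ∀ x y, g x y = g y x) (hp : ∀ x ∈ U, x ≠ 0 → 0 < g x x) (hφ : ∀ x y, φ x y = φ y x) :
    ∃ (e : Fin (Module.finrank ℝ U) → V) (κ : Fin (Module.finrank ℝ U) → ℝ),
      IsFrame g U e ∧ ∀ i j, φ (e i) (e j) = if i = j then κ i else 0 := by
  obtain ⟨e, κ, he, hκ⟩ := exists_frame_diag_top (V := U) (g.restrict U) (φ.restrict U)
    (fun x y => hs x y) (fun x hx => hp x x.2 (by simpa using hx)) (fun x y => hφ x y)
  refine ⟨fun i => e i, κ, ⟨fun i => (e i).2, he.orth, fun x hx => ?_⟩, hκ⟩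
  have := congrArg Subtype.val (he.expand ⟨x, hx⟩ trivial)
  simpa using this

theorem exists_frame (g : LinearMap.BilinForm ℝ V) (U : Submodule ℝ V) [Module.Finite ℝ U]
    (hs : ∀ x y, g x y = g y x) (hp : ∀ x ∈ U, x ≠ 0 → 0 < g x x) :
    ∃ e : Fin (Module.finrank ℝ U) → V, IsFrame g U e := by
  obtain ⟨e, _, he, _⟩ := exists_frame_diag g g U hs hp hs
  exact ⟨e, he⟩

variable {ι κ : Type*} [Fintype ι] [DecidableEq ι] [Fintype κ] [DecidableEq κ]
  {g : LinearMap.BilinForm ℝ V} {U : Submodule ℝ V}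

/-- The trace of a bilinear form does not depend on the orthonormal frame. -/
theorem IsFrame.sum_eq {e : ι → V} {f : κ → V} (he : IsFrame g U e) (hf : IsFrame g U f)
    (hs : ∀ x y, g x y = g y x) (φ : LinearMap.BilinForm ℝ V) :
    ∑ i, φ (e i) (e i) = ∑ j, φ (f j) (f j) := by
  have h1 : ∀ i, φ (e i) (e i) = ∑ j, g (e i) (f j) * φ (f j) (e i) := by
    intro i
    conv_lhs => rw [show φ (e i) = φ (∑ j, g (e i) (f j) • f j) from
      congrArg φ (hf.expand _ (he.mem i))]
    simp [LinearMap.sum_apply]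
  have h2 : ∀ j, φ (f j) (f j) = ∑ i, g (e i) (f j) * φ (f j) (e i) := by
    intro j
    conv_lhs => rw [he.expand _ (hf.mem j)]
    rw [map_sum]
    refine Finset.sum_congr rfl fun i _ => ?_
    rw [map_smul, smul_eq_mul, hs, ← he.expand _ (hf.mem j)]
  simp_rw [h1, h2]
  rw [Finset.sum_comm]

/-- Parseval's identity. -/
theorem IsFrame.parseval {e : ι → V} (he : IsFrame g U e) (x y : V) (hx : x ∈ U) :
    g x y = ∑ i, g x (e i) * g (e i) y := by
  conv_lhs => rw [he.expand x hx]
  simp [LinearMap.sum_apply]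

/-- A trace computed in a generating family with a family of coordinate functionals. -/
theorem trace_eq_sum_coord {ν : Type*} [Fintype ν] [Module.Finite ℝ V] (e : ν → V)
    (α : ν → V →ₗ[ℝ] ℝ)
    (h : ∀ x, x = ∑ i, α i x • e i) (f : V →ₗ[ℝ] V) :
    LinearMap.trace ℝ V f = ∑ i, α i (f (e i)) := by
  have : f = ∑ i, (α i).smulRight (f (e i)) := by
    ext x
    conv_lhs => rw [h x]
    simp [LinearMap.sum_apply]
  conv_lhs => rw [this]
  simp [LinearMap.trace_smulRight]

theorem IsFrame.trace_eq [Module.Finite ℝ V] {e : ι → V} (he : IsFrame g ⊤ e) (f : V →ₗ[ℝ] V) :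
    LinearMap.trace ℝ V f = ∑ i, g (f (e i)) (e i) :=
  trace_eq_sum_coord e (fun i => g.flip (e i)) (fun x => he.expand x trivial) f

theorem IsFrame.smul {e : ι → V} (he : IsFrame g U e) {c : ℝ} (hc : 0 < c) :
    IsFrame (c • g) U (fun i => (Real.sqrt c)⁻¹ • e i) := by
  have h1 : (Real.sqrt c) ^ 2 = c := Real.sq_sqrt hc.le
  have h2 : Real.sqrt c ≠ 0 := (Real.sqrt_pos.2 hc).ne'
  have h3 : c * (Real.sqrt c)⁻¹ * (Real.sqrt c)⁻¹ = 1 := by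
    field_simp
    exact h1.symm
  refine ⟨fun i => U.smul_mem _ (he.mem i), fun i j => ?_, fun x hx => ?_⟩
  · simp only [LinearMap.smul_apply, map_smul, smul_eq_mul, he.orth]
    split_ifs
    · linarith
    · simp
  · conv_lhs => rw [he.expand x hx]
    refine Finset.sum_congr rfl fun i _ => ?_
    simp only [LinearMap.smul_apply, map_smul, smul_eq_mul, smul_smul]
    congr 1
    linear_combination (-(g x (e i))) * h3

theorem IsFrame.congr {g' : LinearMap.BilinForm ℝ V} {e : ι → V} (he : IsFrame g U e)
    (h : ∀ x ∈ U, ∀ y ∈ U, g' x y = g x y) : IsFrame g' U e :=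
  ⟨he.mem, fun i j => by rw [h _ (he.mem i) _ (he.mem j), he.orth], fun x hx => by
    conv_lhs => rw [he.expand x hx]
    exact Finset.sum_congr rfl fun i _ => by rw [h x hx _ (he.mem i)]⟩

/-- The union of orthonormal frames of two orthogonal subspaces. -/
theorem IsFrame.sum_elim {W : Submodule ℝ V} {e : ι → V} {f : κ → V} (he : IsFrame g U e)
    (hf : IsFrame g W f) (h : ∀ x ∈ U, ∀ y ∈ W, g x y = 0) (h' : ∀ x ∈ W, ∀ y ∈ U, g x y = 0) :
    IsFrame g (U ⊔ W) (Sum.elim e f) := by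
  refine ⟨?_, ?_, ?_⟩
  · rintro (i | j)
    · exact Submodule.mem_sup_left (he.mem i)
    · exact Submodule.mem_sup_right (hf.mem j)
  · rintro (i | j) (i' | j')
    · simp [he.orth]
    · simp [h _ (he.mem i) _ (hf.mem j')]
    · simp [h' _ (hf.mem j) _ (he.mem i')]
    · simp [hf.orth]
  · intro x hx
    obtain ⟨u, hu, w, hw, rfl⟩ := Submodule.mem_sup.1 hx
    simp only [Fintype.sum_sum_type, Sum.elim_inl, Sum.elim_inr, map_add, LinearMap.add_apply]
    conv_lhs => rw [he.expand u hu, hf.expand w hw]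
    congr 1
    · exact Finset.sum_congr rfl fun i _ => by rw [h' w hw _ (he.mem i), add_zero]
    · exact Finset.sum_congr rfl fun i _ => by rw [h u hu _ (hf.mem i), zero_add]

open Matrix in
/-- `tr_X Y` is computed in an `X`-orthonormal frame. -/
theorem trForm_eq_sum [Module.Finite ℝ V] {X Y : V → V → ℝ} (BX BY : LinearMap.BilinForm ℝ V)
    (hX : ∀ x y, X x y = BX x y) (hY : ∀ x y, Y x y = BY x y) {e : ι → V}
    (he : IsFrame BX ⊤ e) (hs : ∀ x y, BX x y = BX y x) :
    trForm X Y = ∑ i, BY (e i) (e i) := by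
  -- `M` and `N` are the mutually inverse transition matrices between the basis `b`, in which
  -- `trForm` is defined, and the frame `e`
  let b := Module.finBasis ℝ V
  let M : Matrix (Fin (Module.finrank ℝ V)) ι ℝ := Matrix.of fun i k => BX (b i) (e k)
  let N : Matrix ι (Fin (Module.finrank ℝ V)) ℝ := Matrix.of fun k i => b.repr (e k) i
  let Z : Matrix ι ι ℝ := Matrix.of fun k l => BY (e k) (e l)
  have hMN : M * N = 1 := by
    ext i j
    have h1 := congrArg (fun v => b.repr v j) (he.expand (b i) trivial)
    simp only [map_sum, map_smul, Finsupp.coe_finsetSum, Finset.sum_apply, Finsupp.smul_apply,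
      smul_eq_mul, Module.Basis.repr_self] at h1
    rw [Matrix.mul_apply, Matrix.one_apply]
    simp only [M, N, Matrix.of_apply]
    rw [← h1, Finsupp.single_apply]
  have hNM : N * M = 1 := by
    ext k l
    have h1 : e k = ∑ i, b.repr (e k) i • b i := (b.sum_repr (e k)).symm
    rw [Matrix.mul_apply, Matrix.one_apply, ← he.orth k l]
    rw [show BX (e k) (e l) = BX (∑ i, b.repr (e k) i • b i) (e l) by rw [← h1]]
    simp only [M, N, map_sum, map_smul, LinearMap.sum_apply, LinearMap.smul_apply, smul_eq_mul,
      Matrix.of_apply]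
  have hX' : gram X = M * Mᵀ := by
    ext i j
    rw [Matrix.mul_apply]
    simp only [gram, Matrix.of_apply, hX, M, Matrix.transpose_apply]
    rw [he.parseval _ _ trivial]
    exact Finset.sum_congr rfl fun k _ => by rw [hs (e k)]
  have hY' : gram Y = M * Z * Mᵀ := by
    ext i j
    simp only [Matrix.mul_apply, gram, Matrix.of_apply, hY, M, Z, Matrix.transpose_apply]
    change BY (b i) (b j) = _
    conv_lhs => rw [he.expand (b i) trivial, he.expand (b j) trivial]
    simp only [map_sum, LinearMap.sum_apply, map_smul, LinearMap.smul_apply, smul_eq_mul]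
    refine Finset.sum_congr rfl fun k _ => ?_
    rw [Finset.sum_mul, Finset.mul_sum]
    exact Finset.sum_congr rfl fun l _ => by ring
  have hNM' : Mᵀ * Nᵀ = 1 := by rw [← Matrix.transpose_mul, hNM, Matrix.transpose_one]
  have hinv : (gram X)⁻¹ = Nᵀ * N := by
    apply Matrix.inv_eq_right_inv
    rw [hX', Matrix.mul_assoc, ← Matrix.mul_assoc Mᵀ, hNM', Matrix.one_mul, hMN]
  have : (gram X)⁻¹ * gram Y = Nᵀ * (Z * Mᵀ) := by
    rw [hinv, hY', Matrix.mul_assoc, Matrix.mul_assoc M, ← Matrix.mul_assoc N, hNM, Matrix.one_mul]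
  unfold trForm
  rw [this, Matrix.trace_mul_comm, Matrix.mul_assoc, hNM', Matrix.mul_one]
  rfl

end Frames

/-! ### The Ricci curvature in directions of Killing fields -/

section ChartRicci

variable {n : ℕ}

local notation "𝔼" => EuclideanSpace ℝ (Fin n)

/-- The covariant derivative `u ↦ ∇_u X` of a vector field. -/
def covDeriv (G : 𝔼 → 𝔼 →L[ℝ] 𝔼 →L[ℝ] ℝ) (X : 𝔼 → 𝔼) (y : 𝔼) : 𝔼 →L[ℝ] 𝔼 :=
  fderiv ℝ X y + (christoffelMap G y).flip (X y)

lemma covDeriv_apply (G : 𝔼 → 𝔼 →L[ℝ] 𝔼 →L[ℝ] ℝ) (X : 𝔼 → 𝔼) (y u : 𝔼) :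
    covDeriv G X y u = fderiv ℝ X y u + christoffelMap G y u (X y) := rfl

variable {G : EuclideanSpace ℝ (Fin n) → EuclideanSpace ℝ (Fin n) →L[ℝ]
  EuclideanSpace ℝ (Fin n) →L[ℝ] ℝ} {y : EuclideanSpace ℝ (Fin n)}

/-- `∇X` is skew-symmetric for a Killing field `X`. -/
lemma IsKillingNear.covDeriv_skew {X : 𝔼 → 𝔼} (hG : IsMetricNear G y) (hX : IsKillingNear G X y)
    (u w : 𝔼) : G y (covDeriv G X y u) w + G y u (covDeriv G X y w) = 0 := by
  have h1 := hX.eq.self_of_nhds u w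
  have h2 := hG.compatible (X y) u w
  simp only [covDeriv_apply, map_add, add_apply]
  rw [hG.christoffelMap_symm u, hG.christoffelMap_symm w]
  linarith

/-- Koszul's formula for `∇_Y X` in Killing fields, in terms of Lie brackets. -/
lemma koszul_killing {X Y Z : 𝔼 → 𝔼} (hG : IsMetricNear G y) (hX : IsKillingNear G X y)
    (hY : IsKillingNear G Y y) (hZ : IsKillingNear G Z y) :
    2 * G y (covDeriv G X y (Y y)) (Z y) =
      G y (fderiv ℝ X y (Y y) - fderiv ℝ Y y (X y)) (Z y)
      + G y (fderiv ℝ Z y (Y y) - fderiv ℝ Y y (Z y)) (X y)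
      + G y (fderiv ℝ Z y (X y) - fderiv ℝ X y (Z y)) (Y y) := by
  have t : ∀ A B : 𝔼 → 𝔼, fderiv ℝ A y (B y) - fderiv ℝ B y (A y)
      = covDeriv G A y (B y) - covDeriv G B y (A y) := by
    intro A B
    rw [covDeriv_apply, covDeriv_apply, hG.christoffelMap_symm (A y)]
    abel
  rw [t, t, t]
  simp only [map_sub, sub_apply]
  have s := hG.symm.self_of_nhds
  have x1 := hX.covDeriv_skew hG (Y y) (Z y)
  have x2 := hY.covDeriv_skew hG (X y) (Z y)
  have x3 := hZ.covDeriv_skew hG (X y) (Y y)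
  have s1 := s (X y) (covDeriv G Y y (Z y))
  have s2 := s (X y) (covDeriv G Z y (Y y))
  have s3 := s (Y y) (covDeriv G X y (Z y))
  linarith

lemma IsMetricNear.chartCurvature_eq (hG : IsMetricNear G y) (u v w : 𝔼) :
    chartCurvature G y u v w = fderiv ℝ (christoffelMap G) y u v w
      - fderiv ℝ (christoffelMap G) y v u w + christoffelMap G y u (christoffelMap G y v w)
      - christoffelMap G y v (christoffelMap G y u w) := by
  have dC := (hG.contDiffAt_christoffelMap.differentiableAt (by simp)).hasFDerivAt
  have t : ∀ a b c : 𝔼, fderiv ℝ (fun z => christoffel G z a b) y c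
      = fderiv ℝ (christoffelMap G) y c a b := by
    intro a b c
    have h := (dC.clm_apply (hasFDerivAt_const a y)).clm_apply (hasFDerivAt_const b y)
    have h2 := h.fderiv
    change fderiv ℝ (fun z => christoffel G z a b) y = _ at h2
    rw [h2]
    simp
  unfold chartCurvature
  rw [t, t]
  rfl

/-- For a Killing field `X`, `∇_u ∇_Y X = R(u, X) Y + ∇_{∇_u Y} X`. -/
lemma IsKillingNear.covDeriv_covDeriv {X Y : 𝔼 → 𝔼} (hG : IsMetricNear G y)
    (hX : IsKillingNear G X y) (hY : ContDiffAt ℝ ∞ Y y) (u : 𝔼) :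
    covDeriv G (fun z => covDeriv G X z (Y z)) y u
      = chartCurvature G y u (X y) (Y y) + covDeriv G X y (covDeriv G Y y u) := by
  have cX := hX.smooth.self_of_nhds
  have dX := (cX.differentiableAt (by simp)).hasFDerivAt
  have dY := (hY.differentiableAt (by simp)).hasFDerivAt
  have ddX := ((cX.fderiv_right (m := ∞) (by simp)).differentiableAt (by simp)).hasFDerivAt
  have dC := (hG.contDiffAt_christoffelMap.differentiableAt (by simp)).hasFDerivAt
  have h1 := (ddX.clm_apply dY).add ((dC.clm_apply dY).clm_apply dX)
  have h2 := h1.fderiv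
  change fderiv ℝ (fun z => covDeriv G X z (Y z)) y = _ at h2
  rw [covDeriv_apply, h2, hG.chartCurvature_eq]
  simp only [covDeriv_apply, add_apply, map_add, ContinuousLinearMap.comp_apply,
    ContinuousLinearMap.flip_apply]
  have k := hX.lieDeriv_christoffelMap hG u (Y y)
  have s1 := hG.christoffelMap_symm (X y)
  have s2 := hG.christoffelMap_symm (Y y)
  have s3 : fderiv ℝ (christoffelMap G) y u (Y y) (X y)
      = fderiv ℝ (christoffelMap G) y u (X y) (Y y) := by
    have a1 := (dC.clm_apply (hasFDerivAt_const (Y y) y)).clm_apply (hasFDerivAt_const (X y) y)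
    have a2 := (dC.clm_apply (hasFDerivAt_const (X y) y)).clm_apply (hasFDerivAt_const (Y y) y)
    have a3 := a1.congr_of_eventuallyEq (f₁ := fun z => christoffelMap G z (X y) (Y y)) (by
      filter_upwards [hG.eventually] with z hz using hz.christoffelMap_symm _ _)
    have := DFunLike.congr_fun (a3.unique a2) u
    simpa using this
  rw [s3, s2 (fderiv ℝ X y u), s2 (X y), s1 (christoffelMap G y u (Y y))]
  rw [← sub_eq_zero, ← k]
  abel

/-- The value of a metric at a point, as a bilinear form. -/
def pointForm (G : 𝔼 → 𝔼 →L[ℝ] 𝔼 →L[ℝ] ℝ) (y : 𝔼) : LinearMap.BilinForm ℝ 𝔼 :=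
  LinearMap.mk₂ ℝ (fun v w => G y v w) (by simp) (by simp) (by simp) (by simp)

lemma sum_single_eq_trace (f : 𝔼 →ₗ[ℝ] 𝔼) :
    ∑ i, f (EuclideanSpace.single i 1) i = LinearMap.trace ℝ 𝔼 f := by
  rw [trace_eq_sum_coord (fun i => EuclideanSpace.single i (1 : ℝ))
    (fun i => (EuclideanSpace.proj (𝕜 := ℝ) i : 𝔼 →L[ℝ] ℝ).toLinearMap)]
  · rfl
  · intro x
    ext j
    simp [Finset.sum_apply, Pi.single_apply]

/-- The Ricci curvature in directions of Killing fields that span the tangent space and form a Lie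
algebra of vector fields, in terms of the Lie bracket: the trace over `u` of the identity
`R(u, X) Y = ∇_u ∇_Y X - ∇_{∇_u Y} X`. The three sums are the derivatives of the scalar products in
Koszul's formula for `∇_Y X`, a correction by `Z`, an element of `L` whose field takes the value
`∇_Y X` at `y`, and the trace of `∇X ∘ ∇Y`. The sum with `Z` vanishes for unimodular actions. -/
theorem chartRicci_eq {L : Type*} [LieRing L] [LieAlgebra ℝ L] (ξ : 𝔼 → L →ₗ[ℝ] 𝔼)
    (hG : IsMetricNear G y) (hK : ∀ X, IsKillingNear G (fun z => ξ z X) y)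
    (hbr : ∀ᶠ z in 𝓝 y, ∀ X Y : L, fderiv ℝ (fun x => ξ x X) z (ξ z Y)
      - fderiv ℝ (fun x => ξ x Y) z (ξ z X) = ξ z ⁅X, Y⁆)
    (hsurj : Function.Surjective (ξ y))
    (q : LinearMap.BilinForm ℝ L) (hq : ∀ X Y, q X Y = G y (ξ y X) (ξ y Y))
    {ι : Type*} [Fintype ι] [DecidableEq ι] (e : ι → L)
    (he : IsFrame (pointForm G y) ⊤ (fun i => ξ y (e i))) (X Y : L) :
    ∃ Z : L, chartRicci G y (ξ y X) (ξ y Y) =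
      ∑ i, (1 / 2) * (q ⁅⁅X, Y⁆, e i⁆ (e i) + q ⁅⁅e i, Y⁆, e i⁆ X + q ⁅e i, Y⁆ ⁅X, e i⁆
        + q ⁅⁅e i, X⁆, e i⁆ Y + q ⁅e i, X⁆ ⁅Y, e i⁆)
      - ∑ i, q ⁅Z, e i⁆ (e i)
      + ∑ i, ∑ j, ((1 / 2) * (q ⁅X, e i⁆ (e j) + q ⁅e j, e i⁆ X + q ⁅e j, X⁆ (e i)))
        * ((1 / 2) * (q ⁅Y, e i⁆ (e j) + q ⁅e j, e i⁆ Y + q ⁅e j, Y⁆ (e i))) := by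
  set F : L → 𝔼 → 𝔼 := fun X z => ξ z X with hF
  set V : 𝔼 → 𝔼 := fun z => covDeriv G (F X) z (F Y z) with hV
  obtain ⟨Z, hZ⟩ := hsurj (V y)
  refine ⟨Z, ?_⟩
  have s := hG.symm.self_of_nhds
  have cF : ∀ X, ContDiffAt ℝ ∞ (F X) y := fun X => (hK X).smooth.self_of_nhds
  -- Koszul's formula in a neighbourhood
  have kos : ∀ A B C : L, ∀ᶠ z in 𝓝 y, 2 * G z (covDeriv G (F A) z (F B z)) (F C z)
      = G z (F ⁅A, B⁆ z) (F C z) + G z (F ⁅C, B⁆ z) (F A z) + G z (F ⁅C, A⁆ z) (F B z) := by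
    intro A B C
    filter_upwards [hG.eventually, (hK A).eventually, (hK B).eventually, (hK C).eventually, hbr]
      with z h1 h2 h3 h4 h5
    rw [koszul_killing h1 h2 h3 h4, h5, h5, h5]
  have kos' : ∀ A B C : L, 2 * G y (covDeriv G (F A) y (F B y)) (F C y)
      = q ⁅A, B⁆ C + q ⁅C, B⁆ A + q ⁅C, A⁆ B := by
    intro A B C
    rw [(kos A B C).self_of_nhds, hq, hq, hq]
  -- the derivative of `q(U, W)` along a Killing field
  have dq : ∀ U W E : L, HasFDerivAt (fun z => G z (F U z) (F W z))
      (fderiv ℝ (fun z => G z (F U z) (F W z)) y) y ∧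
      fderiv ℝ (fun z => G z (F U z) (F W z)) y (F E y) = q ⁅U, E⁆ W + q U ⁅W, E⁆ := by
    intro U W E
    have dG := (hG.smooth.self_of_nhds.differentiableAt (by simp)).hasFDerivAt
    have dU := ((cF U).differentiableAt (by simp)).hasFDerivAt
    have dW := ((cF W).differentiableAt (by simp)).hasFDerivAt
    have h1 := (dG.clm_apply dU).clm_apply dW
    refine ⟨h1.differentiableAt.hasFDerivAt, ?_⟩
    rw [h1.fderiv, hq, hq, ← hbr.self_of_nhds U E, ← hbr.self_of_nhds W E]
    have := (hK E).eq.self_of_nhds (F U y) (F W y)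
    simp only [add_apply, ContinuousLinearMap.comp_apply, ContinuousLinearMap.flip_apply,
      map_sub, sub_apply]
    simp only [hF] at *
    linarith
  -- the divergence of `V`
  have div : ∀ i, G y (covDeriv G V y (F (e i) y)) (F (e i) y)
      = (1 / 2) * (q ⁅⁅X, Y⁆, e i⁆ (e i) + q ⁅⁅e i, Y⁆, e i⁆ X + q ⁅e i, Y⁆ ⁅X, e i⁆
        + q ⁅⁅e i, X⁆, e i⁆ Y + q ⁅e i, X⁆ ⁅Y, e i⁆) - q ⁅Z, e i⁆ (e i) := by
    intro i
    have dG := (hG.smooth.self_of_nhds.differentiableAt (by simp)).hasFDerivAt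
    have dE := ((cF (e i)).differentiableAt (by simp)).hasFDerivAt
    have cV : ContDiffAt ℝ ∞ V y := by
      have cX := cF X
      refine ContDiffAt.add ((cX.fderiv_right (m := ∞) (by simp)).clm_apply (cF Y)) ?_
      exact (hG.contDiffAt_christoffelMap.clm_apply (cF Y)).clm_apply cX
    have dV := (cV.differentiableAt (by simp)).hasFDerivAt
    have h1 := (dG.clm_apply dV).clm_apply dE
    have h2 := (((dq ⁅X, Y⁆ (e i) (e i)).1.add (dq ⁅e i, Y⁆ X (e i)).1).add
      (dq ⁅e i, X⁆ Y (e i)).1).const_mul (1 / 2 : ℝ)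
    have h3 := h2.congr_of_eventuallyEq (f₁ := fun z => G z (V z) (F (e i) z)) (by
      filter_upwards [kos X Y (e i)] with z hz
      simp only [Pi.add_apply]
      rw [← hz]
      ring)
    have h4 := DFunLike.congr_fun (h1.unique h3) (F (e i) y)
    simp only [add_apply, ContinuousLinearMap.comp_apply, ContinuousLinearMap.flip_apply,
      smul_apply, smul_eq_mul] at h4
    rw [(dq ⁅X, Y⁆ (e i) (e i)).2, (dq ⁅e i, Y⁆ X (e i)).2, (dq ⁅e i, X⁆ Y (e i)).2,
      lie_self, map_zero] at h4
    have h5 := hG.compatible (F (e i) y) (V y) (F (e i) y)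
    have h6 := kos' (e i) (e i) Z
    rw [lie_self, map_zero, LinearMap.zero_apply] at h6
    have h7 : F Z y = V y := hZ
    rw [h7, s] at h6
    have h8 : covDeriv G V y (F (e i) y) = fderiv ℝ V y (F (e i) y)
      + christoffelMap G y (F (e i) y) (V y) := rfl
    have h9 : covDeriv G (F (e i)) y (F (e i) y) = fderiv ℝ (F (e i)) y (F (e i) y)
      + christoffelMap G y (F (e i) y) (F (e i) y) := rfl
    rw [h9, map_add] at h6
    rw [h8, map_add, add_apply]
    linarith
  -- the trace of the Ricci identity
  have tr1 : LinearMap.trace ℝ 𝔼 (covDeriv G V y).toLinearMap = chartRicci G y (ξ y X) (ξ y Y)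
      + LinearMap.trace ℝ 𝔼 ((covDeriv G (F X) y).toLinearMap ∘ₗ
        (covDeriv G (F Y) y).toLinearMap) := by
    rw [← sum_single_eq_trace, ← sum_single_eq_trace]
    unfold chartRicci
    rw [← Finset.sum_add_distrib]
    refine Finset.sum_congr rfl fun i _ => ?_
    have := (hK X).covDeriv_covDeriv hG (cF Y) (EuclideanSpace.single i 1)
    exact congrArg (fun v : 𝔼 => v i) this
  rw [he.trace_eq, he.trace_eq] at tr1
  have e1 : ∀ v w, pointForm G y v w = G y v w := fun v w => rfl
  have tr2 : ∀ i, pointForm G y (((covDeriv G (F X) y).toLinearMap ∘ₗ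
        (covDeriv G (F Y) y).toLinearMap) (ξ y (e i))) (ξ y (e i)) =
      - ∑ j, ((1 / 2) * (q ⁅X, e i⁆ (e j) + q ⁅e j, e i⁆ X + q ⁅e j, X⁆ (e i)))
        * ((1 / 2) * (q ⁅Y, e i⁆ (e j) + q ⁅e j, e i⁆ Y + q ⁅e j, Y⁆ (e i))) := by
    intro i
    have h1 := (hK X).covDeriv_skew hG (covDeriv G (F Y) y (ξ y (e i))) (ξ y (e i))
    change G y (covDeriv G (F X) y (covDeriv G (F Y) y (ξ y (e i)))) (ξ y (e i)) = _
    have h2 := he.parseval (covDeriv G (F Y) y (ξ y (e i))) (covDeriv G (F X) y (ξ y (e i)))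
      trivial
    simp only [e1] at h2
    have h3 : ∀ A : L, ∀ j, G y (covDeriv G (F A) y (ξ y (e i))) (ξ y (e j))
        = (1 / 2) * (q ⁅A, e i⁆ (e j) + q ⁅e j, e i⁆ A + q ⁅e j, A⁆ (e i)) := by
      intro A j
      rw [← kos' A (e i) (e j)]
      simp only [hF]
      ring
    have h4 : G y (covDeriv G (F Y) y (ξ y (e i))) (covDeriv G (F X) y (ξ y (e i))) =
        ∑ j, ((1 / 2) * (q ⁅X, e i⁆ (e j) + q ⁅e j, e i⁆ X + q ⁅e j, X⁆ (e i)))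
        * ((1 / 2) * (q ⁅Y, e i⁆ (e j) + q ⁅e j, e i⁆ Y + q ⁅e j, Y⁆ (e i))) := by
      rw [h2]
      refine Finset.sum_congr rfl fun j _ => ?_
      rw [s (ξ y (e j)), h3, h3, mul_comm]
    rw [← h4]
    linarith
  rw [Finset.sum_congr rfl fun i _ => tr2 i, Finset.sum_neg_distrib] at tr1
  have tr3 : ∑ i, pointForm G y ((covDeriv G V y).toLinearMap (ξ y (e i))) (ξ y (e i)) = _ :=
    Finset.sum_congr rfl fun i _ => div i
  rw [tr3, Finset.sum_sub_distrib] at tr1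
  linarith

end ChartRicci

/-! ### Invariant forms on the Lie algebra and their Ricci form -/

section Algebra

variable {L : Type*} [LieRing L] [LieAlgebra ℝ L]

/-- `Q` is an `ad`-invariant scalar product on `L` and `h₀` is closed under brackets. The
`Q`-orthogonal complement of `h₀` is then a reductive complement. -/
structure IsReductivePair (Q : LinearMap.BilinForm ℝ L) (h₀ : Submodule ℝ L) : Prop where
  symm : ∀ x y, Q x y = Q y x
  pos : ∀ x, x ≠ 0 → 0 < Q x x
  skew : ∀ z x y : L, Q ⁅z, x⁆ y + Q x ⁅z, y⁆ = 0
  lie_mem : ∀ x ∈ h₀, ∀ y ∈ h₀, ⁅x, y⁆ ∈ h₀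

/-- A form on `L` which corresponds to an `ad h₀`-invariant scalar product on `L / h₀`: it is
positive semidefinite with kernel `h₀`. This describes a scalar product on the complement of `h₀`
without the choice of a projection. -/
structure IsInvForm (h₀ : Submodule ℝ L) (g : LinearMap.BilinForm ℝ L) : Prop where
  symm : ∀ x y, g x y = g y x
  pos : ∀ x, x ∉ h₀ → 0 < g x x
  ker : ∀ x ∈ h₀, ∀ y, g x y = 0
  skew : ∀ w ∈ h₀, ∀ x y : L, g ⁅w, x⁆ y + g x ⁅w, y⁆ = 0

/-- Symmetrization of a double sum. -/
lemma sum_sum_symmetrize {ι : Type*} [Fintype ι] (F : ι → ι → ℝ) :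
    ∑ i, ∑ j, F i j = (1 / 2) * ∑ i, ∑ j, (F i j + F j i) := by
  simp only [Finset.sum_add_distrib]
  rw [Finset.sum_comm (f := fun i j => F j i)]
  ring

lemma mem_ominus {Q : LinearMap.BilinForm ℝ L} {U W : Submodule ℝ L} {x : L} :
    x ∈ ominus Q U W ↔ x ∈ U ∧ ∀ w ∈ W, Q w x = 0 := Iff.rfl

/-- `P` is the `Q`-orthogonal projection of `L` onto `U`. -/
structure IsOrthProj (Q : LinearMap.BilinForm ℝ L) (U : Submodule ℝ L) (P : L →ₗ[ℝ] L) : Prop where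
  mem : ∀ x, P x ∈ U
  orth : ∀ x, ∀ u ∈ U, Q (x - P x) u = 0

variable {Q : LinearMap.BilinForm ℝ L} {h₀ : Submodule ℝ L}

section FiniteDim

variable [Module.Finite ℝ L]

lemma exists_isOrthProj (hQ : IsReductivePair Q h₀) (U : Submodule ℝ L) :
    ∃ P, IsOrthProj Q U P := by
  obtain ⟨v, hv⟩ := exists_frame Q U hQ.symm (fun x _ => hQ.pos x)
  refine ⟨∑ i, (Q.flip (v i)).smulRight (v i), ⟨fun x => ?_, fun x u hu => ?_⟩⟩
  · rw [LinearMap.sum_apply]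
    exact U.sum_mem fun i _ => U.smul_mem _ (hv.mem i)
  · rw [hQ.symm, map_sub, hv.parseval u x hu, sub_eq_zero, LinearMap.sum_apply, map_sum]
    refine Finset.sum_congr rfl fun i _ => ?_
    simp [hQ.symm x, mul_comm]

end FiniteDim

lemma IsOrthProj.mem_compl {U : Submodule ℝ L} {P : L →ₗ[ℝ] L} (hP : IsOrthProj Q U P)
    (hQ : IsReductivePair Q h₀) (x : L) : x - P x ∈ ominus Q ⊤ U :=
  mem_ominus.2 ⟨trivial, fun w hw => by rw [hQ.symm]; exact hP.orth x w hw⟩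

lemma IsReductivePair.eq_zero_of_mem (hQ : IsReductivePair Q h₀) {U : Submodule ℝ L} {x : L}
    (hx : x ∈ U) (hx' : ∀ u ∈ U, Q x u = 0) : x = 0 := by
  by_contra h
  exact (hQ.pos x h).ne' (hx' x hx)

lemma IsReductivePair.nonneg (hQ : IsReductivePair Q h₀) (x : L) : 0 ≤ Q x x := by
  by_cases h : x = 0
  · simp [h]
  · exact (hQ.pos x h).le

lemma IsOrthProj.unique {U : Submodule ℝ L} {P : L →ₗ[ℝ] L} (hP : IsOrthProj Q U P)
    (hQ : IsReductivePair Q h₀) {x y : L} (hy : y ∈ U) (h : ∀ u ∈ U, Q (x - y) u = 0) :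
    P x = y := by
  rw [← sub_eq_zero]
  refine hQ.eq_zero_of_mem (U.sub_mem (hP.mem x) hy) fun u hu => ?_
  have h1 := h u hu
  have h2 := hP.orth x u hu
  simp only [map_sub, LinearMap.sub_apply] at *
  linarith

lemma IsOrthProj.apply_mem {U : Submodule ℝ L} {P : L →ₗ[ℝ] L} (hP : IsOrthProj Q U P)
    (hQ : IsReductivePair Q h₀) {x : L} (hx : x ∈ U) : P x = x :=
  hP.unique hQ hx (by simp)

lemma IsOrthProj.proj_eq {U : Submodule ℝ L} {P : L →ₗ[ℝ] L} (hP : IsOrthProj Q U P)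
    (hQ : IsReductivePair Q h₀) (x : L) : (proj Q U x : L) = P x := by
  have h : ∀ u : U, Q (x - (proj Q U x : U)) u = 0 :=
    Classical.epsilon_spec (p := fun y : U => ∀ u : U, Q (x - y) u = 0)
      ⟨⟨P x, hP.mem x⟩, fun u => hP.orth x u u.2⟩
  exact (hP.unique hQ (proj Q U x).2 fun u hu => h ⟨u, hu⟩).symm

lemma IsReductivePair.lie_mem_compl (hQ : IsReductivePair Q h₀) {w x : L} (hw : w ∈ h₀)
    (hx : x ∈ ominus Q ⊤ h₀) : ⁅w, x⁆ ∈ ominus Q ⊤ h₀ := by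
  refine mem_ominus.2 ⟨trivial, fun u hu => ?_⟩
  have h1 := hQ.skew w u x
  have h2 := (mem_ominus.1 hx).2 _ (hQ.lie_mem w hw u hu)
  linarith

lemma IsInvForm.ker' {g : LinearMap.BilinForm ℝ L} (hg : IsInvForm h₀ g) (x : L) {y : L}
    (hy : y ∈ h₀) : g x y = 0 := by rw [hg.symm, hg.ker y hy]

lemma IsInvForm.nonneg {g : LinearMap.BilinForm ℝ L} (hg : IsInvForm h₀ g) (x : L) :
    0 ≤ g x x := by
  by_cases h : x ∈ h₀
  · rw [hg.ker x h]
  · exact (hg.pos x h).le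

lemma IsReductivePair.notMem (hQ : IsReductivePair Q h₀) {x : L}
    (hx : x ∈ ominus Q ⊤ h₀) (h : x ≠ 0) : x ∉ h₀ :=
  fun h' => (hQ.pos x h).ne' ((mem_ominus.1 hx).2 x h')

lemma IsInvForm.pos_compl {g : LinearMap.BilinForm ℝ L} (hg : IsInvForm h₀ g)
    (hQ : IsReductivePair Q h₀) (x : L) (hx : x ∈ ominus Q ⊤ h₀) (h : x ≠ 0) : 0 < g x x :=
  hg.pos x (hQ.notMem hx h)

variable {ι κ : Type*} [Fintype ι] [DecidableEq ι] [Fintype κ] [DecidableEq κ]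

/-- The coordinates of a vector in the union of a `Q`-frame of `h₀` and a `g`-frame of its
complement. -/
lemma IsInvForm.expand [Module.Finite ℝ L] (hQ : IsReductivePair Q h₀)
    {g : LinearMap.BilinForm ℝ L}
    (hg : IsInvForm h₀ g) {e : ι → L} (he : IsFrame g (ominus Q ⊤ h₀) e) {v : κ → L}
    (hv : IsFrame Q h₀ v) (x : L) : x = ∑ a, Q x (v a) • v a + ∑ i, g x (e i) • e i := by
  obtain ⟨P, hP⟩ := exists_isOrthProj hQ h₀
  have h1 : P x = ∑ a, Q x (v a) • v a := by
    rw [hv.expand _ (hP.mem x)]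
    refine Finset.sum_congr rfl fun a _ => ?_
    have := hP.orth x _ (hv.mem a)
    rw [map_sub, LinearMap.sub_apply, sub_eq_zero] at this
    rw [this]
  have h2 : x - P x = ∑ i, g x (e i) • e i := by
    rw [he.expand _ (hP.mem_compl hQ x)]
    refine Finset.sum_congr rfl fun i _ => ?_
    rw [map_sub, LinearMap.sub_apply, hg.ker _ (hP.mem x), sub_zero]
  rw [← h1, ← h2]
  abel

lemma IsInvForm.trace_eq [Module.Finite ℝ L] (hQ : IsReductivePair Q h₀)
    {g : LinearMap.BilinForm ℝ L}
    (hg : IsInvForm h₀ g) {e : ι → L} (he : IsFrame g (ominus Q ⊤ h₀) e) {v : κ → L}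
    (hv : IsFrame Q h₀ v) (f : L →ₗ[ℝ] L) :
    LinearMap.trace ℝ L f = ∑ a, Q (f (v a)) (v a) + ∑ i, g (f (e i)) (e i) := by
  rw [trace_eq_sum_coord (Sum.elim v e)
    (Sum.elim (fun a => Q.flip (v a)) (fun i => g.flip (e i)))]
  · simp
  · intro x
    simpa using hg.expand hQ he hv x

/-- Unimodularity: `ad z` is traceless since it is `Q`-skew, and it induces a traceless map on
`L / h₀` in the sense of any invariant form. -/
lemma IsInvForm.sum_lie_eq_zero [Module.Finite ℝ L] (hQ : IsReductivePair Q h₀)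
    {g : LinearMap.BilinForm ℝ L}
    (hg : IsInvForm h₀ g) {e : ι → L} (he : IsFrame g (ominus Q ⊤ h₀) e) (z : L) :
    ∑ i, g ⁅z, e i⁆ (e i) = 0 := by
  have hz : ∀ x : L, Q ⁅z, x⁆ x = 0 := fun x => by
    have := hQ.skew z x x
    rw [hQ.symm x] at this
    linarith
  obtain ⟨v, hv⟩ := exists_frame Q h₀ hQ.symm (fun x _ => hQ.pos x)
  obtain ⟨u, hu⟩ := exists_frame Q ⊤ hQ.symm (fun x _ => hQ.pos x)
  have h1 := hg.trace_eq hQ he hv (LieAlgebra.ad ℝ L z)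
  rw [hu.trace_eq] at h1
  simpa [hz] using h1.symm

/-- The algebraic expression for the Ricci curvature of an invariant metric, in a frame `e`. -/
def ricForm (g : LinearMap.BilinForm ℝ L) (e : ι → L) (X Y : L) : ℝ :=
  -(1 / 2) * killingForm ℝ L X Y - (1 / 2) * ∑ i, g ⁅X, e i⁆ ⁅Y, e i⁆
    + (1 / 4) * ∑ i, ∑ j, g ⁅e i, e j⁆ X * g ⁅e i, e j⁆ Y

/-- Expansion of the trace of `∇X ∘ ∇Y`; `x`, `y` stand for the matrices of `ad X`, `ad Y` and
`C`, `D` for the structure constants paired with `X`, `Y`. -/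
lemma sum_sum_skew_aux (x y C D : ι → ι → ℝ) (hC : ∀ i j, C j i = - C i j)
    (hD : ∀ i j, D j i = - D i j) :
    ∑ i, ∑ j, ((1 / 2) * (x i j + C j i - x j i)) * ((1 / 2) * (y i j + D j i - y j i))
      = (1 / 2) * ∑ i, ∑ j, x i j * y i j - (1 / 2) * ∑ i, ∑ j, x i j * y j i
        + (1 / 4) * ∑ i, ∑ j, C i j * D i j + (1 / 2) * ∑ i, ∑ j, C j i * y i j
        + (1 / 2) * ∑ i, ∑ j, D j i * x i j := by
  rw [sum_sum_symmetrize, sum_sum_symmetrize (fun i j => x i j * y i j), sum_sum_symmetrize (fun i j => x i j * y j i),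
    sum_sum_symmetrize (fun i j => C i j * D i j), sum_sum_symmetrize (fun i j => C j i * y i j), sum_sum_symmetrize (fun i j => D j i * x i j)]
  simp only [Finset.mul_sum, ← Finset.sum_add_distrib, ← Finset.sum_sub_distrib]
  refine Finset.sum_congr rfl fun i _ => Finset.sum_congr rfl fun j _ => ?_
  rw [hC i j, hD i j]
  ring

/-- The outcome of the computation in Killing fields is the expression `ricForm`. -/
theorem ricForm_eq [Module.Finite ℝ L] (hQ : IsReductivePair Q h₀) {g : LinearMap.BilinForm ℝ L}
    (hg : IsInvForm h₀ g) {e : ι → L} (he : IsFrame g (ominus Q ⊤ h₀) e) {X Y : L}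
    (hX : X ∈ ominus Q ⊤ h₀) (hY : Y ∈ ominus Q ⊤ h₀) (Z : L) :
    ∑ i, (1 / 2) * (g ⁅⁅X, Y⁆, e i⁆ (e i) + g ⁅⁅e i, Y⁆, e i⁆ X + g ⁅e i, Y⁆ ⁅X, e i⁆
        + g ⁅⁅e i, X⁆, e i⁆ Y + g ⁅e i, X⁆ ⁅Y, e i⁆)
      - ∑ i, g ⁅Z, e i⁆ (e i)
      + ∑ i, ∑ j, ((1 / 2) * (g ⁅X, e i⁆ (e j) + g ⁅e j, e i⁆ X + g ⁅e j, X⁆ (e i)))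
        * ((1 / 2) * (g ⁅Y, e i⁆ (e j) + g ⁅e j, e i⁆ Y + g ⁅e j, Y⁆ (e i)))
      = ricForm g e X Y := by
  obtain ⟨v, hv⟩ := exists_frame Q h₀ hQ.symm (fun x _ => hQ.pos x)
  have exp := hg.expand hQ he hv
  -- the Killing form
  have hB : killingForm ℝ L X Y = ∑ i, ∑ a, g ⁅Y, v a⁆ (e i) * Q ⁅X, e i⁆ (v a)
      + ∑ i, ∑ a, g ⁅X, v a⁆ (e i) * Q ⁅Y, e i⁆ (v a)
      + ∑ i, ∑ j, g ⁅X, e i⁆ (e j) * g ⁅Y, e j⁆ (e i) := by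
    rw [killingForm_apply_apply, hg.trace_eq hQ he hv]
    have h1 : ∀ a, Q ((LieAlgebra.ad ℝ L X ∘ₗ LieAlgebra.ad ℝ L Y) (v a)) (v a)
        = ∑ i, g ⁅Y, v a⁆ (e i) * Q ⁅X, e i⁆ (v a) := by
      intro a
      have hm : ⁅Y, v a⁆ ∈ ominus Q ⊤ h₀ := by
        rw [← lie_skew]
        exact Submodule.neg_mem _ (hQ.lie_mem_compl (hv.mem a) hY)
      have : ⁅X, ⁅Y, v a⁆⁆ = ∑ i, g ⁅Y, v a⁆ (e i) • ⁅X, e i⁆ := by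
        conv_lhs => rw [he.expand _ hm]
        simp [lie_sum]
      change Q ⁅X, ⁅Y, v a⁆⁆ (v a) = _
      rw [this]
      simp [LinearMap.sum_apply]
    have h2 : ∀ j, g ((LieAlgebra.ad ℝ L X ∘ₗ LieAlgebra.ad ℝ L Y) (e j)) (e j)
        = ∑ a, g ⁅X, v a⁆ (e j) * Q ⁅Y, e j⁆ (v a)
          + ∑ i, g ⁅X, e i⁆ (e j) * g ⁅Y, e j⁆ (e i) := by
      intro j
      have : ⁅X, ⁅Y, e j⁆⁆ = ∑ a, Q ⁅Y, e j⁆ (v a) • ⁅X, v a⁆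
          + ∑ i, g ⁅Y, e j⁆ (e i) • ⁅X, e i⁆ := by
        conv_lhs => rw [exp ⁅Y, e j⁆]
        simp [lie_sum]
      change g ⁅X, ⁅Y, e j⁆⁆ (e j) = _
      rw [this]
      simp [LinearMap.sum_apply, mul_comm]
    rw [Finset.sum_congr rfl fun a _ => h1 a, Finset.sum_congr rfl fun a _ => h2 a,
      Finset.sum_comm, Finset.sum_add_distrib,
      Finset.sum_comm (f := fun j i => g ⁅X, e i⁆ (e j) * g ⁅Y, e j⁆ (e i))]
    ring
  -- the double brackets
  have hD : ∀ A ∈ ominus Q ⊤ h₀, ∀ A' : L, ∀ i, g ⁅⁅e i, A'⁆, e i⁆ A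
      = - ∑ a, g ⁅A, v a⁆ (e i) * Q ⁅A', e i⁆ (v a)
        - ∑ j, g ⁅e j, e i⁆ A * g ⁅A', e i⁆ (e j) := by
    intro A _ A' i
    have h1 : ⁅⁅e i, A'⁆, e i⁆ = - (∑ a, Q ⁅A', e i⁆ (v a) • ⁅v a, e i⁆
          + ∑ j, g ⁅A', e i⁆ (e j) • ⁅e j, e i⁆) := by
      rw [← lie_skew (e i) A', neg_lie]
      conv_lhs => rw [exp ⁅A', e i⁆]
      simp [sum_lie]
    have h2 : ∀ a, g ⁅v a, e i⁆ A = g ⁅A, v a⁆ (e i) := by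
      intro a
      have := hg.skew (v a) (hv.mem a) (e i) A
      rw [← lie_skew A, map_neg, LinearMap.neg_apply, hg.symm _ (e i)]
      linarith
    rw [h1]
    simp only [map_neg, map_add, map_sum, map_smul, LinearMap.neg_apply, LinearMap.add_apply,
      LinearMap.sum_apply, LinearMap.smul_apply, smul_eq_mul, h2]
    rw [neg_add, sub_eq_add_neg]
    congr 2
    · exact Finset.sum_congr rfl fun a _ => mul_comm _ _
    · exact Finset.sum_congr rfl fun a _ => mul_comm _ _
  have hN : ∀ i, g ⁅X, e i⁆ ⁅Y, e i⁆ = ∑ j, g ⁅X, e i⁆ (e j) * g ⁅Y, e i⁆ (e j) := by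
    intro i
    conv_lhs => rw [exp ⁅Y, e i⁆]
    rw [map_add, map_sum, map_sum, Finset.sum_eq_zero, zero_add]
    · exact Finset.sum_congr rfl fun j _ => by rw [map_smul, smul_eq_mul, mul_comm]
    · intro a _
      rw [map_smul, hg.ker' _ (hv.mem a), smul_zero]
  have s1 : ∀ i, g ⁅e i, Y⁆ ⁅X, e i⁆ = - g ⁅X, e i⁆ ⁅Y, e i⁆ := by
    intro i
    rw [← lie_skew (e i) Y, map_neg, LinearMap.neg_apply, hg.symm]
  have s2 : ∀ i, g ⁅e i, X⁆ ⁅Y, e i⁆ = - g ⁅X, e i⁆ ⁅Y, e i⁆ := by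
    intro i
    rw [← lie_skew (e i) X, map_neg, LinearMap.neg_apply]
  have s3 : ∀ (A : L) i j, g ⁅e j, A⁆ (e i) = - g ⁅A, e j⁆ (e i) := by
    intro A i j
    rw [← lie_skew (e j) A, map_neg, LinearMap.neg_apply]
  have s4 : ∀ (A : L) i j, g ⁅e j, e i⁆ A = - g ⁅e i, e j⁆ A := by
    intro A i j
    rw [← lie_skew (e j) (e i), map_neg, LinearMap.neg_apply]
  rw [hg.sum_lie_eq_zero hQ he Z, ← Finset.mul_sum]
  simp only [Finset.sum_add_distrib]
  rw [hg.sum_lie_eq_zero hQ he ⁅X, Y⁆]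
  simp only [hD X hX Y, hD Y hY X, s1, s2, s3, ← sub_eq_add_neg]
  rw [sum_sum_skew_aux (fun i j => g ⁅X, e i⁆ (e j)) (fun i j => g ⁅Y, e i⁆ (e j))
    (fun i j => g ⁅e i, e j⁆ X) (fun i j => g ⁅e i, e j⁆ Y) (s4 X) (s4 Y)]
  unfold ricForm
  rw [hB]
  simp only [Finset.sum_sub_distrib, Finset.sum_neg_distrib, hN]
  ring

end Algebra

/-! ### The algebraic scalar curvature -/

section ScalarCurvature

variable {L : Type*} [LieRing L] [LieAlgebra ℝ L] [Module.Finite ℝ L]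
  {Q : LinearMap.BilinForm ℝ L} {h₀ : Submodule ℝ L}
  {ι κ ι' κ' : Type*} [Fintype ι] [DecidableEq ι] [Fintype κ] [DecidableEq κ]
  [Fintype ι'] [DecidableEq ι'] [Fintype κ'] [DecidableEq κ']

/-- The algebraic expression for the scalar curvature of an invariant metric, in a frame `e`. -/
def scal (g : LinearMap.BilinForm ℝ L) (e : ι → L) : ℝ :=
  -(1 / 2) * ∑ i, killingForm ℝ L (e i) (e i) - (1 / 4) * ∑ i, ∑ j, g ⁅e i, e j⁆ ⁅e i, e j⁆

omit [Module.Finite ℝ L] in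
lemma lie_self_swap (b : LinearMap.BilinForm ℝ L) (x y : L) :
    b ⁅x, y⁆ ⁅x, y⁆ = b ⁅y, x⁆ ⁅y, x⁆ := by
  rw [← lie_skew x y]
  simp only [map_neg, LinearMap.neg_apply, neg_neg]

lemma IsFrame.sum_lie_eq {g : LinearMap.BilinForm ℝ L} {U : Submodule ℝ L} {e : ι → L}
    {e' : ι' → L} (he : IsFrame g U e) (he' : IsFrame g U e') (hs : ∀ x y, g x y = g y x)
    (b : LinearMap.BilinForm ℝ L) (y : L) :
    ∑ i, b ⁅e i, y⁆ ⁅e i, y⁆ = ∑ i, b ⁅e' i, y⁆ ⁅e' i, y⁆ := by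
  simp only [lie_self_swap b _ y]
  exact he.sum_eq he' hs (b.compl₁₂ (LieAlgebra.ad ℝ L y : L →ₗ[ℝ] L) (LieAlgebra.ad ℝ L y))

/-- The norm of a bracket does not depend on the orthonormal frames. -/
lemma IsFrame.sum_sum_lie_eq {g g' : LinearMap.BilinForm ℝ L} {U W : Submodule ℝ L} {e : ι → L}
    {e' : ι' → L} (he : IsFrame g U e) (he' : IsFrame g U e') (hs : ∀ x y, g x y = g y x)
    {f : κ → L} {f' : κ' → L} (hf : IsFrame g' W f) (hf' : IsFrame g' W f')
    (hs' : ∀ x y, g' x y = g' y x) (b : LinearMap.BilinForm ℝ L) :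
    ∑ i, ∑ j, b ⁅e i, f j⁆ ⁅e i, f j⁆ = ∑ i, ∑ j, b ⁅e' i, f' j⁆ ⁅e' i, f' j⁆ := by
  rw [Finset.sum_comm]
  simp only [he.sum_lie_eq he' hs b]
  rw [Finset.sum_comm]
  simp only [lie_self_swap b (e' _)]
  exact Finset.sum_congr rfl fun i _ => hf.sum_lie_eq hf' hs' b (e' i)

lemma IsFrame.scal_eq {g : LinearMap.BilinForm ℝ L} {U : Submodule ℝ L} {e : ι → L}
    {e' : ι' → L} (he : IsFrame g U e) (he' : IsFrame g U e') (hs : ∀ x y, g x y = g y x) :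
    scal g e = scal g e' := by
  unfold scal
  rw [he.sum_sum_lie_eq he' hs he he' hs, he.sum_eq he' hs]

/-- The scalar curvature in a frame which consists of two blocks. -/
lemma scal_sum_elim (g : LinearMap.BilinForm ℝ L) (e : ι → L) (f : κ → L) :
    scal g (Sum.elim e f) = -(1 / 2) * ∑ i, killingForm ℝ L (e i) (e i)
      - (1 / 2) * ∑ a, killingForm ℝ L (f a) (f a)
      - (1 / 4) * ∑ i, ∑ j, g ⁅e i, e j⁆ ⁅e i, e j⁆
      - (1 / 2) * ∑ i, ∑ a, g ⁅e i, f a⁆ ⁅e i, f a⁆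
      - (1 / 4) * ∑ a, ∑ b, g ⁅f a, f b⁆ ⁅f a, f b⁆ := by
  unfold scal
  simp only [Fintype.sum_sum_type, Sum.elim_inl, Sum.elim_inr, Finset.sum_add_distrib]
  rw [Finset.sum_comm (f := fun a i => g ⁅f a, e i⁆ ⁅f a, e i⁆)]
  simp only [lie_self_swap g (f _) (e _)]
  ring

/-- Parseval's identity in a frame of the complement of `h₀`; it holds for all vectors since `h₀` is
the kernel of the form. -/
lemma IsInvForm.parseval (hQ : IsReductivePair Q h₀) {g : LinearMap.BilinForm ℝ L}
    (hg : IsInvForm h₀ g) {e : ι → L} (he : IsFrame g (ominus Q ⊤ h₀) e) (x y : L) :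
    g x y = ∑ i, g x (e i) * g y (e i) := by
  obtain ⟨v, hv⟩ := exists_frame Q h₀ hQ.symm (fun x _ => hQ.pos x)
  conv_lhs => rw [hg.expand hQ he hv y]
  rw [map_add, map_sum, map_sum, Finset.sum_eq_zero, zero_add]
  · exact Finset.sum_congr rfl fun j _ => by rw [map_smul, smul_eq_mul, mul_comm]
  · intro a _
    rw [map_smul, hg.ker' _ (hv.mem a), smul_zero]

/-- The scalar curvature is the trace of the Ricci form. -/
lemma sum_ricForm (hQ : IsReductivePair Q h₀) {g : LinearMap.BilinForm ℝ L}
    (hg : IsInvForm h₀ g) {e : ι → L} (he : IsFrame g (ominus Q ⊤ h₀) e) :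
    ∑ k, ricForm g e (e k) (e k) = scal g e := by
  unfold ricForm scal
  rw [Finset.sum_add_distrib, Finset.sum_sub_distrib, ← Finset.mul_sum, ← Finset.mul_sum,
    ← Finset.mul_sum]
  have : ∑ k, ∑ i, ∑ j, g ⁅e i, e j⁆ (e k) * g ⁅e i, e j⁆ (e k)
      = ∑ i, ∑ j, g ⁅e i, e j⁆ ⁅e i, e j⁆ := by
    rw [Finset.sum_comm]
    refine Finset.sum_congr rfl fun i _ => ?_
    rw [Finset.sum_comm]
    exact Finset.sum_congr rfl fun j _ => (hg.parseval hQ he _ _).symm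
  rw [this]
  ring

/-! ### The reductive decomposition with respect to a subalgebra -/

omit [Module.Finite ℝ L] in
lemma IsReductivePair.lie_mem_ominus (hQ : IsReductivePair Q h₀) (k : LieSubalgebra ℝ L) {x y : L}
    (hx : x ∈ k) (hy : y ∈ ominus Q ⊤ k.toSubmodule) : ⁅x, y⁆ ∈ ominus Q ⊤ k.toSubmodule := by
  refine mem_ominus.2 ⟨trivial, fun u hu => ?_⟩
  have h1 := hQ.skew x u y
  have h2 := (mem_ominus.1 hy).2 _ (k.lie_mem hx hu)
  linarith

/-- `L ⊖ h₀ = (k ⊖ h₀) ⊕ (L ⊖ k)`. -/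
lemma IsReductivePair.sup_eq (hQ : IsReductivePair Q h₀) (k : LieSubalgebra ℝ L)
    (hk : h₀ ≤ k.toSubmodule) :
    ominus Q k.toSubmodule h₀ ⊔ ominus Q ⊤ k.toSubmodule = ominus Q ⊤ h₀ := by
  apply le_antisymm
  · refine sup_le (fun x hx => mem_ominus.2 ⟨trivial, (mem_ominus.1 hx).2⟩)
      (fun x hx => mem_ominus.2 ⟨trivial, fun w hw => (mem_ominus.1 hx).2 w (hk hw)⟩)
  · intro x hx
    obtain ⟨P, hP⟩ := exists_isOrthProj hQ k.toSubmodule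
    refine Submodule.mem_sup.2 ⟨P x, mem_ominus.2 ⟨hP.mem x, fun w hw => ?_⟩, x - P x,
      hP.mem_compl hQ x, by abel⟩
    have h1 := (mem_ominus.1 hx).2 w hw
    have h2 := hP.orth x w (hk hw)
    rw [hQ.symm, map_sub] at h2
    linarith

omit [Module.Finite ℝ L] in
lemma IsReductivePair.orth_ominus (hQ : IsReductivePair Q h₀) (k : LieSubalgebra ℝ L) {x y : L}
    (hx : x ∈ ominus Q k.toSubmodule h₀) (hy : y ∈ ominus Q ⊤ k.toSubmodule) : Q x y = 0 :=
  (mem_ominus.1 hy).2 x (mem_ominus.1 hx).1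

lemma IsFrame.subtype {V : Type*} [AddCommGroup V] [Module ℝ V] {g : LinearMap.BilinForm ℝ V}
    {U : Submodule ℝ V} {e : ι → V} (he : IsFrame g U e) {h : LinearMap.BilinForm ℝ U}
    (hh : ∀ x y : U, h x y = g x y) :
    IsFrame h ⊤ (fun i => (⟨e i, he.mem i⟩ : U)) := by
  refine ⟨fun _ => trivial, fun i j => by rw [hh]; exact he.orth i j, fun x _ => ?_⟩
  ext
  have := he.expand x x.2
  rw [Submodule.coe_sum]
  simpa [hh] using this

/-- The trace of a restricted form in a frame of vectors of the ambient space. -/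
lemma trForm_subtype {U : Submodule ℝ L} {g b : LinearMap.BilinForm ℝ L} {e : ι → L}
    (he : IsFrame g U e) (hs : ∀ x y, g x y = g y x) {h : U → U → ℝ}
    (hh : ∀ x y : U, h x y = g x y) :
    trForm h (restr b U) = ∑ i, b (e i) (e i) := by
  rw [trForm_eq_sum (Y := restr b U) (g.restrict U) (b.restrict U) (fun x y => hh x y) (fun x y => rfl)
    (he.subtype (h := g.restrict U) (fun _ _ => rfl)) (fun x y => hs x y)]
  rfl

/-- The squared norm of the bracket in orthonormal frames. -/
lemma deltaNormSq_eq (hQ : IsReductivePair Q h₀) {U₁ U₂ U₃ : Submodule ℝ L}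
    {b g₂ g₃ : LinearMap.BilinForm ℝ L} {P : L →ₗ[ℝ] L} (hP : IsOrthProj Q U₁ P)
    {X₁ : U₁ → U₁ → ℝ} {X₂ : U₂ → U₂ → ℝ} {X₃ : U₃ → U₃ → ℝ}
    (h1 : ∀ x y : U₁, X₁ x y = b x y) (h2 : ∀ x y : U₂, X₂ x y = g₂ x y)
    (h3 : ∀ x y : U₃, X₃ x y = g₃ x y) (hs2 : ∀ x y, g₂ x y = g₂ y x)
    (hs3 : ∀ x y, g₃ x y = g₃ y x) {e : ι → L} {f : κ → L} (he : IsFrame g₂ U₂ e)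
    (hf : IsFrame g₃ U₃ f) :
    deltaNormSq Q U₁ U₂ U₃ X₁ X₂ X₃
      = ∑ i, ∑ j, b (P ⁅e i, f j⁆) (P ⁅e i, f j⁆) := by
  let φ : L → L → LinearMap.BilinForm ℝ L := fun x y =>
    b.compl₁₂ (P ∘ₗ (LieAlgebra.ad ℝ L x : L →ₗ[ℝ] L)) (P ∘ₗ (LieAlgebra.ad ℝ L y : L →ₗ[ℝ] L))
  let ψ : LinearMap.BilinForm ℝ L := ∑ j,
    b.compl₁₂ (P ∘ₗ (LieAlgebra.ad ℝ L (f j) : L →ₗ[ℝ] L))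
      (P ∘ₗ (LieAlgebra.ad ℝ L (f j) : L →ₗ[ℝ] L))
  have hin : ∀ u u' : U₂, trForm X₃ (fun w w' : U₃ =>
      X₁ (proj Q U₁ ⁅(u : L), (w : L)⁆) (proj Q U₁ ⁅(u' : L), (w' : L)⁆)) = ψ u u' := by
    intro u u'
    rw [trForm_eq_sum (g₃.restrict U₃) ((φ u u').restrict U₃) h3
      (fun x y => by rw [h1, hP.proj_eq hQ, hP.proj_eq hQ]; rfl)
      (hf.subtype (h := g₃.restrict U₃) (fun _ _ => rfl)) (fun x y => hs3 x y)]
    simp only [ψ, LinearMap.sum_apply]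
    refine Finset.sum_congr rfl fun j _ => ?_
    change b (P ⁅(u : L), f j⁆) (P ⁅(u' : L), f j⁆) = b (P ⁅f j, (u : L)⁆) (P ⁅f j, (u' : L)⁆)
    rw [← lie_skew (f j) (u : L), ← lie_skew (f j) (u' : L)]
    simp only [map_neg, LinearMap.neg_apply, neg_neg]
  unfold deltaNormSq
  simp only [hin]
  rw [trForm_eq_sum (Y := fun u u' : U₂ => ψ u u') (g₂.restrict U₂) (ψ.restrict U₂) h2 (fun x y => rfl)
      (he.subtype (h := g₂.restrict U₂) (fun _ _ => rfl)) (fun x y => hs2 x y)]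
  refine Finset.sum_congr rfl fun i _ => ?_
  change ψ (e i) (e i) = _
  simp only [ψ, LinearMap.sum_apply]
  refine Finset.sum_congr rfl fun j _ => ?_
  change b (P ⁅f j, e i⁆) (P ⁅f j, e i⁆) = _
  rw [← lie_skew (f j) (e i)]
  simp only [map_neg, LinearMap.neg_apply, neg_neg]

/-- `Ŝ` in orthonormal frames, for a form `g` on `L` which extends `h`. The projections onto `l` and
`n` disappear, since `[k, l] ⊆ l` and since `h₀` is in the kernel of `g`. -/
lemma Shat_eq (hQ : IsReductivePair Q h₀) (k : LieSubalgebra ℝ L) (hk : h₀ ≤ k.toSubmodule)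
    {g : LinearMap.BilinForm ℝ L} (hs : ∀ x y, g x y = g y x) (hker : ∀ x ∈ h₀, ∀ y, g x y = 0)
    {h : LinearMap.BilinForm ℝ (ominus Q k.toSubmodule h₀)}
    (hh : ∀ x y : ominus Q k.toSubmodule h₀, h x y = g x y)
    {e : ι → L} (he : IsFrame g (ominus Q k.toSubmodule h₀) e)
    {v : κ → L} (hv : IsFrame Q (ominus Q ⊤ k.toSubmodule) v) :
    Shat Q h₀ k h = -(1 / 2) * ∑ i, killingForm ℝ L (e i) (e i)
      - (1 / 2) * ∑ i, ∑ a, Q ⁅e i, v a⁆ ⁅e i, v a⁆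
      - (1 / 4) * ∑ i, ∑ j, g ⁅e i, e j⁆ ⁅e i, e j⁆ := by
  obtain ⟨Pl, hPl⟩ := exists_isOrthProj hQ (ominus Q ⊤ k.toSubmodule)
  obtain ⟨Pn, hPn⟩ := exists_isOrthProj hQ (ominus Q k.toSubmodule h₀)
  unfold Shat
  rw [trForm_subtype he hs hh,
    deltaNormSq_eq hQ hPl (X₁ := restr Q _) (X₂ := fun x y => h x y) (X₃ := restr Q _)
      (fun _ _ => rfl) hh (fun _ _ => rfl) hs hQ.symm he hv,
    deltaNormSq_eq hQ hPn (X₁ := fun x y => h x y) (X₂ := fun x y => h x y)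
      (X₃ := fun x y => h x y) hh hh hh hs hs he he]
  have h1 : ∀ i a, Pl ⁅e i, v a⁆ = ⁅e i, v a⁆ := fun i a =>
    hPl.apply_mem hQ (hQ.lie_mem_ominus k (mem_ominus.1 (he.mem i)).1 (hv.mem a))
  have h2 : ∀ i j, g (Pn ⁅e i, e j⁆) (Pn ⁅e i, e j⁆) = g ⁅e i, e j⁆ ⁅e i, e j⁆ := by
    intro i j
    have hz : ⁅e i, e j⁆ ∈ k := k.lie_mem (mem_ominus.1 (he.mem i)).1 (mem_ominus.1 (he.mem j)).1
    obtain ⟨Ph, hPh⟩ := exists_isOrthProj hQ h₀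
    have h3 : Pn ⁅e i, e j⁆ = ⁅e i, e j⁆ - Ph ⁅e i, e j⁆ := by
      refine hPn.unique hQ (mem_ominus.2 ⟨?_, (mem_ominus.1 (hPh.mem_compl hQ _)).2⟩) ?_
      · exact k.toSubmodule.sub_mem hz (hk (hPh.mem _))
      · intro u hu
        rw [sub_sub_cancel]
        exact (mem_ominus.1 hu).2 _ (hPh.mem _)
    have h4 := hPh.mem ⁅e i, e j⁆
    have h5 := hs ⁅e i, e j⁆ (Ph ⁅e i, e j⁆)
    rw [h3]
    simp only [map_sub, LinearMap.sub_apply, h5, hker _ h4, sub_zero]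
  simp only [h1, h2]
  ring

end ScalarCurvature

/-! ### Adapted actions and Schur's lemma -/

section Adapted

variable {L : Type*} [LieRing L] [LieAlgebra ℝ L] [Module.Finite ℝ L]
  {Q : LinearMap.BilinForm ℝ L} {h₀ : Submodule ℝ L} {Γ : Type*} {A : Γ → L → L}

/-- A bilinear form is infinitesimally invariant under `h₀`. -/
def IsAdInvariant (h₀ : Submodule ℝ L) (φ : LinearMap.BilinForm ℝ L) : Prop :=
  ∀ w ∈ h₀, ∀ x y : L, φ ⁅w, x⁆ y + φ x ⁅w, y⁆ = 0

/-- The family of maps `A` behaves like the adjoint action of a connected group with Lie algebra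
`h₀`: invariance of bilinear forms under `A` and under `ad h₀` are the same. -/
structure IsAdapted (A : Γ → L → L) (h₀ : Submodule ℝ L) : Prop where
  lin : ∀ a, ∃ f : L →ₗ[ℝ] L, ∀ x, A a x = f x
  form : ∀ φ : LinearMap.BilinForm ℝ L,
    IsAdInvariant h₀ φ ↔ ∀ a x y, φ (A a x) (A a y) = φ x y

/-- The endomorphism which represents a bilinear form with respect to `Q`. -/
lemma exists_repr (hQ : IsReductivePair Q h₀) (φ : LinearMap.BilinForm ℝ L) :
    ∃ F : L →ₗ[ℝ] L, ∀ x y, Q (F x) y = φ x y := by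
  obtain ⟨v, hv⟩ := exists_frame Q ⊤ hQ.symm (fun x _ => hQ.pos x)
  refine ⟨∑ i, (φ.flip (v i)).smulRight (v i), fun x y => ?_⟩
  conv_rhs => rw [hv.expand y trivial]
  simp only [LinearMap.sum_apply, map_sum, LinearMap.smulRight_apply, map_smul, smul_eq_mul,
    LinearMap.smul_apply, LinearMap.flip_apply]
  exact Finset.sum_congr rfl fun i _ => by rw [hQ.symm, mul_comm]; rfl

lemma IsReductivePair.isAdInvariant (hQ : IsReductivePair Q h₀) : IsAdInvariant h₀ Q :=
  fun w _ x y => hQ.skew w x y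

/-- Endomorphisms `F` which commute with `ad h₀` commute with `A`: the form `Q (F x) y` is
invariant. -/
lemma IsAdapted.commute (hA : IsAdapted A h₀) (hQ : IsReductivePair Q h₀) {F : L →ₗ[ℝ] L}
    (hF : ∀ w ∈ h₀, ∀ x, F ⁅w, x⁆ = ⁅w, F x⁆) (a : Γ) (x : L) : F (A a x) = A a (F x) := by
  have hinv := (hA.form Q).1 hQ.isAdInvariant
  obtain ⟨f, hf⟩ := hA.lin a
  have hsurj : Function.Surjective f := by
    apply LinearMap.injective_iff_surjective.1
    rw [← LinearMap.ker_eq_bot, LinearMap.ker_eq_bot']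
    intro z hz
    by_contra h
    have h1 := hinv a z z
    rw [hf, hz, map_zero] at h1
    exact (hQ.pos z h).ne h1
  have h1 := (hA.form (Q.comp F LinearMap.id)).1 (fun w hw x y => by
    change Q (F ⁅w, x⁆) y + Q (F x) ⁅w, y⁆ = 0
    rw [hF w hw, hQ.skew])
  rw [← sub_eq_zero]
  refine hQ.eq_zero_of_mem (U := ⊤) trivial fun u _ => ?_
  obtain ⟨y, rfl⟩ := hsurj u
  have h2 := h1 a x y
  change Q (F (A a x)) (A a y) = Q (F x) y at h2
  rw [← hf, map_sub, LinearMap.sub_apply, h2, hinv, sub_self]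

/-- The orthogonal projection onto an `ad h₀`-invariant subspace commutes with `ad h₀`. -/
lemma IsOrthProj.lie (hQ : IsReductivePair Q h₀) {U : Submodule ℝ L} {P : L →ₗ[ℝ] L}
    (hP : IsOrthProj Q U P) (hU : ∀ w ∈ h₀, ∀ x ∈ U, ⁅w, x⁆ ∈ U) :
    ∀ w ∈ h₀, ∀ x, P ⁅w, x⁆ = ⁅w, P x⁆ := by
  intro w hw x
  refine hP.unique hQ (hU w hw _ (hP.mem x)) fun u hu => ?_
  have h1 := hQ.skew w (x - P x) u
  rw [hP.orth x _ (hU w hw u hu), add_zero, lie_sub] at h1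
  exact h1

omit [Module.Finite ℝ L] in
lemma IsReductivePair.lie_mem_n (hQ : IsReductivePair Q h₀) (k : LieSubalgebra ℝ L)
    (hk : h₀ ≤ k.toSubmodule) : ∀ w ∈ h₀, ∀ x ∈ ominus Q k.toSubmodule h₀,
      ⁅w, x⁆ ∈ ominus Q k.toSubmodule h₀ := fun w hw x hx =>
  mem_ominus.2 ⟨k.lie_mem (hk hw) (mem_ominus.1 hx).1,
    (mem_ominus.1 (hQ.lie_mem_compl hw (mem_ominus.2 ⟨trivial, (mem_ominus.1 hx).2⟩))).2⟩

/-- Schur's lemma: under the inequivalence hypothesis, an invariant form is block diagonal with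
respect to a maximal subalgebra. Its off-diagonal block is represented by an equivariant map
`F : n → l`, which gives an equivalence between the range of the adjoint of `F` and that of `F`. -/
lemma IsAdInvariant.eq_zero_of_maximal (hA : IsAdapted A h₀) (hQ : IsReductivePair Q h₀)
    (hflag : MaximalInequivalence A Q h₀) {s : LieSubalgebra ℝ L} (hs : IsCoatom s)
    (hs₀ : h₀ ≤ s.toSubmodule) {g : LinearMap.BilinForm ℝ L} (hg : IsAdInvariant h₀ g)
    {x y : L} (hx : x ∈ ominus Q s.toSubmodule h₀) (hy : y ∈ ominus Q ⊤ s.toSubmodule) :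
    g x y = 0 := by
  obtain ⟨Pn, hPn⟩ := exists_isOrthProj hQ (ominus Q s.toSubmodule h₀)
  obtain ⟨Pl, hPl⟩ := exists_isOrthProj hQ (ominus Q ⊤ s.toSubmodule)
  have hPn' := hPn.lie hQ (hQ.lie_mem_n s hs₀)
  have hPl' := hPl.lie hQ (fun w hw x hx => hQ.lie_mem_ominus s (hs₀ hw) hx)
  -- `F : n → l` and its adjoint `F'`
  obtain ⟨F, hF⟩ := exists_repr hQ (g.comp Pn Pl)
  obtain ⟨F', hF'⟩ := exists_repr hQ (g.comp Pn Pl).flip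
  have adj : ∀ u w, Q (F' u) w = Q u (F w) := by
    intro u w
    rw [hF', hQ.symm u, hF]
    rfl
  have cF : ∀ w ∈ h₀, ∀ x, F ⁅w, x⁆ = ⁅w, F x⁆ := by
    intro w hw x
    rw [← sub_eq_zero]
    refine hQ.eq_zero_of_mem (U := ⊤) trivial fun u _ => ?_
    have h1 := hQ.skew w (F x) u
    have h2 := hg w hw (Pn x) (Pl u)
    rw [map_sub, LinearMap.sub_apply, hF]
    rw [hF] at h1
    change g (Pn ⁅w, x⁆) (Pl u) - _ = 0
    change _ + g (Pn x) (Pl ⁅w, u⁆) = 0 at h1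
    rw [hPn' w hw]
    rw [hPl' w hw] at h1
    linarith
  have cF' : ∀ w ∈ h₀, ∀ x, F' ⁅w, x⁆ = ⁅w, F' x⁆ := by
    intro w hw x
    rw [← sub_eq_zero]
    refine hQ.eq_zero_of_mem (U := ⊤) trivial fun u _ => ?_
    have h1 := hQ.skew w (F' x) u
    rw [adj] at h1
    rw [map_sub, LinearMap.sub_apply, adj]
    have h2 := hQ.skew w x (F u)
    rw [← cF w hw] at h2
    linarith
  have memF : ∀ u, F u ∈ ominus Q ⊤ s.toSubmodule := by
    intro u
    refine mem_ominus.2 ⟨trivial, fun w hw => ?_⟩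
    rw [hQ.symm, hF]
    change g (Pn u) (Pl w) = 0
    have : Pl w = 0 := hPl.unique hQ (Submodule.zero_mem _) fun z hz => by
      rw [sub_zero]; exact (mem_ominus.1 hz).2 w hw
    rw [this, map_zero]
  have memF' : ∀ u, F' u ∈ ominus Q s.toSubmodule h₀ := by
    intro u
    have h0 : ∀ w, (∀ z ∈ ominus Q s.toSubmodule h₀, Q w z = 0) → Q (F' u) w = 0 := by
      intro w hw
      rw [hF']
      change g (Pn w) (Pl u) = 0
      have : Pn w = 0 := hPn.unique hQ (Submodule.zero_mem _) fun z hz => by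
        rw [sub_zero]; exact hw z hz
      rw [this, map_zero, LinearMap.zero_apply]
    have h1 : F' u = Pn (F' u) := by
      rw [← sub_eq_zero]
      refine hQ.eq_zero_of_mem (U := ⊤) trivial fun w _ => ?_
      rw [map_sub, LinearMap.sub_apply, sub_eq_zero]
      have h2 := h0 (w - Pn w) (hPn.orth w)
      rw [map_sub, sub_eq_zero] at h2
      have h3 := hPn.orth (F' u) (Pn w) (hPn.mem w)
      have h4 := hPn.orth w (Pn (F' u)) (hPn.mem _)
      rw [hQ.symm] at h4
      simp only [map_sub, LinearMap.sub_apply] at h3 h4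
      linarith
    rw [h1]
    exact hPn.mem _
  by_contra hne
  have hFne : F ≠ 0 := by
    rintro rfl
    have := hF x y
    rw [LinearMap.zero_apply, map_zero, LinearMap.zero_apply] at this
    apply hne
    rw [this]
    change g x y = g (Pn x) (Pl y)
    rw [hPn.apply_mem hQ hx, hPl.apply_mem hQ hy]
  -- the equivalence between the ranges
  have inj1 : ∀ x, F (F' x) = 0 → F' x = 0 := by
    intro x hx
    by_contra h
    have := adj x (F' x)
    rw [hx, map_zero] at this
    exact (hQ.pos _ h).ne' this
  have inj2 : ∀ x, F' (F x) = 0 → F x = 0 := by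
    intro x hx
    by_contra h
    have := adj (F x) x
    rw [hx, map_zero, LinearMap.zero_apply] at this
    exact (hQ.pos _ h).ne this
  let φ : LinearMap.range F' →ₗ[ℝ] LinearMap.range F :=
    (F.comp (LinearMap.range F').subtype).codRestrict _ (fun z => ⟨_, rfl⟩)
  let ψ : LinearMap.range F →ₗ[ℝ] LinearMap.range F' :=
    (F'.comp (LinearMap.range F).subtype).codRestrict _ (fun z => ⟨_, rfl⟩)
  have hφ : Function.Injective φ := by
    rw [← LinearMap.ker_eq_bot, LinearMap.ker_eq_bot']
    rintro ⟨_, z, rfl⟩ hz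
    have := congrArg Subtype.val hz
    exact Subtype.ext (inj1 z this)
  have hψ : Function.Injective ψ := by
    rw [← LinearMap.ker_eq_bot, LinearMap.ker_eq_bot']
    rintro ⟨_, z, rfl⟩ hz
    have := congrArg Subtype.val hz
    exact Subtype.ext (inj2 z this)
  have hdim := le_antisymm (LinearMap.finrank_le_finrank_of_injective hφ)
    (LinearMap.finrank_le_finrank_of_injective hψ)
  have hW : LinearMap.range F ≠ ⊥ := by
    rwa [Ne, LinearMap.range_eq_bot]
  refine hflag s hs hs₀ (LinearMap.range F') (LinearMap.range F) ?_ ?_ ?_ hW ?_ ?_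
    ⟨LinearEquiv.ofInjectiveOfFinrankEq φ hφ hdim, ?_⟩
  · rintro _ ⟨z, rfl⟩
    exact memF' z
  · rintro _ ⟨z, rfl⟩
    exact memF z
  · intro hbot
    apply hW
    rw [LinearMap.range_eq_bot] at hbot ⊢
    ext z
    exact inj2 z (by rw [hbot]; rfl)
  · rintro a _ ⟨z, rfl⟩
    exact ⟨A a z, hA.commute hQ cF' a z⟩
  · rintro a _ ⟨z, rfl⟩
    exact ⟨A a z, hA.commute hQ cF a z⟩
  · intro a x y hxy
    change F y = A a (F x)
    rw [hxy, hA.commute hQ cF]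

end Adapted

/-! ### Bounds for the scalar curvature -/

section Bounds

variable {L : Type*} [LieRing L] [LieAlgebra ℝ L] [Module.Finite ℝ L]
  {Q T : LinearMap.BilinForm ℝ L} {h₀ : Submodule ℝ L} {Γ : Type*} {A : Γ → L → L}
  {ι κ : Type*} [Fintype ι] [DecidableEq ι] [Fintype κ] [DecidableEq κ]

/-- Rescaling a frame which diagonalizes `g'` gives a `g'`-orthonormal frame. -/
lemma IsFrame.rescale {V : Type*} [AddCommGroup V] [Module ℝ V] {g g' : LinearMap.BilinForm ℝ V}
    {U : Submodule ℝ V} {e : ι → V} (he : IsFrame g U e) {μ : ι → ℝ} (hμ : ∀ i, 0 < μ i)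
    (h : ∀ i j, g' (e i) (e j) = if i = j then μ i else 0) :
    IsFrame g' U (fun i => (Real.sqrt (μ i))⁻¹ • e i) := by
  have h1 : ∀ i, (Real.sqrt (μ i))⁻¹ * ((Real.sqrt (μ i))⁻¹ * μ i) = 1 := by
    intro i
    have h1 : Real.sqrt (μ i) ^ 2 = μ i := Real.sq_sqrt (hμ i).le
    have h2 : Real.sqrt (μ i) ≠ 0 := (Real.sqrt_pos.2 (hμ i)).ne'
    field_simp
    exact h1.symm
  refine ⟨fun i => U.smul_mem _ (he.mem i), fun i j => ?_, fun x hx => ?_⟩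
  · simp only [LinearMap.smul_apply, map_smul, smul_eq_mul, h]
    split_ifs with hij
    · subst hij
      exact h1 i
    · simp
  · conv_lhs => rw [he.expand x hx]
    refine Finset.sum_congr rfl fun i _ => ?_
    have h2 : g' x (e i) = μ i * g x (e i) := by
      rw [show g' x = g' (∑ j, g x (e j) • e j) from congrArg g' (he.expand x hx)]
      simp [LinearMap.sum_apply, h, mul_comm]
    rw [map_smul, smul_eq_mul, smul_smul, h2]
    congr 1
    linear_combination (-(g x (e i))) * h1 i

/-- A form `g'` which is diagonal in a `g`-frame, evaluated on the diagonal. -/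
lemma IsFrame.apply_eq_sum {V : Type*} [AddCommGroup V] [Module ℝ V]
    {g g' : LinearMap.BilinForm ℝ V}
    {U : Submodule ℝ V} {e : ι → V} (he : IsFrame g U e) {μ : ι → ℝ}
    (h : ∀ i j, g' (e i) (e j) = if i = j then μ i else 0) {x : V} (hx : x ∈ U) :
    g' x x = ∑ i, μ i * g x (e i) ^ 2 := by
  conv_lhs => rw [he.expand x hx]
  simp only [LinearMap.sum_apply, map_sum, map_smul, LinearMap.smul_apply, smul_eq_mul, h]
  refine Finset.sum_congr rfl fun i _ => ?_
  simp only [mul_ite, mul_zero, Finset.sum_ite_eq', Finset.sum_ite_eq, Finset.mem_univ, if_true]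
  ring

/-- The negative of the Killing form is bounded by a multiple of `T`. -/
lemma IsInvForm.exists_killing_le (hQ : IsReductivePair Q h₀) (hT : IsInvForm h₀ T) :
    ∃ C : ℝ, 0 ≤ C ∧ ∀ x ∈ ominus Q ⊤ h₀, -killingForm ℝ L x x ≤ C * T x x := by
  obtain ⟨e, κ, he, hκ⟩ := exists_frame_diag T (-killingForm ℝ L) (ominus Q ⊤ h₀) hT.symm
    (hT.pos_compl hQ) (fun x y => by
      simp only [LinearMap.neg_apply]
      rw [LieModule.traceForm_comm])
  refine ⟨∑ i, |κ i|, Finset.sum_nonneg fun i _ => abs_nonneg _, fun x hx => ?_⟩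
  have h1 := he.apply_eq_sum hκ hx
  have h2 := he.apply_eq_sum (μ := fun _ => 1) he.orth hx
  rw [LinearMap.neg_apply, LinearMap.neg_apply] at h1
  rw [h1, h2, Finset.mul_sum]
  refine Finset.sum_le_sum fun i _ => ?_
  rw [one_mul]
  refine mul_le_mul_of_nonneg_right ?_ (sq_nonneg _)
  exact (le_abs_self _).trans (Finset.single_le_sum (f := fun i => |κ i|)
    (fun i _ => abs_nonneg _) (Finset.mem_univ i))

/-- The form on `L` which extends a scalar product on `k ⊖ h₀` by zero. -/
lemma IsInvariantScalarProduct.exists_extension (hA : IsAdapted A h₀) (hQ : IsReductivePair Q h₀)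
    (k : LieSubalgebra ℝ L) (hk : h₀ ≤ k.toSubmodule)
    {h : LinearMap.BilinForm ℝ (ominus Q k.toSubmodule h₀)}
    (hh : IsInvariantScalarProduct A (ominus Q k.toSubmodule h₀) h) :
    ∃ g : LinearMap.BilinForm ℝ L, (∀ x y, g x y = g y x) ∧
      (∀ x y : ominus Q k.toSubmodule h₀, h x y = g x y) ∧
      (∀ x, (∀ u ∈ ominus Q k.toSubmodule h₀, Q x u = 0) → ∀ y, g x y = 0) ∧
      (∀ x ∈ ominus Q k.toSubmodule h₀, x ≠ 0 → 0 < g x x) ∧ IsAdInvariant h₀ g := by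
  obtain ⟨P, hP⟩ := exists_isOrthProj hQ (ominus Q k.toSubmodule h₀)
  have hPl := hP.lie hQ (hQ.lie_mem_n k hk)
  let P' : L →ₗ[ℝ] ominus Q k.toSubmodule h₀ := P.codRestrict _ hP.mem
  have hP' : ∀ x : ominus Q k.toSubmodule h₀, P' x = x := fun x =>
    Subtype.ext (hP.apply_mem hQ x.2)
  refine ⟨h.comp P' P', fun x y => hh.symm _ _, fun x y => ?_, fun x hx y => ?_, fun x hx h0 => ?_,
    (hA.form _).2 fun a x y => ?_⟩
  · change h x y = h (P' x) (P' y)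
    rw [hP', hP']
  · change h (P' x) (P' y) = 0
    have : P' x = 0 := Subtype.ext (hP.unique hQ (Submodule.zero_mem _) (by simpa using hx))
    rw [this, map_zero, LinearMap.zero_apply]
  · change 0 < h (P' (⟨x, hx⟩ : ominus Q k.toSubmodule h₀))
      (P' (⟨x, hx⟩ : ominus Q k.toSubmodule h₀))
    rw [hP']
    exact hh.pos _ fun h1 => h0 (congrArg Subtype.val h1)
  · exact hh.invariant a _ _ _ _ (hA.commute hQ hPl a x) (hA.commute hQ hPl a y)

/-- The restriction of an invariant form is an invariant scalar product. -/
lemma IsAdInvariant.isInvariantScalarProduct (hA : IsAdapted A h₀)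
    {g : LinearMap.BilinForm ℝ L} (hg : IsAdInvariant h₀ g) (hs : ∀ x y, g x y = g y x)
    {U : Submodule ℝ L} (hp : ∀ x ∈ U, x ≠ 0 → 0 < g x x) :
    IsInvariantScalarProduct A U (g.restrict U) := by
  refine ⟨fun x y => hs x y, fun x hx => hp x x.2 (by simpa using hx), ?_⟩
  intro a x y x' y' hx hy
  change g x' y' = g x y
  rw [hx, hy]
  exact (hA.form g).1 hg a x y

/-- `Ŝ` is homogeneous of degree `-1`. -/
lemma Shat_smul (hQ : IsReductivePair Q h₀) (k : LieSubalgebra ℝ L) (hk : h₀ ≤ k.toSubmodule)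
    {g : LinearMap.BilinForm ℝ L} (hs : ∀ x y, g x y = g y x) (hker : ∀ x ∈ h₀, ∀ y, g x y = 0)
    (hp : ∀ x ∈ ominus Q k.toSubmodule h₀, x ≠ 0 → 0 < g x x) {t : ℝ} (ht : 0 < t) :
    Shat Q h₀ k ((t • g).restrict (ominus Q k.toSubmodule h₀)) =
      t⁻¹ * Shat Q h₀ k (g.restrict (ominus Q k.toSubmodule h₀)) := by
  obtain ⟨e, he⟩ := exists_frame g (ominus Q k.toSubmodule h₀) hs hp
  obtain ⟨v, hv⟩ := exists_frame Q (ominus Q ⊤ k.toSubmodule) hQ.symm (fun x _ => hQ.pos x)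
  rw [Shat_eq hQ k hk (g := t • g) (h := (t • g).restrict _) (fun x y => by simp [hs x y])
      (fun x hx y => by simp [hker x hx]) (fun _ _ => rfl) (he.smul ht) hv,
    Shat_eq hQ k hk (h := g.restrict _) hs hker (fun _ _ => rfl) he hv]
  have h1 : (Real.sqrt t)⁻¹ * (Real.sqrt t)⁻¹ = t⁻¹ := by
    rw [← mul_inv, Real.mul_self_sqrt ht.le]
  have h2 : ∀ x y : L, killingForm ℝ L ((Real.sqrt t)⁻¹ • x) ((Real.sqrt t)⁻¹ • y)
      = t⁻¹ * killingForm ℝ L x y := by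
    intro x y
    rw [map_smul, map_smul, LinearMap.smul_apply, smul_eq_mul, smul_eq_mul, ← mul_assoc, h1]
  have h3 : ∀ x y : L, Q ⁅(Real.sqrt t)⁻¹ • x, y⁆ ⁅(Real.sqrt t)⁻¹ • x, y⁆
      = t⁻¹ * Q ⁅x, y⁆ ⁅x, y⁆ := by
    intro x y
    rw [smul_lie, map_smul, map_smul, LinearMap.smul_apply, smul_eq_mul, smul_eq_mul, ← mul_assoc,
      h1]
  have h4 : ∀ x y : L, (t • g) ⁅(Real.sqrt t)⁻¹ • x, (Real.sqrt t)⁻¹ • y⁆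
      ⁅(Real.sqrt t)⁻¹ • x, (Real.sqrt t)⁻¹ • y⁆ = t⁻¹ * g ⁅x, y⁆ ⁅x, y⁆ := by
    intro x y
    simp only [smul_lie, lie_smul, smul_smul, map_smul, LinearMap.smul_apply, smul_eq_mul, h1]
    field_simp
  simp only [h2, h3, h4, ← Finset.mul_sum]
  ring

/-- Only the Killing form contributes positively to `Ŝ`. -/
lemma Shat_le (hQ : IsReductivePair Q h₀) (k : LieSubalgebra ℝ L)
    (hk : h₀ ≤ k.toSubmodule) {C : ℝ}
    (hC : ∀ x ∈ ominus Q ⊤ h₀, -killingForm ℝ L x x ≤ C * T x x)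
    {g : LinearMap.BilinForm ℝ L} (hs : ∀ x y, g x y = g y x) (hker : ∀ x ∈ h₀, ∀ y, g x y = 0)
    (hnn : ∀ x ∈ k, 0 ≤ g x x) {e : ι → L} (he : IsFrame g (ominus Q k.toSubmodule h₀) e) :
    Shat Q h₀ k (g.restrict (ominus Q k.toSubmodule h₀)) ≤ C / 2 * ∑ i, T (e i) (e i) := by
  obtain ⟨v, hv⟩ := exists_frame Q (ominus Q ⊤ k.toSubmodule) hQ.symm (fun x _ => hQ.pos x)
  rw [Shat_eq hQ k hk hs hker (fun _ _ => rfl) he hv]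
  have h1 : ∑ i, -killingForm ℝ L (e i) (e i) ≤ ∑ i, C * T (e i) (e i) :=
    Finset.sum_le_sum fun i _ => hC _ (mem_ominus.2 ⟨trivial, (mem_ominus.1 (he.mem i)).2⟩)
  rw [Finset.sum_neg_distrib, ← Finset.mul_sum] at h1
  have h2 : 0 ≤ ∑ i, ∑ a, Q ⁅e i, v a⁆ ⁅e i, v a⁆ :=
    Finset.sum_nonneg fun i _ => Finset.sum_nonneg fun a _ => hQ.nonneg _
  have h3 : 0 ≤ ∑ i, ∑ j, g ⁅e i, e j⁆ ⁅e i, e j⁆ :=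
    Finset.sum_nonneg fun i _ => Finset.sum_nonneg fun j _ =>
      hnn _ (k.lie_mem (mem_ominus.1 (he.mem i)).1 (mem_ominus.1 (he.mem j)).1)
  linarith

lemma nonneg_of_ominus (hQ : IsReductivePair Q h₀) (k : LieSubalgebra ℝ L)
    (hk : h₀ ≤ k.toSubmodule)
    {g : LinearMap.BilinForm ℝ L} (hs : ∀ x y, g x y = g y x) (hker : ∀ x ∈ h₀, ∀ y, g x y = 0)
    (hp : ∀ x ∈ ominus Q k.toSubmodule h₀, x ≠ 0 → 0 < g x x) (x : L) (hx : x ∈ k) :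
    0 ≤ g x x := by
  obtain ⟨P, hP⟩ := exists_isOrthProj hQ h₀
  have h1 : x - P x ∈ ominus Q k.toSubmodule h₀ :=
    mem_ominus.2 ⟨k.toSubmodule.sub_mem hx (hk (hP.mem x)), (mem_ominus.1 (hP.mem_compl hQ x)).2⟩
  have h2 : g (x - P x) (x - P x) = g x x := by
    have h3 := hs x (P x)
    simp only [map_sub, LinearMap.sub_apply, h3, hker _ (hP.mem x), sub_zero]
  rw [← h2]
  by_cases h : x - P x = 0
  · rw [h, map_zero]
  · exact (hp _ h1 h).le

/-- `Ŝ` is bounded above on `M_T(k)`. -/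
lemma bddAbove_Shat (hA : IsAdapted A h₀) (hQ : IsReductivePair Q h₀) (hT : IsInvForm h₀ T)
    (k : LieSubalgebra ℝ L) (hk : h₀ ≤ k.toSubmodule) :
    BddAbove (Shat Q h₀ k '' MTk A Q T h₀ k) := by
  obtain ⟨C, _, hC⟩ := hT.exists_killing_le hQ
  refine ⟨C / 2, ?_⟩
  rintro _ ⟨h, ⟨hh, htr⟩, rfl⟩
  obtain ⟨g, hs, hr, hz, hp, _⟩ := hh.exists_extension hA hQ k hk
  have hker : ∀ x ∈ h₀, ∀ y, g x y = 0 := fun x hx =>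
    hz x fun u hu => (mem_ominus.1 hu).2 x hx
  obtain ⟨e, he⟩ := exists_frame g (ominus Q k.toSubmodule h₀) hs hp
  have h1 := Shat_le hQ k hk hC hs hker (nonneg_of_ominus hQ k hk hs hker hp) he
  rw [trForm_subtype he hs hr] at htr
  rw [htr, mul_one] at h1
  have h2 : h = g.restrict _ := by
    ext x y
    exact hr x y
  rwa [h2]

/-- `Ŝ` of an arbitrary invariant scalar product is bounded by `σ`. -/
lemma Shat_le_sigma (hA : IsAdapted A h₀) (hQ : IsReductivePair Q h₀) (hT : IsInvForm h₀ T)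
    (k : LieSubalgebra ℝ L) (hk : h₀ < k.toSubmodule) {g : LinearMap.BilinForm ℝ L}
    (hs : ∀ x y, g x y = g y x) (hker : ∀ x ∈ h₀, ∀ y, g x y = 0)
    (hp : ∀ x ∈ ominus Q k.toSubmodule h₀, x ≠ 0 → 0 < g x x) (hg : IsAdInvariant h₀ g)
    {e : ι → L} (he : IsFrame g (ominus Q k.toSubmodule h₀) e) :
    0 < ∑ i, T (e i) (e i) ∧
    Shat Q h₀ k (g.restrict (ominus Q k.toSubmodule h₀))
      ≤ (∑ i, T (e i) (e i)) * sigma A Q T h₀ k := by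
  set τ := ∑ i, T (e i) (e i) with hτ
  have hτ0 : 0 < τ := by
    obtain ⟨x, hx, hx0⟩ := SetLike.exists_of_lt hk
    obtain ⟨P, hP⟩ := exists_isOrthProj hQ h₀
    have h1 : x - P x ∈ ominus Q k.toSubmodule h₀ :=
      mem_ominus.2 ⟨k.toSubmodule.sub_mem hx (hk.le (hP.mem x)),
        (mem_ominus.1 (hP.mem_compl hQ x)).2⟩
    have h2 : (Finset.univ : Finset ι).Nonempty := by
      by_contra hne
      rw [Finset.not_nonempty_iff_eq_empty] at hne
      have h3 := he.expand _ h1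
      rw [hne, Finset.sum_empty, sub_eq_zero] at h3
      exact hx0 (h3 ▸ hP.mem x)
    refine Finset.sum_pos (fun i _ => hT.pos _ fun h3 => ?_) h2
    have h4 := he.orth i i
    rw [hker _ h3] at h4
    simp at h4
  refine ⟨hτ0, ?_⟩
  have hmem : (τ • g).restrict (ominus Q k.toSubmodule h₀) ∈ MTk A Q T h₀ k := by
    refine ⟨IsAdInvariant.isInvariantScalarProduct hA (fun w hw x y => ?_) (fun x y => ?_)
      (fun x hx h => ?_), ?_⟩
    · simp only [LinearMap.smul_apply, ← smul_add, hg w hw x y, smul_zero]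
    · simp only [LinearMap.smul_apply, hs x y]
    · simp only [LinearMap.smul_apply, smul_eq_mul]
      exact mul_pos hτ0 (hp x hx h)
    · refine (trForm_subtype (g := τ • g) (b := T)
        (h := fun x y => (τ • g).restrict (ominus Q k.toSubmodule h₀) x y) (he.smul hτ0)
        (fun x y => by simp only [LinearMap.smul_apply, hs x y]) (fun x y => rfl)).trans ?_
      simp only [map_smul, LinearMap.smul_apply, smul_eq_mul, ← mul_assoc, ← mul_inv,
        Real.mul_self_sqrt hτ0.le, ← Finset.mul_sum]
      exact inv_mul_cancel₀ hτ0.ne'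
  have h1 := le_csSup (bddAbove_Shat hA hQ hT k hk.le) ⟨_, hmem, rfl⟩
  rw [Shat_smul hQ k hk.le hs hker hp hτ0] at h1
  have h2 := mul_le_mul_of_nonneg_left h1 hτ0.le
  rwa [← mul_assoc, mul_inv_cancel₀ hτ0.ne', one_mul] at h2

/-- On an `ad X`-invariant subspace, the norm of `ad X` with respect to a scalar product `g` is at
least the norm with respect to `Q`. -/
lemma sum_lie_le (hQ : IsReductivePair Q h₀) {U : Submodule ℝ L} {g : LinearMap.BilinForm ℝ L}
    {v : ι → L} (hv : IsFrame Q U v) {μ : ι → ℝ} (hμ : ∀ i, 0 < μ i)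
    (h : ∀ i j, g (v i) (v j) = if i = j then μ i else 0) {X : L} (hX : ∀ x ∈ U, ⁅X, x⁆ ∈ U) :
    ∑ a, Q ⁅X, v a⁆ ⁅X, v a⁆ ≤
      ∑ a, g ⁅X, (Real.sqrt (μ a))⁻¹ • v a⁆ ⁅X, (Real.sqrt (μ a))⁻¹ • v a⁆ := by
  set c : ι → ι → ℝ := fun a b => Q ⁅X, v a⁆ (v b) with hc
  have hskew : ∀ a b, c b a = - c a b := by
    intro a b
    have := hQ.skew X (v a) (v b)
    rw [hQ.symm (v a)] at this
    simp only [hc]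
    linarith
  have h1 : ∀ a, Q ⁅X, v a⁆ ⁅X, v a⁆ = ∑ b, c a b ^ 2 := by
    intro a
    rw [hv.apply_eq_sum (μ := fun _ => 1) hv.orth (hX _ (hv.mem a))]
    simp [hc]
  have h2 : ∀ a, g ⁅X, (Real.sqrt (μ a))⁻¹ • v a⁆ ⁅X, (Real.sqrt (μ a))⁻¹ • v a⁆
      = ∑ b, (μ b / μ a) * c a b ^ 2 := by
    intro a
    have h3 : (Real.sqrt (μ a))⁻¹ * (Real.sqrt (μ a))⁻¹ = (μ a)⁻¹ := by
      rw [← mul_inv, Real.mul_self_sqrt (hμ a).le]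
    simp only [lie_smul, map_smul, LinearMap.smul_apply, smul_eq_mul]
    rw [← mul_assoc, h3, hv.apply_eq_sum h (hX _ (hv.mem a)), Finset.mul_sum]
    exact Finset.sum_congr rfl fun b _ => by ring
  simp only [h1, h2]
  rw [sum_sum_symmetrize, sum_sum_symmetrize (fun a b => μ b / μ a * c a b ^ 2)]
  refine mul_le_mul_of_nonneg_left ?_ (by norm_num)
  refine Finset.sum_le_sum fun a _ => Finset.sum_le_sum fun b _ => ?_
  rw [hskew a b]
  -- the `(a, b)` and `(b, a)` entries of the skew matrix `c` together get the weight
  -- `μ b / μ a + μ a / μ b`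
  have h3 : 2 ≤ μ b / μ a + μ a / μ b := by
    rw [div_add_div _ _ (hμ a).ne' (hμ b).ne', le_div_iff₀ (mul_pos (hμ a) (hμ b))]
    nlinarith [sq_nonneg (μ a - μ b)]
  nlinarith [sq_nonneg (c a b)]

/-- The scalar curvature of a block diagonal metric is bounded by `σ` of the subalgebra, up to
an error which is controlled by `tr_g T` on the complement of the subalgebra. -/
lemma IsInvForm.scal_le (hA : IsAdapted A h₀) (hQ : IsReductivePair Q h₀) (hT : IsInvForm h₀ T)
    {C : ℝ} (hC : ∀ x ∈ ominus Q ⊤ h₀, -killingForm ℝ L x x ≤ C * T x x)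
    (k : LieSubalgebra ℝ L) (hk : h₀ < k.toSubmodule) {g : LinearMap.BilinForm ℝ L}
    (hg : IsInvForm h₀ g)
    (hgb : ∀ x ∈ ominus Q k.toSubmodule h₀, ∀ y ∈ ominus Q ⊤ k.toSubmodule, g x y = 0)
    {P : L →ₗ[ℝ] L} (hP : IsOrthProj Q (ominus Q ⊤ k.toSubmodule) P)
    (hTb : ∀ x ∈ ominus Q k.toSubmodule h₀, ∀ y ∈ ominus Q ⊤ k.toSubmodule, T x y = 0)
    {e : ι → L} (he : IsFrame g (ominus Q ⊤ h₀) e) (htr : ∑ i, T (e i) (e i) = 1) :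
    scal g e ≤ (1 - ∑ i, T (P (e i)) (P (e i))) * sigma A Q T h₀ k
      + C / 2 * ∑ i, T (P (e i)) (P (e i)) := by
  have hnm : ominus Q k.toSubmodule h₀ ≤ ominus Q ⊤ h₀ := by
    rw [← hQ.sup_eq k hk.le]; exact le_sup_left
  have hlm : ominus Q ⊤ k.toSubmodule ≤ ominus Q ⊤ h₀ := by
    rw [← hQ.sup_eq k hk.le]; exact le_sup_right
  obtain ⟨u, hu⟩ := exists_frame g (ominus Q k.toSubmodule h₀) hg.symm
    (fun x hx => hg.pos_compl hQ x (hnm hx))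
  obtain ⟨v, μ, hv, hvμ⟩ := exists_frame_diag Q g (ominus Q ⊤ k.toSubmodule) hQ.symm
    (fun x _ => hQ.pos x) hg.symm
  have hμ : ∀ a, 0 < μ a := by
    intro a
    have h1 := hvμ a a
    rw [if_pos rfl] at h1
    rw [← h1]
    refine hg.pos_compl hQ _ (hlm (hv.mem a)) fun h2 => ?_
    have h3 := hv.orth a a
    rw [h2] at h3
    simp at h3
  have hf := hv.rescale hμ hvμ
  set f := fun a => (Real.sqrt (μ a))⁻¹ • v a with hfdef
  have hsum := hu.sum_elim hf hgb (fun x hx y hy => by rw [hg.symm]; exact hgb y hy x hx)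
  rw [hQ.sup_eq k hk.le] at hsum
  have hPu : ∀ i, P (u i) = 0 := fun i => hP.unique hQ (Submodule.zero_mem _) fun z hz => by
    rw [sub_zero]; exact hQ.orth_ominus k (hu.mem i) hz
  have hPf : ∀ a, P (f a) = f a := fun a => hP.apply_mem hQ (hf.mem a)
  have hδ : ∑ i, T (P (e i)) (P (e i)) = ∑ a, T (f a) (f a) := by
    have := he.sum_eq hsum hg.symm (T.comp P P)
    simp only [Fintype.sum_sum_type, Sum.elim_inl, Sum.elim_inr, LinearMap.BilinForm.comp_apply,
      hPu, hPf, map_zero, Finset.sum_const_zero, zero_add] at this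
    exact this
  have hτ : ∑ i, T (u i) (u i) = 1 - ∑ a, T (f a) (f a) := by
    have := he.sum_eq hsum hg.symm T
    rw [htr] at this
    simp only [Fintype.sum_sum_type, Sum.elim_inl, Sum.elim_inr] at this
    linarith
  have hS := (Shat_le_sigma hA hQ hT k hk hg.symm hg.ker
    (fun x hx => hg.pos_compl hQ x (hnm hx)) hg.skew hu).2
  rw [Shat_eq hQ k hk.le hg.symm hg.ker (fun _ _ => rfl) hu hv] at hS
  rw [he.scal_eq hsum hg.symm, scal_sum_elim, hδ]
  have h1 : ∑ i, ∑ a, Q ⁅u i, v a⁆ ⁅u i, v a⁆ ≤ ∑ i, ∑ a, g ⁅u i, f a⁆ ⁅u i, f a⁆ :=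
    Finset.sum_le_sum fun i _ => sum_lie_le hQ hv hμ hvμ
      (fun x hx => hQ.lie_mem_ominus k (mem_ominus.1 (hu.mem i)).1 hx)
  have h2 : 0 ≤ ∑ a, ∑ b, g ⁅f a, f b⁆ ⁅f a, f b⁆ :=
    Finset.sum_nonneg fun i _ => Finset.sum_nonneg fun a _ => hg.nonneg _
  have h3 : ∑ a, -killingForm ℝ L (f a) (f a) ≤ ∑ a, C * T (f a) (f a) :=
    Finset.sum_le_sum fun a _ => hC _ (hlm (hf.mem a))
  rw [Finset.sum_neg_distrib, ← Finset.mul_sum] at h3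
  rw [hτ] at hS
  linarith

end Bounds

/-! ### Diagonal variations and invariance of the Ricci form -/

section Variation

variable {L : Type*} [LieRing L] [LieAlgebra ℝ L]
  {Q T g : LinearMap.BilinForm ℝ L} {h₀ : Submodule ℝ L}
  {ι κ : Type*} [Fintype ι] [DecidableEq ι] [Fintype κ] [DecidableEq κ]

/-- The form which is diagonal with entries `μ` in the `g`-frame `f` of the complement of `h₀`. -/
def diagForm (g : LinearMap.BilinForm ℝ L) (f : ι → L) (μ : ι → ℝ) : LinearMap.BilinForm ℝ L :=
  ∑ i, μ i • (g (f i)).smulRight (g (f i))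

omit [DecidableEq ι] in
lemma diagForm_apply (f : ι → L) (μ : ι → ℝ) (x y : L) :
    diagForm g f μ x y = ∑ i, μ i * (g (f i) x * g (f i) y) := by
  simp [diagForm, LinearMap.sum_apply]

/-- The frame coefficients of `ad w`, `w ∈ h₀`, are skew. -/
lemma IsInvForm.skew_frame (hg : IsInvForm h₀ g) {w : L} (hw : w ∈ h₀) (x y : L) :
    g ⁅w, x⁆ y = -g ⁅w, y⁆ x := by
  have := hg.skew w hw x y
  rw [hg.symm x] at this
  linarith

lemma diagForm_frame (f : ι → L) (μ : ι → ℝ)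
    (hf : IsFrame g (ominus Q ⊤ h₀) f) (i j : ι) :
    diagForm g f μ (f i) (f j) = if i = j then μ i else 0 := by
  rw [diagForm_apply]
  simp only [hf.orth, mul_ite, mul_one, mul_zero, Finset.sum_ite_eq', Finset.mem_univ, if_true]
  by_cases h : i = j
  · subst h; simp
  · rw [if_neg h, if_neg (Ne.symm h)]

/-- The diagonal form is invariant if its eigenspaces are. -/
lemma IsInvForm.isInvForm_diagForm [Module.Finite ℝ L] (hQ : IsReductivePair Q h₀) (hg : IsInvForm h₀ g)
    {f : ι → L}
    (hf : IsFrame g (ominus Q ⊤ h₀) f) {μ : ι → ℝ} (hμ : ∀ i, 0 < μ i)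
    (h : ∀ w ∈ h₀, ∀ i j, (μ i - μ j) * g ⁅w, f i⁆ (f j) = 0) :
    IsInvForm h₀ (diagForm g f μ) := by
  refine ⟨fun x y => ?_, fun x hx => ?_, fun x hx y => ?_, fun w hw x y => ?_⟩
  · simp only [diagForm_apply, mul_comm (g (f _) x)]
  · rw [diagForm_apply]
    have hnn : ∀ i ∈ Finset.univ, 0 ≤ μ i * (g (f i) x * g (f i) x) := fun i _ =>
      mul_nonneg (hμ i).le (mul_self_nonneg _)
    refine lt_of_le_of_ne (Finset.sum_nonneg hnn) fun h0 => ?_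
    have h1 := (Finset.sum_eq_zero_iff_of_nonneg hnn).1 h0.symm
    have h2 : ∀ i, g (f i) x = 0 := fun i => by
      have := h1 i (Finset.mem_univ i)
      rcases mul_eq_zero.1 this with h3 | h3
      · exact absurd h3 (hμ i).ne'
      · exact mul_self_eq_zero.1 h3
    have h3 := hg.parseval hQ hf x x
    simp only [hg.symm x, h2, mul_zero, Finset.sum_const_zero] at h3
    exact absurd h3 (by rw [hg.symm x]; exact (hg.pos x hx).ne')
  · rw [diagForm_apply]
    simp [hg.ker' (f _) hx]
  · have e1 : ∀ x i, g (f i) ⁅w, x⁆ = -∑ j, g ⁅w, f i⁆ (f j) * g (f j) x := by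
      intro x i
      rw [hg.symm, hg.skew_frame hw, hf.parseval _ _ (hQ.lie_mem_compl hw (hf.mem i))]
    rw [diagForm_apply, diagForm_apply, ← Finset.sum_add_distrib]
    have e2 : ∀ i, μ i * (g (f i) ⁅w, x⁆ * g (f i) y) + μ i * (g (f i) x * g (f i) ⁅w, y⁆)
        = ∑ j, -(μ i * g ⁅w, f i⁆ (f j)) * (g (f j) x * g (f i) y + g (f i) x * g (f j) y) := by
      intro i
      rw [e1, e1, neg_mul, mul_neg, Finset.sum_mul, Finset.mul_sum]
      rw [mul_neg, mul_neg, Finset.mul_sum, Finset.mul_sum, ← neg_add, ← Finset.sum_add_distrib,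
        ← Finset.sum_neg_distrib]
      exact Finset.sum_congr rfl fun j _ => by ring
    rw [Finset.sum_congr rfl fun i _ => e2 i]
    rw [sum_sum_symmetrize]
    refine mul_eq_zero_of_right _ (Finset.sum_eq_zero fun i _ => Finset.sum_eq_zero fun j _ => ?_)
    have h1 := h w hw i j
    have h2 := hg.skew_frame hw (f i) (f j)
    have h3 : g ⁅w, f j⁆ (f i) = - g ⁅w, f i⁆ (f j) := by linarith
    rw [h3]
    linear_combination (-(g (f j) x * g (f i) y + g (f i) x * g (f j) y)) * h1

/-- The scalar curvature of a diagonal form in terms of the structure constants. -/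
lemma IsInvForm.scal_rescale [Module.Finite ℝ L] (hQ : IsReductivePair Q h₀) (hT : IsInvForm h₀ T)
    (hg : IsInvForm h₀ g) {f : ι → L} (hf : IsFrame T (ominus Q ⊤ h₀) f) {μ : ι → ℝ}
    (hμ : ∀ i, 0 < μ i) (h : ∀ i j, g (f i) (f j) = if i = j then μ i else 0) :
    scal g (fun i => (Real.sqrt (μ i))⁻¹ • f i) =
      -(1 / 2) * ∑ i, (μ i)⁻¹ * killingForm ℝ L (f i) (f i)
      - (1 / 4) * ∑ i, ∑ j, ∑ k, (μ i)⁻¹ * (μ j)⁻¹ * μ k * T ⁅f i, f j⁆ (f k) ^ 2 := by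
  have h1 : ∀ i, (Real.sqrt (μ i))⁻¹ * (Real.sqrt (μ i))⁻¹ = (μ i)⁻¹ := fun i => by
    rw [← mul_inv, Real.mul_self_sqrt (hμ i).le]
  obtain ⟨P, hP⟩ := exists_isOrthProj hQ h₀
  have hc : ∀ (b : LinearMap.BilinForm ℝ L), IsInvForm h₀ b → ∀ x y, b (x - P x) y = b x y := by
    intro b hb x y
    rw [map_sub, LinearMap.sub_apply, hb.ker _ (hP.mem x), sub_zero]
  have h2 : ∀ x, g x x = ∑ k, μ k * T x (f k) ^ 2 := by
    intro x
    have h3 : g x x = g (x - P x) (x - P x) := by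
      rw [hc g hg, hg.symm x (x - P x), hc g hg]
    rw [h3, hf.apply_eq_sum h (hP.mem_compl hQ x)]
    simp only [hc T hT]
  unfold scal
  congr 2
  · refine Finset.sum_congr rfl fun i _ => ?_
    rw [map_smul, map_smul, LinearMap.smul_apply, smul_eq_mul, smul_eq_mul, ← mul_assoc, h1]
  · refine Finset.sum_congr rfl fun i _ => Finset.sum_congr rfl fun j _ => ?_
    rw [smul_lie, lie_smul, smul_smul]
    simp only [map_smul, LinearMap.smul_apply, smul_eq_mul]
    rw [h2, ← mul_assoc, Finset.mul_sum]
    refine Finset.sum_congr rfl fun k _ => ?_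
    have : (Real.sqrt (μ i))⁻¹ * (Real.sqrt (μ j))⁻¹ * ((Real.sqrt (μ i))⁻¹ * (Real.sqrt (μ j))⁻¹)
      = (μ i)⁻¹ * (μ j)⁻¹ := by rw [← h1 i, ← h1 j]; ring
    rw [this]
    ring

omit [DecidableEq ι] in
/-- The trace of a form `b` in a rescaled frame. -/
lemma sum_rescale (b : LinearMap.BilinForm ℝ L) (f : ι → L) {μ : ι → ℝ} (hμ : ∀ i, 0 < μ i) :
    ∑ i, b ((Real.sqrt (μ i))⁻¹ • f i) ((Real.sqrt (μ i))⁻¹ • f i)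
      = ∑ i, (μ i)⁻¹ * b (f i) (f i) := by
  refine Finset.sum_congr rfl fun i _ => ?_
  rw [map_smul, map_smul, LinearMap.smul_apply, smul_eq_mul, smul_eq_mul, ← mul_assoc,
    ← mul_inv, Real.mul_self_sqrt (hμ i).le]

lemma IsFrame.sum_eq₂ {V : Type*} [AddCommGroup V] [Module ℝ V] {g : LinearMap.BilinForm ℝ V}
    {U : Submodule ℝ V} {e : ι → V} {f : κ → V} (he : IsFrame g U e) (hf : IsFrame g U f)
    (hs : ∀ x y, g x y = g y x) (φ ψ : V →ₗ[ℝ] ℝ) :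
    ∑ i, φ (e i) * ψ (e i) = ∑ j, φ (f j) * ψ (f j) :=
  he.sum_eq hf hs (φ.smulRight ψ)

/-- `ricForm` does not depend on the frame. -/
lemma IsFrame.ricForm_eq {U : Submodule ℝ L} {e : ι → L} {f : κ → L} (he : IsFrame g U e)
    (hf : IsFrame g U f) (hs : ∀ x y, g x y = g y x) (X Y : L) :
    ricForm g e X Y = ricForm g f X Y := by
  unfold ricForm
  have h1 : ∑ i, g ⁅X, e i⁆ ⁅Y, e i⁆ = ∑ i, g ⁅X, f i⁆ ⁅Y, f i⁆ :=
    he.sum_eq hf hs (g.compl₁₂ (LieAlgebra.ad ℝ L X) (LieAlgebra.ad ℝ L Y))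
  have h2 : ∑ i, ∑ j, g ⁅e i, e j⁆ X * g ⁅e i, e j⁆ Y
      = ∑ i, ∑ j, g ⁅f i, f j⁆ X * g ⁅f i, f j⁆ Y := by
    have h3 : ∀ i, ∑ j, g ⁅e i, e j⁆ X * g ⁅e i, e j⁆ Y
        = ∑ j, g ⁅e i, f j⁆ X * g ⁅e i, f j⁆ Y := fun i =>
      he.sum_eq₂ hf hs ((g.flip X).comp (LieAlgebra.ad ℝ L (e i)))
        ((g.flip Y).comp (LieAlgebra.ad ℝ L (e i)))
    have h4 : ∀ j, ∑ i, g ⁅e i, f j⁆ X * g ⁅e i, f j⁆ Y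
        = ∑ i, g ⁅f i, f j⁆ X * g ⁅f i, f j⁆ Y := fun j => by
      have h5 := he.sum_eq₂ hf hs ((g.flip X).comp (LieAlgebra.ad ℝ L (f j)))
        ((g.flip Y).comp (LieAlgebra.ad ℝ L (f j)))
      simp only [LinearMap.comp_apply, LinearMap.flip_apply, LieHom.coe_toLinearMap,
        LieAlgebra.ad_apply] at h5
      have h6 : ∀ x : L, g ⁅x, f j⁆ X * g ⁅x, f j⁆ Y = g ⁅f j, x⁆ X * g ⁅f j, x⁆ Y := fun x => by
        rw [← lie_skew x (f j)]
        simp only [map_neg, LinearMap.neg_apply, neg_mul_neg]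
      simp only [h6]
      exact h5
    rw [Finset.sum_congr rfl fun i _ => h3 i, Finset.sum_comm, Finset.sum_congr rfl fun j _ => h4 j,
      Finset.sum_comm]
  rw [h1, h2]

/-- `ad w`, `w ∈ h₀`, rotates frames infinitesimally. -/
lemma IsInvForm.sum_frame_skew (hQ : IsReductivePair Q h₀) (hg : IsInvForm h₀ g) {e : ι → L}
    (he : IsFrame g (ominus Q ⊤ h₀) e) {w : L} (hw : w ∈ h₀) (φ : LinearMap.BilinForm ℝ L) :
    ∑ i, (φ ⁅w, e i⁆ (e i) + φ (e i) ⁅w, e i⁆) = 0 := by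
  have e1 : ∀ i, ⁅w, e i⁆ = ∑ j, g ⁅w, e i⁆ (e j) • e j := fun i =>
    he.expand _ (hQ.lie_mem_compl hw (he.mem i))
  rw [Finset.sum_add_distrib]
  have e2 : ∑ i, φ ⁅w, e i⁆ (e i) = ∑ i, ∑ j, g ⁅w, e i⁆ (e j) * φ (e j) (e i) := by
    refine Finset.sum_congr rfl fun i _ => ?_
    conv_lhs => rw [e1 i]
    simp [LinearMap.sum_apply]
  have e3 : ∑ i, φ (e i) ⁅w, e i⁆ = ∑ i, ∑ j, g ⁅w, e i⁆ (e j) * φ (e i) (e j) := by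
    refine Finset.sum_congr rfl fun i _ => ?_
    conv_lhs => rw [e1 i]
    simp
  rw [e2, e3, Finset.sum_comm, ← Finset.sum_add_distrib]
  refine Finset.sum_eq_zero fun i _ => ?_
  rw [← Finset.sum_add_distrib]
  refine Finset.sum_eq_zero fun j _ => ?_
  rw [hg.skew_frame hw (e j) (e i)]
  ring

/-- `ricForm` is invariant under `ad w`, `w ∈ h₀`. -/
lemma IsInvForm.ricForm_skew [Module.Finite ℝ L] (hQ : IsReductivePair Q h₀) (hg : IsInvForm h₀ g)
    {e : ι → L}
    (he : IsFrame g (ominus Q ⊤ h₀) e) {w : L} (hw : w ∈ h₀) (X Y : L) :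
    ricForm g e ⁅w, X⁆ Y + ricForm g e X ⁅w, Y⁆ = 0 := by
  have hB : killingForm ℝ L ⁅w, X⁆ Y + killingForm ℝ L X ⁅w, Y⁆ = 0 := by
    rw [LieModule.traceForm_apply_lie_apply' ]
    ring
  have h1 : ∑ i, g ⁅⁅w, X⁆, e i⁆ ⁅Y, e i⁆ + ∑ i, g ⁅X, e i⁆ ⁅⁅w, Y⁆, e i⁆ = 0 := by
    have h2 := hg.sum_frame_skew hQ he hw
      (g.compl₁₂ (LieAlgebra.ad ℝ L X) (LieAlgebra.ad ℝ L Y))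
    simp only [LinearMap.compl₁₂_apply, LieAlgebra.ad_apply] at h2
    rw [← Finset.sum_add_distrib, ← neg_eq_zero, ← h2, ← Finset.sum_neg_distrib]
    refine Finset.sum_congr rfl fun i _ => ?_
    rw [lie_lie w X, lie_lie w Y]
    have := hg.skew w hw ⁅X, e i⁆ ⁅Y, e i⁆
    simp only [map_sub, LinearMap.sub_apply]
    linarith
  have h3 : ∑ i, ∑ j, g ⁅e i, e j⁆ ⁅w, X⁆ * g ⁅e i, e j⁆ Y
      + ∑ i, ∑ j, g ⁅e i, e j⁆ X * g ⁅e i, e j⁆ ⁅w, Y⁆ = 0 := by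
    have h4 : ∀ i, ∑ j, (g ⁅e i, ⁅w, e j⁆⁆ X * g ⁅e i, e j⁆ Y
        + g ⁅e i, e j⁆ X * g ⁅e i, ⁅w, e j⁆⁆ Y) = 0 := fun i =>
      hg.sum_frame_skew hQ he hw
        (((g.flip X).comp (LieAlgebra.ad ℝ L (e i))).smulRight
        ((g.flip Y).comp (LieAlgebra.ad ℝ L (e i))))
    have h5 : ∑ i, ∑ j, (g ⁅⁅w, e i⁆, e j⁆ X * g ⁅e i, e j⁆ Y
        + g ⁅e i, e j⁆ X * g ⁅⁅w, e i⁆, e j⁆ Y) = 0 := by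
      have h4' : ∑ i, ∑ j, (g ⁅e i, ⁅w, e j⁆⁆ X * g ⁅e i, e j⁆ Y
          + g ⁅e i, e j⁆ X * g ⁅e i, ⁅w, e j⁆⁆ Y) = 0 := Finset.sum_eq_zero fun i _ => h4 i
      rw [Finset.sum_comm, ← h4', ← sub_eq_zero]
      simp only [← Finset.sum_sub_distrib]
      refine Finset.sum_eq_zero fun i _ => Finset.sum_eq_zero fun j _ => ?_
      rw [← lie_skew ⁅w, e j⁆ (e i), ← lie_skew (e j) (e i)]
      simp only [map_neg, LinearMap.neg_apply]
      ring
    have h6 : ∀ i j, ∀ Z, g ⁅e i, e j⁆ ⁅w, Z⁆ = - g ⁅⁅w, e i⁆, e j⁆ Z - g ⁅e i, ⁅w, e j⁆⁆ Z := by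
      intro i j Z
      have h7 := hg.skew w hw ⁅e i, e j⁆ Z
      rw [leibniz_lie, map_add, LinearMap.add_apply] at h7
      linarith
    have h4' := Finset.sum_congr rfl fun i (_ : i ∈ Finset.univ) => h4 i
    simp only [h6]
    rw [Finset.sum_const_zero] at h4'
    have h8 := congrArg₂ (· + ·) h4' h5
    simp only [← Finset.sum_add_distrib, add_zero] at h8 ⊢
    rw [← neg_eq_zero, ← h8]
    simp only [← Finset.sum_neg_distrib]
    exact Finset.sum_congr rfl fun i _ => Finset.sum_congr rfl fun j _ => by ring
  unfold ricForm
  linear_combination (-(1 / 2)) * hB - (1 / 2) * h1 + (1 / 4) * h3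

end Variation

/-! ### The first variation -/

section Critical

variable {L : Type*} [LieRing L] [LieAlgebra ℝ L] [Module.Finite ℝ L]
  {Q T g : LinearMap.BilinForm ℝ L} {h₀ : Submodule ℝ L}
  {ι κ : Type*} [Fintype ι] [DecidableEq ι] [Fintype κ] [DecidableEq κ]

/-- `ricForm` as an element of `LinearMap.BilinForm`. -/
def ricBilin (g : LinearMap.BilinForm ℝ L) (e : ι → L) : LinearMap.BilinForm ℝ L :=
  LinearMap.mk₂ ℝ (fun X Y => ricForm g e X Y)
  (fun x y z => by
    simp only [ricForm, map_add, LinearMap.add_apply, add_lie, mul_add, add_mul,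
      Finset.sum_add_distrib]
    ring)
  (fun a x y => by
    simp only [ricForm, map_smul, LinearMap.smul_apply, smul_lie, smul_eq_mul, mul_assoc,
      ← Finset.mul_sum]
    ring)
  (fun x y z => by
    simp only [ricForm, map_add, LinearMap.add_apply, add_lie, mul_add, add_mul,
      Finset.sum_add_distrib]
    ring)
  (fun a x y => by
    simp only [ricForm, map_smul, LinearMap.smul_apply, smul_lie, smul_eq_mul,
      mul_left_comm _ a, ← Finset.mul_sum]
    ring)

/-- First variation: if `scal g' ≤ c tr_{g'} T` for all invariant forms `g'`, with equality for `g`,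
then `g` has Ricci form `c T`. It suffices to vary `g` in one direction, `ric - c T`, which is
`ad h₀`-invariant; the derivative in this direction is the squared norm of `ric - c T`. -/
theorem IsInvForm.ricForm_eq_of_isMax (hQ : IsReductivePair Q h₀) (hT : IsInvForm h₀ T)
    (hg : IsInvForm h₀ g) {e : ι → L} (he : IsFrame g (ominus Q ⊤ h₀) e)
    (htr : ∑ i, T (e i) (e i) = 1)
    (hmax : ∀ g' : LinearMap.BilinForm ℝ L, IsInvForm h₀ g' →
      ∀ e' : Fin (Module.finrank ℝ (ominus Q ⊤ h₀)) → L, IsFrame g' (ominus Q ⊤ h₀) e' →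
      scal g' e' ≤ scal g e * ∑ i, T (e' i) (e' i)) {X Y : L} (hX : X ∈ ominus Q ⊤ h₀)
    (hY : Y ∈ ominus Q ⊤ h₀) : ricForm g e X Y = scal g e * T X Y := by
  set c := scal g e with hc
  let R : LinearMap.BilinForm ℝ L := ricBilin g e
  have hR : ∀ X Y, R X Y = ricForm g e X Y := fun _ _ => rfl
  have hRs : ∀ X Y, R X Y = R Y X := by
    intro X Y
    simp only [hR, ricForm, LieModule.traceForm_comm ℝ L L X Y, hg.symm ⁅X, _⁆ ⁅Y, _⁆,
      mul_comm (g _ X)]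
  let φ : LinearMap.BilinForm ℝ L := R - c • T
  have hφ : ∀ X Y, φ X Y = ricForm g e X Y - c * T X Y := fun _ _ => rfl
  have hφs : ∀ X Y, φ X Y = φ Y X := fun X Y => by
    simp only [hφ, ← hR]
    rw [hRs, hT.symm]
  have hφi : ∀ w ∈ h₀, ∀ X Y, φ ⁅w, X⁆ Y + φ X ⁅w, Y⁆ = 0 := by
    intro w hw X Y
    simp only [hφ]
    have h1 := hg.ricForm_skew hQ he hw X Y
    have h2 := hT.skew w hw X Y
    linear_combination h1 - c * h2
  obtain ⟨f, s, hf, hs⟩ := exists_frame_diag g φ (ominus Q ⊤ h₀) hg.symm (hg.pos_compl hQ) hφs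
  have hinv : ∀ w ∈ h₀, ∀ i j, (s i - s j) * g ⁅w, f i⁆ (f j) = 0 := by
    intro w hw i j
    have h1 : ∀ i j, φ ⁅w, f i⁆ (f j) = g ⁅w, f i⁆ (f j) * s j := by
      intro i j
      conv_lhs => rw [hf.expand _ (hQ.lie_mem_compl hw (hf.mem i))]
      simp [LinearMap.sum_apply, hs]
    have h2 := hφi w hw (f i) (f j)
    rw [hφs (f i), h1, h1, hg.skew_frame hw (f j)] at h2
    linarith
  -- the forms with eigenvalues `exp (t * s i)` in the frame `f` are invariant by `hinv`
  have hvar : ∀ t : ℝ, 0 ≤ c * ∑ i, (Real.exp (t * s i))⁻¹ * T (f i) (f i)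
      - (-(1 / 2) * ∑ i, (Real.exp (t * s i))⁻¹ * killingForm ℝ L (f i) (f i)
      - (1 / 4) * ∑ i, ∑ j, ∑ k, (Real.exp (t * s i))⁻¹ * (Real.exp (t * s j))⁻¹ *
        Real.exp (t * s k) * g ⁅f i, f j⁆ (f k) ^ 2) := by
    intro t
    have hμ : ∀ i, 0 < Real.exp (t * s i) := fun i => Real.exp_pos _
    have hgt : IsInvForm h₀ (diagForm g f fun i => Real.exp (t * s i)) :=
      hg.isInvForm_diagForm hQ hf hμ fun w hw i j => by
        rcases mul_eq_zero.1 (hinv w hw i j) with h | h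
        · rw [sub_eq_zero.1 h, sub_self, zero_mul]
        · rw [h, mul_zero]
    have hd := diagForm_frame f (fun i => Real.exp (t * s i)) hf
    have h1 := hmax _ hgt _ (hf.rescale hμ hd)
    rw [IsInvForm.scal_rescale hQ hg hgt hf hμ hd] at h1
    rw [sum_rescale T f hμ] at h1
    linarith
  have hsc : c = -(1 / 2) * ∑ i, killingForm ℝ L (f i) (f i)
      - (1 / 4) * ∑ i, ∑ j, ∑ k, g ⁅f i, f j⁆ (f k) ^ 2 := by
    rw [hc, he.scal_eq hf hg.symm, scal]
    simp only [hg.parseval hQ hf ⁅_, _⁆ ⁅_, _⁆, sq]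
  have htr' : ∑ i, T (f i) (f i) = 1 := by rw [← htr]; exact (he.sum_eq hf hg.symm T).symm
  set p : ℝ → ℝ := fun t => c * ∑ i, (Real.exp (t * s i))⁻¹ * T (f i) (f i)
      - (-(1 / 2) * ∑ i, (Real.exp (t * s i))⁻¹ * killingForm ℝ L (f i) (f i)
      - (1 / 4) * ∑ i, ∑ j, ∑ k, (Real.exp (t * s i))⁻¹ * (Real.exp (t * s j))⁻¹ *
        Real.exp (t * s k) * g ⁅f i, f j⁆ (f k) ^ 2) with hp
  have hp0 : p 0 = 0 := by
    simp only [hp, zero_mul, Real.exp_zero, inv_one, one_mul, htr']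
    linarith
  have hexp : ∀ a : ℝ, HasDerivAt (fun t : ℝ => Real.exp (t * a)) a 0 := fun a => by
    have := ((hasDerivAt_id (0 : ℝ)).mul_const a).exp
    simpa using this
  have hexpi : ∀ a : ℝ, HasDerivAt (fun t : ℝ => (Real.exp (t * a))⁻¹) (-a) 0 := fun a => by
    have := (hexp a).fun_inv (Real.exp_pos _).ne'
    simpa using this
  have hderiv : HasDerivAt p (c * ∑ i, (-s i) * T (f i) (f i)
      - (-(1 / 2) * ∑ i, (-s i) * killingForm ℝ L (f i) (f i)
      - (1 / 4) * ∑ i, ∑ j, ∑ k, (-s i - s j + s k) * g ⁅f i, f j⁆ (f k) ^ 2)) 0 := by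
    refine ((HasDerivAt.fun_sum fun i _ => (hexpi (s i)).mul_const _).const_mul c).sub
      (((HasDerivAt.fun_sum fun i _ => (hexpi (s i)).mul_const _).const_mul _).sub
      ((HasDerivAt.fun_sum fun i _ => HasDerivAt.fun_sum fun j _ => HasDerivAt.fun_sum fun k _ =>
        ?_).const_mul _))
    refine ((((hexpi (s i)).fun_mul (hexpi (s j))).fun_mul (hexp (s k))).mul_const
      (g ⁅f i, f j⁆ (f k) ^ 2)).congr_deriv ?_
    simp only [zero_mul, Real.exp_zero, inv_one, one_mul, mul_one]
    ring
  have hz : (c * ∑ i, (-s i) * T (f i) (f i)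
      - (-(1 / 2) * ∑ i, (-s i) * killingForm ℝ L (f i) (f i)
      - (1 / 4) * ∑ i, ∑ j, ∑ k, (-s i - s j + s k) * g ⁅f i, f j⁆ (f k) ^ 2)) = 0 := by
    have hmin : IsLocalMin p 0 := Filter.Eventually.of_forall fun t => by
      rw [hp0]; exact hvar t
    exact hmin.hasDerivAt_eq_zero hderiv
  -- the derivative `hz` of `p` at its minimum is `∑ i, s i ^ 2`
  have hsq : ∑ i, s i ^ 2 = 0 := by
    have h1 : ∀ i, s i = -(1 / 2) * killingForm ℝ L (f i) (f i)
        - (1 / 2) * ∑ j, ∑ k, g ⁅f i, f j⁆ (f k) ^ 2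
        + (1 / 4) * ∑ j, ∑ k, g ⁅f j, f k⁆ (f i) ^ 2 - c * T (f i) (f i) := by
      intro i
      have h2 := hs i i
      rw [if_pos rfl, hφ, he.ricForm_eq hf hg.symm] at h2
      rw [← h2]
      simp only [ricForm, hg.parseval hQ hf ⁅f i, _⁆ ⁅f i, _⁆, sq]
    have h3 : ∑ i, s i ^ 2 = -(1 / 2) * ∑ i, s i * killingForm ℝ L (f i) (f i)
        - (1 / 2) * ∑ i, ∑ j, ∑ k, s i * g ⁅f i, f j⁆ (f k) ^ 2
        + (1 / 4) * ∑ i, ∑ j, ∑ k, s i * g ⁅f j, f k⁆ (f i) ^ 2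
        - c * ∑ i, s i * T (f i) (f i) := by
      simp only [Finset.mul_sum (s := Finset.univ) (a := c),
        Finset.mul_sum (s := Finset.univ) (a := (1 / 2 : ℝ)),
        Finset.mul_sum (s := Finset.univ) (a := (-(1 / 2) : ℝ)),
        Finset.mul_sum (s := Finset.univ) (a := (1 / 4 : ℝ)), ← Finset.sum_sub_distrib,
        ← Finset.sum_add_distrib]
      refine Finset.sum_congr rfl fun i _ => ?_
      simp only [← Finset.mul_sum]
      linear_combination s i * h1 i
    have h4 : c * ∑ i, (-s i) * T (f i) (f i) = - (c * ∑ i, s i * T (f i) (f i)) := by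
      simp only [neg_mul, Finset.sum_neg_distrib, mul_neg]
    have h5 : ∑ i, (-s i) * killingForm ℝ L (f i) (f i)
        = - ∑ i, s i * killingForm ℝ L (f i) (f i) := by
      simp only [neg_mul, Finset.sum_neg_distrib]
    have h6 : ∑ i, ∑ j, ∑ k, (-s i - s j + s k) * g ⁅f i, f j⁆ (f k) ^ 2
        = - ∑ i, ∑ j, ∑ k, s i * g ⁅f i, f j⁆ (f k) ^ 2
          - ∑ i, ∑ j, ∑ k, s j * g ⁅f i, f j⁆ (f k) ^ 2
          + ∑ i, ∑ j, ∑ k, s k * g ⁅f i, f j⁆ (f k) ^ 2 := by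
      simp only [Finset.sum_add_distrib, Finset.sum_sub_distrib, add_mul, sub_mul,
        neg_mul, Finset.sum_neg_distrib]
    have sw1 : ∑ i, ∑ j, ∑ k, s i * g ⁅f j, f k⁆ (f i) ^ 2
        = ∑ i, ∑ j, ∑ k, s k * g ⁅f i, f j⁆ (f k) ^ 2 := by
      rw [Finset.sum_comm]
      refine Finset.sum_congr rfl fun i _ => ?_
      rw [Finset.sum_comm]
    have sw2 : ∑ i, ∑ j, ∑ k, s j * g ⁅f i, f j⁆ (f k) ^ 2
        = ∑ i, ∑ j, ∑ k, s i * g ⁅f i, f j⁆ (f k) ^ 2 := by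
      rw [Finset.sum_comm]
      refine Finset.sum_congr rfl fun i _ => Finset.sum_congr rfl fun j _ =>
        Finset.sum_congr rfl fun k _ => ?_
      rw [← lie_skew (f i) (f j)]
      simp only [map_neg, LinearMap.neg_apply, neg_sq]
    rw [h4, h5, h6, sw2] at hz
    rw [h3, sw1]
    linarith
  have hs0 : ∀ i, s i = 0 := fun i => by
    have := (Finset.sum_eq_zero_iff_of_nonneg (fun i _ => sq_nonneg (s i))).1 hsq i
      (Finset.mem_univ i)
    exact pow_eq_zero_iff (two_ne_zero) |>.1 this
  have hfin : φ X Y = 0 := by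
    rw [hf.expand X hX, hf.expand Y hY]
    simp [LinearMap.sum_apply, hs, hs0]
  rw [hφ] at hfin
  linarith

end Critical

/-! ### Test metrics -/

section TestMetrics

variable {L : Type*} [LieRing L] [LieAlgebra ℝ L] [Module.Finite ℝ L]
  {Q T : LinearMap.BilinForm ℝ L} {h₀ : Submodule ℝ L} {Γ : Type*} {A : Γ → L → L}
  {ι κ : Type*} [Fintype ι] [DecidableEq ι] [Fintype κ] [DecidableEq κ]

/-- `-B(x, x)` is the squared norm of the `Q`-skew map `ad x`, and dominates the part of the norm
which comes from the complement of `h₀`. -/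
lemma IsReductivePair.sum_le_neg_killing (hQ : IsReductivePair Q h₀) {v : ι → L}
    (hv : IsFrame Q (ominus Q ⊤ h₀) v) (x : L) :
    ∑ i, Q ⁅x, v i⁆ ⁅x, v i⁆ ≤ -killingForm ℝ L x x := by
  obtain ⟨w, hw⟩ := exists_frame Q h₀ hQ.symm (fun x _ => hQ.pos x)
  have h1 := hv.sum_elim hw (fun x hx y hy => by
      rw [hQ.symm]; exact (mem_ominus.1 hx).2 y hy) (fun x hx y hy => (mem_ominus.1 hy).2 x hx)
  have htop : ominus Q ⊤ h₀ ⊔ h₀ = ⊤ := by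
    obtain ⟨P, hP⟩ := exists_isOrthProj hQ h₀
    refine eq_top_iff.2 fun y _ => ?_
    have := Submodule.add_mem_sup (hP.mem_compl hQ y) (hP.mem y)
    rwa [sub_add_cancel] at this
  rw [htop] at h1
  have h2 := h1.trace_eq ((LieAlgebra.ad ℝ L x) ∘ₗ (LieAlgebra.ad ℝ L x))
  have h3 : killingForm ℝ L x x = -∑ i, Q ⁅x, Sum.elim v w i⁆ ⁅x, Sum.elim v w i⁆ := by
    rw [killingForm_apply_apply, h2, ← Finset.sum_neg_distrib]
    refine Finset.sum_congr rfl fun i _ => ?_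
    have h4 := hQ.skew x ⁅x, Sum.elim v w i⁆ (Sum.elim v w i)
    simp only [LinearMap.comp_apply, LieAlgebra.ad_apply]
    linarith
  rw [h3, neg_neg, Fintype.sum_sum_type]
  simp only [Sum.elim_inl, Sum.elim_inr]
  have := Finset.sum_nonneg (s := Finset.univ) fun i _ => hQ.nonneg ⁅x, w i⁆
  linarith

/-- `σ(k, T)` is nonnegative; this is seen by evaluating `Ŝ` at a multiple of `Q`. -/
lemma sigma_nonneg (hA : IsAdapted A h₀) (hQ : IsReductivePair Q h₀) (hT : IsInvForm h₀ T)
    (k : LieSubalgebra ℝ L) (hk : h₀ < k.toSubmodule) : 0 ≤ sigma A Q T h₀ k := by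
  obtain ⟨P, hP⟩ := exists_isOrthProj hQ (ominus Q k.toSubmodule h₀)
  have hPl := hP.lie hQ (hQ.lie_mem_n k hk.le)
  set g : LinearMap.BilinForm ℝ L := Q.comp P P with hg
  have hga : ∀ x y, g x y = Q (P x) (P y) := fun _ _ => rfl
  have hs : ∀ x y, g x y = g y x := fun x y => hQ.symm _ _
  have hmem : ∀ x ∈ ominus Q k.toSubmodule h₀, P x = x := fun x hx => hP.apply_mem hQ hx
  have hker : ∀ x ∈ h₀, ∀ y, g x y = 0 := fun x hx y => by
    rw [hga, hP.unique hQ (Submodule.zero_mem _) (fun u hu => by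
      rw [sub_zero]; exact (mem_ominus.1 hu).2 x hx), map_zero, LinearMap.zero_apply]
  have hp : ∀ x ∈ ominus Q k.toSubmodule h₀, x ≠ 0 → 0 < g x x := fun x hx h => by
    rw [hga, hmem x hx]; exact hQ.pos x h
  have hgi : IsAdInvariant h₀ g := fun w hw x y => by
    rw [hga, hga, hPl w hw, hPl w hw]; exact hQ.skew _ _ _
  obtain ⟨e, he⟩ := exists_frame Q (ominus Q k.toSubmodule h₀) hQ.symm (fun x _ => hQ.pos x)
  have he' : IsFrame g (ominus Q k.toSubmodule h₀) e := he.congr fun x hx y hy => by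
    rw [hga, hmem x hx, hmem y hy]
  obtain ⟨v, hv⟩ := exists_frame Q (ominus Q ⊤ k.toSubmodule) hQ.symm (fun x _ => hQ.pos x)
  obtain ⟨h0, h1⟩ := Shat_le_sigma hA hQ hT k hk hs hker hp hgi he'
  rw [Shat_eq hQ k hk.le hs hker (fun _ _ => rfl) he' hv] at h1
  have hev := he.sum_elim hv (fun x hx y hy => hQ.orth_ominus k hx hy)
    (fun x hx y hy => by rw [hQ.symm]; exact hQ.orth_ominus k hy hx)
  rw [hQ.sup_eq k hk.le] at hev
  have h2 : ∀ i, ∑ j, Q ⁅e i, e j⁆ ⁅e i, e j⁆ + ∑ a, Q ⁅e i, v a⁆ ⁅e i, v a⁆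
      ≤ -killingForm ℝ L (e i) (e i) := fun i => by
    have := hQ.sum_le_neg_killing hev (e i)
    simpa only [Fintype.sum_sum_type, Sum.elim_inl, Sum.elim_inr] using this
  have h3 := Finset.sum_le_sum fun i (_ : i ∈ Finset.univ) => h2 i
  rw [Finset.sum_add_distrib, Finset.sum_neg_distrib] at h3
  have h4 : ∀ x, g x x ≤ Q x x := fun x => by
    have h5 : Q (x - P x) (P x) = 0 := hP.orth x _ (hP.mem x)
    have h6 := hQ.nonneg (x - P x)
    rw [hga]
    simp only [map_sub, LinearMap.sub_apply] at h5 h6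
    have := hQ.symm x (P x)
    linarith
  have h5 : ∑ i, ∑ j, g ⁅e i, e j⁆ ⁅e i, e j⁆ ≤ ∑ i, ∑ j, Q ⁅e i, e j⁆ ⁅e i, e j⁆ :=
    Finset.sum_le_sum fun i _ => Finset.sum_le_sum fun j _ => h4 _
  have h6 : 0 ≤ ∑ i, ∑ j, Q ⁅e i, e j⁆ ⁅e i, e j⁆ :=
    Finset.sum_nonneg fun i _ => Finset.sum_nonneg fun j _ => hQ.nonneg _
  have h7 : 0 ≤ (∑ i, T (e i) (e i)) * sigma A Q T h₀ k := by linarith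
  exact nonneg_of_mul_nonneg_right h7 h0

/-- A metric whose scalar curvature exceeds `σ(k, T)`: if `h` attains `σ(k, T)`, the metrics
`(1 - ε tr_Q T|_l)⁻¹ h + ε⁻¹ Q|_l` satisfy `tr T = 1`, and their scalar curvature tends to `σ(k, T)`
for `ε → 0`, with derivative `(-2 tr_Q B|_l - ⟨lll⟩ - 4 σ(k, T) tr_Q T|_l) / 4` at `ε = 0`. -/
lemma exists_scal_gt (hA : IsAdapted A h₀) (hQ : IsReductivePair Q h₀) (hT : IsInvForm h₀ T)
    (k : LieSubalgebra ℝ L) (hk : IsApical A Q T h₀ k)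
    (hineq : 4 * sigma A Q T h₀ k
          * trForm (restr Q (ominus Q ⊤ k.toSubmodule)) (restr T (ominus Q ⊤ k.toSubmodule))
        < -2 * trForm (restr Q (ominus Q ⊤ k.toSubmodule))
              (restr (killingForm ℝ L) (ominus Q ⊤ k.toSubmodule))
          - structConst Q (ominus Q ⊤ k.toSubmodule) (ominus Q ⊤ k.toSubmodule)
            (ominus Q ⊤ k.toSubmodule)) :
    ∃ g, IsInvForm h₀ g ∧ ∃ e : Fin (Module.finrank ℝ (ominus Q k.toSubmodule h₀)) ⊕
      Fin (Module.finrank ℝ (ominus Q ⊤ k.toSubmodule)) → L, IsFrame g (ominus Q ⊤ h₀) e ∧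
      ∑ i, T (e i) (e i) = 1 ∧ sigma A Q T h₀ k < scal g e := by
  set σ := sigma A Q T h₀ k with hσ
  obtain ⟨h, ⟨hh, htr⟩, hS⟩ := hk.attained
  obtain ⟨b, hbs, hbr, hbz, hbp, hbi⟩ := hh.exists_extension hA hQ k hk.lt.le
  have hbker : ∀ x ∈ h₀, ∀ y, b x y = 0 := fun x hx => hbz x fun u hu => (mem_ominus.1 hu).2 x hx
  have hbl : ∀ x ∈ ominus Q ⊤ k.toSubmodule, ∀ y, b x y = 0 := fun x hx => hbz x fun u hu => by
    rw [hQ.symm]; exact hQ.orth_ominus k hu hx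
  obtain ⟨u, hu⟩ := exists_frame b (ominus Q k.toSubmodule h₀) hbs hbp
  obtain ⟨v, hv⟩ := exists_frame Q (ominus Q ⊤ k.toSubmodule) hQ.symm (fun x _ => hQ.pos x)
  obtain ⟨P, hP⟩ := exists_isOrthProj hQ (ominus Q ⊤ k.toSubmodule)
  have hPl := hP.lie hQ (fun w hw x hx => hQ.lie_mem_ominus k (hk.lt.le hw) hx)
  have hPv : ∀ x ∈ ominus Q ⊤ k.toSubmodule, P x = x := fun x hx => hP.apply_mem hQ hx
  have hPk : ∀ x ∈ k, P x = 0 := fun x hx => hP.unique hQ (Submodule.zero_mem _) fun z hz => by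
    rw [sub_zero]; exact (mem_ominus.1 hz).2 x hx
  rw [trForm_subtype hu hbs hbr] at htr
  rw [Shat_eq hQ k hk.lt.le hbs hbker hbr hu hv] at hS
  rw [structConst, deltaNormSq_eq hQ (b := Q) (g₂ := Q) (g₃ := Q) (X₁ := restr Q _)
      (X₂ := restr Q _) (X₃ := restr Q _) hP (fun _ _ => rfl)
    (fun _ _ => rfl) (fun _ _ => rfl)
    hQ.symm hQ.symm hv hv, trForm_subtype (h := restr Q _) (g := Q) hv hQ.symm (fun _ _ => rfl),
    trForm_subtype (h := restr Q _) (g := Q) hv hQ.symm (fun _ _ => rfl)] at hineq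
  set τ := ∑ a, T (v a) (v a) with hτ
  set β := ∑ a, killingForm ℝ L (v a) (v a) with hβ
  set s := ∑ i, ∑ j, Q (P ⁅v i, v j⁆) (P ⁅v i, v j⁆) with hs
  set C' := ∑ i, ∑ j, b ⁅v i, v j⁆ ⁅v i, v j⁆ with hC'
  -- the lower bound for the scalar curvature is the one computed at the end of the proof
  have hpoly : ∃ ε : ℝ, 0 < ε ∧ 0 < 1 - ε * τ ∧
      σ < (1 - ε * τ) * σ - (1 / 2) * ε * β - (1 / 4) * ε * s
        - (1 / 4) * ε ^ 2 * (1 - ε * τ)⁻¹ * C' := by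
    have hD : 0 < -2 * β - s - 4 * σ * τ := by linarith
    have ht : Tendsto (fun ε : ℝ => ε * (1 - ε * τ)⁻¹ * C') (𝓝[>] 0) (𝓝 0) := by
      have : ContinuousAt (fun ε : ℝ => ε * (1 - ε * τ)⁻¹ * C') 0 :=
        ((continuousAt_id.mul ((continuousAt_const.sub (continuousAt_id.mul
          continuousAt_const)).inv₀ (by simp))).mul continuousAt_const)
      have h1 := this.tendsto
      simp only [zero_mul] at h1
      exact h1.mono_left nhdsWithin_le_nhds
    have ht2 : Tendsto (fun ε : ℝ => 1 - ε * τ) (𝓝[>] 0) (𝓝 1) := by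
      have : Continuous fun ε : ℝ => 1 - ε * τ := by fun_prop
      have h1 := this.tendsto 0
      simp only [zero_mul, sub_zero] at h1
      exact h1.mono_left nhdsWithin_le_nhds
    obtain ⟨ε, h1, h2, h3⟩ := ((ht.eventually (gt_mem_nhds hD)).and
      ((ht2.eventually (lt_mem_nhds zero_lt_one)).and self_mem_nhdsWithin)).exists
    refine ⟨ε, h3, h2, ?_⟩
    have h3 : 0 < ε := h3
    nlinarith [mul_lt_mul_of_pos_left h1 h3]
  obtain ⟨ε, hε, hθ, hgt⟩ := hpoly
  set θ := 1 - ε * τ with hθd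
  set g : LinearMap.BilinForm ℝ L := θ⁻¹ • b + ε⁻¹ • Q.comp P P with hg
  have hga : ∀ x y, g x y = θ⁻¹ * b x y + ε⁻¹ * Q (P x) (P y) := fun _ _ => rfl
  have hgs : ∀ x y, g x y = g y x := fun x y => by rw [hga, hga, hbs, hQ.symm]
  have hnk : ∀ x ∈ ominus Q k.toSubmodule h₀, x ∈ k := fun x hx => (mem_ominus.1 hx).1
  have hu' : IsFrame (θ⁻¹ • b) (ominus Q k.toSubmodule h₀)
      fun i => (Real.sqrt θ⁻¹)⁻¹ • u i := hu.smul (inv_pos.2 hθ)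
  have hv' : IsFrame (ε⁻¹ • Q) (ominus Q ⊤ k.toSubmodule)
      fun i => (Real.sqrt ε⁻¹)⁻¹ • v i := hv.smul (inv_pos.2 hε)
  have hug : IsFrame g (ominus Q k.toSubmodule h₀) fun i => (Real.sqrt θ⁻¹)⁻¹ • u i :=
    hu'.congr fun x hx y _ => by
      rw [hga, hPk x (hnk x hx), map_zero, LinearMap.zero_apply, mul_zero, add_zero]; rfl
  have hvg : IsFrame g (ominus Q ⊤ k.toSubmodule) fun i => (Real.sqrt ε⁻¹)⁻¹ • v i :=
    hv'.congr fun x hx y hy => by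
      rw [hga, hbl x hx, mul_zero, zero_add, hPv x hx, hPv y hy]; rfl
  have horth : ∀ x ∈ ominus Q k.toSubmodule h₀, ∀ y ∈ ominus Q ⊤ k.toSubmodule, g x y = 0 := by
    intro x hx y hy
    rw [hga, hPk x (hnk x hx), map_zero, LinearMap.zero_apply, hbs, hbl y hy]
    simp
  have hfr := hug.sum_elim hvg horth (fun x hx y hy => by rw [hgs]; exact horth y hy x hx)
  rw [hQ.sup_eq k hk.lt.le] at hfr
  have hgker : ∀ x ∈ h₀, ∀ y, g x y = 0 := fun x hx y => by
    rw [hga, hbker x hx, hPk x (hk.lt.le hx)]; simp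
  have hg' : IsInvForm h₀ g := by
    refine ⟨hgs, fun x hx => ?_, hgker, fun w hw x y => ?_⟩
    · obtain ⟨P₀, hP₀⟩ := exists_isOrthProj hQ h₀
      have h1 : x - P₀ x ≠ 0 := fun h => hx (by rw [sub_eq_zero.1 h]; exact hP₀.mem x)
      have h2 : g x x = g (x - P₀ x) (x - P₀ x) := by
        have := hgs x (P₀ x)
        simp only [map_sub, LinearMap.sub_apply, this, hgker _ (hP₀.mem x), sub_zero]
      have h3 := hP₀.mem_compl hQ x
      rw [h2, hfr.apply_eq_sum (μ := fun _ => 1) hfr.orth h3]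
      refine lt_of_le_of_ne (Finset.sum_nonneg fun i _ => by positivity) fun h0 => h1 ?_
      have h4 := (Finset.sum_eq_zero_iff_of_nonneg (fun i _ => by positivity)).1 h0.symm
      rw [hfr.expand _ h3]
      refine Finset.sum_eq_zero fun i hi => ?_
      have := h4 i hi
      rw [one_mul, pow_eq_zero_iff two_ne_zero] at this
      rw [this, zero_smul]
    · rw [hga, hga, hPl w hw, hPl w hw]
      have h1 := hbi w hw x y
      have h2 := hQ.skew w (P x) (P y)
      linear_combination θ⁻¹ * h1 + ε⁻¹ * h2
  have hsq : ∀ t : ℝ, 0 < t → (Real.sqrt t⁻¹)⁻¹ * (Real.sqrt t⁻¹)⁻¹ = t := fun t ht => by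
    rw [← mul_inv, Real.mul_self_sqrt (inv_pos.2 ht).le, inv_inv]
  have hbil : ∀ (b : LinearMap.BilinForm ℝ L) (t : ℝ), 0 < t → ∀ x : L,
      b ((Real.sqrt t⁻¹)⁻¹ • x) ((Real.sqrt t⁻¹)⁻¹ • x) = t * b x x := fun b t ht x => by
    rw [map_smul, map_smul, LinearMap.smul_apply, smul_eq_mul, smul_eq_mul, ← mul_assoc, hsq t ht]
  have hbil2 : ∀ (b : LinearMap.BilinForm ℝ L) (t r : ℝ), 0 < t → 0 < r → ∀ x y : L,
      b ⁅(Real.sqrt t⁻¹)⁻¹ • x, (Real.sqrt r⁻¹)⁻¹ • y⁆ ⁅(Real.sqrt t⁻¹)⁻¹ • x, (Real.sqrt r⁻¹)⁻¹ • y⁆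
      = t * r * b ⁅x, y⁆ ⁅x, y⁆ := fun b t r ht hr x y => by
    rw [smul_lie, lie_smul, hbil b t ht, hbil b r hr, mul_assoc]
  refine ⟨g, hg', _, hfr, ?_, ?_⟩
  · rw [Fintype.sum_sum_type]
    simp only [Sum.elim_inl, Sum.elim_inr, hbil T θ hθ, hbil T ε hε, ← Finset.mul_sum]
    rw [htr, ← hτ, hθd]
    ring
  · rw [scal_sum_elim]
    simp only [hbil _ θ hθ, hbil _ ε hε, hbil2 _ θ θ hθ hθ, hbil2 _ θ ε hθ hε, hbil2 _ ε ε hε hε,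
      ← Finset.mul_sum]
    have h1 : ∑ i, ∑ j, g ⁅u i, u j⁆ ⁅u i, u j⁆ = θ⁻¹ * ∑ i, ∑ j, b ⁅u i, u j⁆ ⁅u i, u j⁆ := by
      simp only [Finset.mul_sum]
      refine Finset.sum_congr rfl fun i _ => Finset.sum_congr rfl fun j _ => ?_
      rw [hga, hPk _ (k.lie_mem (hnk _ (hu.mem i)) (hnk _ (hu.mem j)))]
      simp
    have h2 : ∑ i, ∑ j, g ⁅u i, v j⁆ ⁅u i, v j⁆ = ε⁻¹ * ∑ i, ∑ j, Q ⁅u i, v j⁆ ⁅u i, v j⁆ := by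
      simp only [Finset.mul_sum]
      refine Finset.sum_congr rfl fun i _ => Finset.sum_congr rfl fun j _ => ?_
      have h3 := hQ.lie_mem_ominus k (hnk _ (hu.mem i)) (hv.mem j)
      rw [hga, hPv _ h3, hbl _ h3]
      simp
    have h3 : ∑ i, ∑ j, g ⁅v i, v j⁆ ⁅v i, v j⁆ = θ⁻¹ * C' + ε⁻¹ * s := by
      simp only [hC', hs, Finset.mul_sum, ← Finset.sum_add_distrib]
      rfl
    rw [h1, h2, h3]
    have e1 : θ * θ * (θ⁻¹ * ∑ i, ∑ j, b ⁅u i, u j⁆ ⁅u i, u j⁆)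
        = θ * ∑ i, ∑ j, b ⁅u i, u j⁆ ⁅u i, u j⁆ := by field_simp
    have e2 : θ * ε * (ε⁻¹ * ∑ i, ∑ j, Q ⁅u i, v j⁆ ⁅u i, v j⁆)
        = θ * ∑ i, ∑ j, Q ⁅u i, v j⁆ ⁅u i, v j⁆ := by field_simp
    have e3 : ε * ε * (θ⁻¹ * C' + ε⁻¹ * s) = ε ^ 2 * θ⁻¹ * C' + ε * s := by field_simp
    rw [e1, e2, e3, ← hβ]
    linear_combination hgt - θ * hS

end TestMetrics

/-! ### Compactness of orthonormal frames -/

section Compactness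

variable {L : Type*} [LieRing L] [LieAlgebra ℝ L]
  {T : LinearMap.BilinForm ℝ L} {U : Submodule ℝ L}
  {N : ℕ}

/-- Orthonormal frames and points of the unit cube subconverge. -/
lemma exists_tendsto_frame {b : Fin N → L} (hb : IsFrame T U b) (hs : ∀ x y, T x y = T y x)
    (f : ℕ → Fin N → L) (hf : ∀ n, IsFrame T U (f n)) (lam : ℕ → Fin N → ℝ)
    (hl : ∀ n i, 0 ≤ lam n i ∧ lam n i ≤ 1) :
    ∃ (φ : ℕ → ℕ) (f' : Fin N → L) (lam' : Fin N → ℝ), StrictMono φ ∧ IsFrame T U f' ∧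
      (∀ i, Tendsto (fun n => lam (φ n) i) atTop (𝓝 (lam' i))) ∧
      (∀ (ψ : LinearMap.BilinForm ℝ L) i j,
        Tendsto (fun n => ψ (f (φ n) i) (f (φ n) j)) atTop (𝓝 (ψ (f' i) (f' j)))) ∧
      (∀ i j k, Tendsto (fun n => T ⁅f (φ n) i, f (φ n) j⁆ (f (φ n) k)) atTop
        (𝓝 (T ⁅f' i, f' j⁆ (f' k)))) := by
  -- the coordinates of the frames in the fixed frame `b` are bounded by `1`
  set O : ℕ → Fin N → Fin N → ℝ := fun n j k => T (f n j) (b k) with hO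
  have hfO : ∀ n j, f n j = ∑ k, O n j k • b k := fun n j => hb.expand _ ((hf n).mem j)
  have hO1 : ∀ n j k, O n j k ^ 2 ≤ 1 := by
    intro n j k
    have h1 := hb.apply_eq_sum (μ := fun _ => 1) hb.orth ((hf n).mem j)
    rw [(hf n).orth, if_pos rfl] at h1
    simp only [one_mul] at h1
    rw [h1]
    exact Finset.single_le_sum (f := fun k => T (f n j) (b k) ^ 2) (fun i _ => sq_nonneg _)
      (Finset.mem_univ k)
  obtain ⟨⟨O', lam'⟩, _, φ, hφ, hlim⟩ := (isCompact_Icc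
    (a := ((fun _ _ => -1, fun _ => 0) : (Fin N → Fin N → ℝ) × (Fin N → ℝ)))
    (b := (fun _ _ => 1, fun _ => 1))).tendsto_subseq (x := fun n => (O n, lam n)) (fun n =>
      ⟨⟨fun j k => (abs_le.1 ((sq_le_one_iff_abs_le_one _).1 (hO1 n j k))).1,
        fun i => (hl n i).1⟩,
       ⟨fun j k => (abs_le.1 ((sq_le_one_iff_abs_le_one _).1 (hO1 n j k))).2,
        fun i => (hl n i).2⟩⟩)
  rw [Prod.tendsto_iff] at hlim
  have hO' : ∀ i j, Tendsto (fun n => O (φ n) i j) atTop (𝓝 (O' i j)) := fun i j =>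
    (tendsto_pi_nhds.1 (tendsto_pi_nhds.1 hlim.1 i) j)
  have hlam' : ∀ i, Tendsto (fun n => lam (φ n) i) atTop (𝓝 (lam' i)) := fun i =>
    tendsto_pi_nhds.1 hlim.2 i
  set f' : Fin N → L := fun j => ∑ k, O' j k • b k with hf'
  have hψ : ∀ (ψ : LinearMap.BilinForm ℝ L) i j,
        Tendsto (fun n => ψ (f (φ n) i) (f (φ n) j)) atTop (𝓝 (ψ (f' i) (f' j))) := by
    intro ψ i j
    simp only [hfO, hf', map_sum, map_smul, LinearMap.sum_apply, LinearMap.smul_apply, smul_eq_mul]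
    exact tendsto_finset_sum _ fun k _ => (hO' _ _).mul (tendsto_finset_sum _ fun l _ =>
      (hO' _ _).mul tendsto_const_nhds)
  have hx : ∀ x i, Tendsto (fun n => T x (f (φ n) i)) atTop (𝓝 (T x (f' i))) := by
    intro x i
    simp only [hfO, hf', map_sum, map_smul, smul_eq_mul]
    exact tendsto_finset_sum _ fun k _ => (hO' _ _).mul tendsto_const_nhds
  refine ⟨φ, f', lam', hφ, ⟨fun j => U.sum_mem fun k _ => U.smul_mem _ (hb.mem k), fun i j => ?_,
    fun x hxU => ?_⟩, hlam', hψ, fun i j k => ?_⟩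
  · refine tendsto_nhds_unique (hψ T i j) ?_
    simp only [(hf _).orth]
    exact tendsto_const_nhds
  · have h1 : ∀ l, T x (b l) = ∑ j, T x (f' j) * O' j l := by
      intro l
      refine tendsto_nhds_unique (l := atTop) (f := fun _ : ℕ => T x (b l)) tendsto_const_nhds ?_
      have h2 : ∀ n, T x (b l) = ∑ j, T x (f (φ n) j) * O (φ n) j l := fun n =>
        (hf (φ n)).parseval x (b l) hxU
      rw [show (fun _ : ℕ => T x (b l)) = fun n => ∑ j, T x (f (φ n) j) * O (φ n) j l from
        funext h2]
      exact tendsto_finset_sum _ fun j _ => (hx x j).mul (hO' j l)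
    conv_lhs => rw [hb.expand x hxU]
    simp only [h1, hf', Finset.sum_smul, Finset.smul_sum, smul_smul]
    rw [Finset.sum_comm]
  · simp only [hfO, hf', sum_lie, lie_sum, smul_lie, lie_smul, map_sum, map_smul,
      LinearMap.sum_apply, LinearMap.smul_apply, smul_eq_mul]
    exact tendsto_finset_sum _ fun l _ => (hO' _ _).mul (tendsto_finset_sum _ fun l _ =>
      (hO' _ _).mul (tendsto_finset_sum _ fun l _ => (hO' _ _).mul tendsto_const_nhds))

end Compactness

/-! ### Existence of a maximum of the scalar curvature -/

section Existence

variable {L : Type*} [LieRing L] [LieAlgebra ℝ L] [Module.Finite ℝ L]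
  {Q T : LinearMap.BilinForm ℝ L} {h₀ : Submodule ℝ L} {Γ : Type*} {A : Γ → L → L}

/-- Invariant forms in coordinates: a `T`-frame diagonalising `g`, with the inverses `lam` of the
eigenvalues, which lie in the standard simplex if `tr_g T = 1`. -/
lemma IsInvForm.exists_diag {N : ℕ} (hN : N = Module.finrank ℝ (ominus Q ⊤ h₀))
    (hQ : IsReductivePair Q h₀) (hT : IsInvForm h₀ T) {g : LinearMap.BilinForm ℝ L}
    (hg : IsInvForm h₀ g) {ι : Type*} [Fintype ι] [DecidableEq ι] {e : ι → L}
    (he : IsFrame g (ominus Q ⊤ h₀) e)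
    (htr : ∑ i, T (e i) (e i) = 1) :
    ∃ (f : Fin N → L) (lam : Fin N → ℝ), IsFrame T (ominus Q ⊤ h₀) f ∧ (∀ i, 0 < lam i) ∧
      (∀ i j, g (f i) (f j) = if i = j then (lam i)⁻¹ else 0) ∧ ∑ i, lam i = 1 ∧
      scal g e = -(1 / 2) * ∑ i, lam i * killingForm ℝ L (f i) (f i)
      - (1 / 4) * ∑ i, ∑ j, ∑ k, lam i * lam j * (lam k)⁻¹ * T ⁅f i, f j⁆ (f k) ^ 2 := by
  subst hN
  obtain ⟨f, μ, hf, hfμ⟩ := exists_frame_diag T g (ominus Q ⊤ h₀) hT.symm (hT.pos_compl hQ) hg.symm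
  have hμ : ∀ i, 0 < μ i := by
    intro i
    have h1 := hfμ i i
    rw [if_pos rfl] at h1
    rw [← h1]
    refine hg.pos_compl hQ _ (hf.mem i) fun h2 => ?_
    have h3 := hf.orth i i
    rw [h2] at h3
    simp at h3
  have hfr := hf.rescale hμ hfμ
  refine ⟨f, fun i => (μ i)⁻¹, hf, fun i => inv_pos.2 (hμ i), fun i j => by rw [hfμ, inv_inv], ?_,
    ?_⟩
  · rw [← htr, he.sum_eq hfr hg.symm T, sum_rescale T f hμ]
    simp [hf.orth]
  · rw [he.scal_eq hfr hg.symm, IsInvForm.scal_rescale hQ hT hg hf hμ hfμ]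
    simp only [inv_inv]

/-- The scalar curvature functional attains its supremum on invariant forms with `tr_g T = 1`,
provided that it takes values above all `σ(s, T)`. A maximizing sequence is diagonalized with
respect to `T`. If the inverses of some eigenvalues tend to zero, then the remaining directions and
`h₀` span a proper subalgebra, and the limit of the scalar curvatures is at most `σ(s, T)` for
any maximal subalgebra `s` which contains it. -/
theorem exists_scal_max (hA : IsAdapted A h₀) (hQ : IsReductivePair Q h₀) (hT : IsInvForm h₀ T)
    (hflag : MaximalInequivalence A Q h₀) {σ : ℝ}
    (hσ : ∀ s : LieSubalgebra ℝ L, IsCoatom s → h₀ ≤ s.toSubmodule → sigma A Q T h₀ s ≤ σ)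
    {ι : Type*} [Fintype ι] [DecidableEq ι] {g₁ : LinearMap.BilinForm ℝ L} (hg₁ : IsInvForm h₀ g₁)
    {e₁ : ι → L} (he₁ : IsFrame g₁ (ominus Q ⊤ h₀) e₁) (htr₁ : ∑ i, T (e₁ i) (e₁ i) = 1)
    (hgt : σ < scal g₁ e₁) :
    ∃ g, IsInvForm h₀ g ∧ ∃ e : Fin (Module.finrank ℝ (ominus Q ⊤ h₀)) → L,
      IsFrame g (ominus Q ⊤ h₀) e ∧ ∑ i, T (e i) (e i) = 1 ∧ σ < scal g e ∧
      ∀ g', IsInvForm h₀ g' → ∀ e' : Fin (Module.finrank ℝ (ominus Q ⊤ h₀)) → L,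
        IsFrame g' (ominus Q ⊤ h₀) e' → ∑ i, T (e' i) (e' i) = 1 → scal g' e' ≤ scal g e := by
  set N := Module.finrank ℝ (ominus Q ⊤ h₀) with hN
  obtain ⟨C, hC0, hC⟩ := hT.exists_killing_le hQ
  set S : Set ℝ := {r | ∃ g, IsInvForm h₀ g ∧ ∃ e : Fin N → L,
    IsFrame g (ominus Q ⊤ h₀) e ∧ ∑ i, T (e i) (e i) = 1 ∧ scal g e = r} with hS
  have hSb : BddAbove S := by
    refine ⟨C / 2, ?_⟩
    rintro r ⟨g, hg, e, he, htr, rfl⟩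
    have h1 : ∑ i, -killingForm ℝ L (e i) (e i) ≤ ∑ i, C * T (e i) (e i) :=
      Finset.sum_le_sum fun i _ => hC _ (he.mem i)
    rw [← Finset.mul_sum, htr, Finset.sum_neg_distrib] at h1
    have h2 : 0 ≤ ∑ i, ∑ j, g ⁅e i, e j⁆ ⁅e i, e j⁆ :=
      Finset.sum_nonneg fun i _ => Finset.sum_nonneg fun j _ => hg.nonneg _
    unfold scal
    linarith
  obtain ⟨e₁', he₁'⟩ := exists_frame g₁ (ominus Q ⊤ h₀) hg₁.symm (hg₁.pos_compl hQ)
  have hS₁ : scal g₁ e₁ ∈ S := ⟨g₁, hg₁, e₁', he₁', by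
    rw [← htr₁]; exact (he₁'.sum_eq he₁ hg₁.symm T), he₁'.scal_eq he₁ hg₁.symm⟩
  have hSne : S.Nonempty := ⟨_, hS₁⟩
  have hσS : σ < sSup S := hgt.trans_le (le_csSup hSb hS₁)
  -- it suffices that the supremum is attained
  suffices hmem : sSup S ∈ S by
    obtain ⟨g, hg, e, he, htr, hsc⟩ := hmem
    exact ⟨g, hg, e, he, htr, hsc ▸ hσS, fun g' hg' e' he' htr' =>
      hsc ▸ le_csSup hSb ⟨g', hg', e', he', htr', rfl⟩⟩
  obtain ⟨r, _, hr, hrS⟩ := exists_seq_tendsto_sSup hSne hSb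
  choose g hg e he htr hsc using hrS
  choose f lam hf hlam hgf hsum hscf using fun n => IsInvForm.exists_diag hN hQ hT (hg n) (he n) (htr n)
  obtain ⟨b, hb⟩ : ∃ b : Fin N → L, IsFrame T (ominus Q ⊤ h₀) b :=
    exists_frame T (ominus Q ⊤ h₀) hT.symm (hT.pos_compl hQ)
  obtain ⟨φ, f', lam', hφ, hf', hlam', hψ, hbr⟩ := exists_tendsto_frame hb hT.symm f hf lam
    (fun n i => ⟨(hlam n i).le, by
      rw [← hsum n]
      exact Finset.single_le_sum (f := lam n) (fun i _ => (hlam n i).le) (Finset.mem_univ i)⟩)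
  have hlam0 : ∀ i, 0 ≤ lam' i := fun i => ge_of_tendsto' (hlam' i) fun n => (hlam _ i).le
  have hlam1 : ∑ i, lam' i = 1 := by
    refine tendsto_nhds_unique (tendsto_finset_sum _ fun i _ => hlam' i) ?_
    simp only [hsum]
    exact tendsto_const_nhds
  have hrφ : Tendsto (fun n => r (φ n)) atTop (𝓝 (sSup S)) := hr.comp hφ.tendsto_atTop
  -- eigenspaces are invariant
  have hinv : ∀ w ∈ h₀, ∀ i j, (lam' i - lam' j) * T ⁅w, f' i⁆ (f' j) = 0 := by
    intro w hw i j
    have h1 : ∀ n, (lam n i - lam n j) * T ⁅w, f n i⁆ (f n j) = 0 := by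
      intro n
      have h2 : ∀ i j, g n ⁅w, f n i⁆ (f n j) = T ⁅w, f n i⁆ (f n j) * (lam n j)⁻¹ := by
        intro i j
        rw [(hf n).expand _ (hQ.lie_mem_compl hw ((hf n).mem i))]
        simp [LinearMap.sum_apply, hgf, (hf n).orth]
      have h3 := (hg n).skew_frame hw (f n i) (f n j)
      rw [h2, h2, hT.skew_frame hw (f n j)] at h3
      have h4 := (hlam n i).ne'
      have h5 := (hlam n j).ne'
      field_simp at h3
      linear_combination h3
    have h2 := ((hlam' i).sub (hlam' j)).mul
      (hψ (T.comp (LieAlgebra.ad ℝ L w) LinearMap.id) i j)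
    refine tendsto_nhds_unique h2 ?_
    have h3 : (fun n => (lam (φ n) i - lam (φ n) j) *
        (T.comp (LieAlgebra.ad ℝ L w) LinearMap.id) (f (φ n) i) (f (φ n) j)) = fun _ => 0 :=
      funext fun n => h1 (φ n)
    rw [h3]
    exact tendsto_const_nhds
  by_cases hpos : ∀ i, 0 < lam' i
  · -- the limit is a metric
    have hinv' : ∀ w ∈ h₀, ∀ i j, ((lam' i)⁻¹ - (lam' j)⁻¹) * T ⁅w, f' i⁆ (f' j) = 0 := by
      intro w hw i j
      rcases mul_eq_zero.1 (hinv w hw i j) with h | h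
      · rw [sub_eq_zero.1 h, sub_self, zero_mul]
      · rw [h, mul_zero]
    have hμ : ∀ i, 0 < (lam' i)⁻¹ := fun i => inv_pos.2 (hpos i)
    have hG := hT.isInvForm_diagForm hQ hf' hμ hinv'
    have hd := diagForm_frame f' (fun i => (lam' i)⁻¹) hf'
    refine ⟨_, hG, _, hf'.rescale hμ hd, ?_, ?_⟩
    · rw [sum_rescale T f' hμ]
      simp [hf'.orth, hlam1]
    · rw [IsInvForm.scal_rescale hQ hT hG hf' hμ hd]
      refine tendsto_nhds_unique ?_ hrφ
      simp only [← hsc, hscf, inv_inv]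
      refine ((tendsto_finset_sum _ fun i _ => (hlam' i).mul (hψ _ i i)).const_mul _).sub
        ((tendsto_finset_sum _ fun i _ => tendsto_finset_sum _ fun j _ => tendsto_finset_sum _
          fun k _ => (((hlam' i).mul (hlam' j)).mul ((hlam' k).inv₀ (hpos k).ne')).mul
            ((hbr i j k).pow 2)).const_mul _)
  · -- the limit is degenerate
    exfalso
    push Not at hpos
    obtain ⟨l₀, hl₀⟩ := hpos
    have hl₀ : lam' l₀ = 0 := le_antisymm hl₀ (hlam0 l₀)
    -- the scalar curvature is bounded below along the sequence, which bounds each of the terms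
    -- `lam i * lam j * (lam k)⁻¹ * T ⁅f i, f j⁆ (f k) ^ 2`
    obtain ⟨D, hD⟩ : ∃ D : ℝ, ∀ᶠ n in atTop, ∀ i j k,
        lam (φ n) i * lam (φ n) j * T ⁅f (φ n) i, f (φ n) j⁆ (f (φ n) k) ^ 2
          ≤ D * lam (φ n) k := by
      refine ⟨4 * (C / 2 - (sSup S - 1)), ?_⟩
      filter_upwards [hrφ.eventually (lt_mem_nhds (sub_one_lt (sSup S)))] with n hn i j k
      have h1 := hscf (φ n)
      rw [hsc] at h1
      have h2 : ∑ i, -(lam (φ n) i * killingForm ℝ L (f (φ n) i) (f (φ n) i)) ≤ C := by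
        calc _ ≤ ∑ i, lam (φ n) i * C := Finset.sum_le_sum fun i _ => by
              have h3 := hC _ ((hf (φ n)).mem i)
              rw [(hf (φ n)).orth, if_pos rfl, mul_one] at h3
              have := mul_le_mul_of_nonneg_left h3 (hlam (φ n) i).le
              linarith
          _ = C := by rw [← Finset.sum_mul, hsum, one_mul]
      rw [Finset.sum_neg_distrib] at h2
      set F : Fin N → Fin N → Fin N → ℝ := fun i j k => lam (φ n) i * lam (φ n) j *
        (lam (φ n) k)⁻¹ * T ⁅f (φ n) i, f (φ n) j⁆ (f (φ n) k) ^ 2 with hF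
      have hF0 : ∀ i j k, 0 ≤ F i j k := fun i j k => by
        have h3 := hlam (φ n) i
        have h4 := hlam (φ n) j
        have h5 := hlam (φ n) k
        positivity
      have h3 : F i j k ≤ ∑ i, ∑ j, ∑ k, F i j k :=
        (Finset.single_le_sum (f := fun k => F i j k) (fun k _ => hF0 i j k)
          (Finset.mem_univ k)).trans <|
        (Finset.single_le_sum (f := fun j => ∑ k, F i j k)
          (fun j _ => Finset.sum_nonneg fun k _ => hF0 i j k) (Finset.mem_univ j)).trans <|
        Finset.single_le_sum (f := fun i => ∑ j, ∑ k, F i j k)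
          (fun i _ => Finset.sum_nonneg fun j _ => Finset.sum_nonneg fun k _ => hF0 i j k)
          (Finset.mem_univ i)
      have h4 : F i j k ≤ 4 * (C / 2 - (sSup S - 1)) := by linarith
      have h5 := mul_le_mul_of_nonneg_right h4 (hlam (φ n) k).le
      have h6 : F i j k * lam (φ n) k
          = lam (φ n) i * lam (φ n) j * T ⁅f (φ n) i, f (φ n) j⁆ (f (φ n) k) ^ 2 := by
        have := (hlam (φ n) k).ne'
        simp only [hF]
        field_simp
      rwa [h6] at h5
    have hc : ∀ i j k, 0 < lam' i → 0 < lam' j → lam' k = 0 → T ⁅f' i, f' j⁆ (f' k) = 0 := by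
      intro i j k hi hj hk
      have h1 : lam' i * lam' j * T ⁅f' i, f' j⁆ (f' k) ^ 2 ≤ D * lam' k :=
        le_of_tendsto_of_tendsto (((hlam' i).mul (hlam' j)).mul ((hbr i j k).pow 2))
          ((hlam' k).const_mul D) (hD.mono fun n hn => hn i j k)
      rw [hk, mul_zero] at h1
      have h2 : T ⁅f' i, f' j⁆ (f' k) ^ 2 ≤ 0 := by
        by_contra h
        push Not at h
        exact absurd h1 (not_le.2 (by positivity))
      exact pow_eq_zero_iff two_ne_zero |>.1 (le_antisymm h2 (sq_nonneg _))
    -- the subalgebra of directions that do not collapse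
    obtain ⟨P₀, hP₀⟩ := exists_isOrthProj hQ h₀
    have hdec : ∀ x, x = P₀ x + ∑ i, T x (f' i) • f' i := by
      intro x
      have h1 := hf'.expand _ (hP₀.mem_compl hQ x)
      simp only [map_sub, LinearMap.sub_apply, hT.ker _ (hP₀.mem x), sub_zero] at h1
      rw [← h1]; abel
    have hwf : ∀ w ∈ h₀, ∀ x, (∀ l, lam' l = 0 → T x (f' l) = 0) → ∀ l, lam' l = 0 →
        T ⁅w, x⁆ (f' l) = 0 := by
      intro w hw x hx l hl
      rw [hdec x]
      simp only [lie_add, map_add, LinearMap.add_apply, lie_sum, lie_smul, map_sum, map_smul,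
        LinearMap.sum_apply, LinearMap.smul_apply, smul_eq_mul]
      rw [hT.ker _ (hQ.lie_mem _ hw _ (hP₀.mem x)), zero_add]
      refine Finset.sum_eq_zero fun i _ => ?_
      by_cases hi : lam' i = 0
      · rw [hx i hi, zero_mul]
      · have := hinv w hw i l
        rw [hl, sub_zero] at this
        rw [(mul_eq_zero.1 this).resolve_left hi, mul_zero]
    let U : LieSubalgebra ℝ L :=
      { carrier := {x | ∀ l, lam' l = 0 → T x (f' l) = 0}
        add_mem' := fun {x y} hx hy l hl => by
          rw [map_add, LinearMap.add_apply, hx l hl, hy l hl, add_zero]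
        zero_mem' := fun l _ => by rw [map_zero, LinearMap.zero_apply]
        smul_mem' := fun a x hx l hl => by
          rw [map_smul, LinearMap.smul_apply, hx l hl, smul_zero]
        lie_mem' := fun {x y} hx hy l hl => by
          have e1 : ⁅x, y⁆ = ⁅P₀ x, y⁆ - ∑ i, T x (f' i) • ⁅P₀ y, f' i⁆
              + ∑ i, ∑ j, (T x (f' i) * T y (f' j)) • ⁅f' i, f' j⁆ := by
            conv_lhs => rw [hdec x]
            rw [add_lie, sub_add, sub_eq_add_neg]
            congr 1
            conv_lhs => rw [hdec y]
            rw [lie_add, neg_sub, sub_eq_neg_add, ← Finset.sum_neg_distrib, sum_lie, sum_lie]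
            congr 1
            · refine Finset.sum_congr rfl fun i _ => ?_
              rw [smul_lie, ← lie_skew, smul_neg]
            · refine Finset.sum_congr rfl fun i _ => ?_
              rw [smul_lie, lie_sum, Finset.smul_sum]
              refine Finset.sum_congr rfl fun j _ => ?_
              rw [lie_smul, smul_smul]
          rw [e1]
          simp only [map_add, map_sub, LinearMap.add_apply, LinearMap.sub_apply, map_sum, map_smul,
            LinearMap.sum_apply, LinearMap.smul_apply, smul_eq_mul]
          rw [hwf _ (hP₀.mem x) y hy l hl, Finset.sum_eq_zero, Finset.sum_eq_zero]
          · simp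
          · intro i _
            refine Finset.sum_eq_zero fun j _ => ?_
            by_cases hi : lam' i = 0
            · rw [hx i hi]; simp
            by_cases hj : lam' j = 0
            · rw [hy j hj]; simp
            rw [hc i j l (lt_of_le_of_ne (hlam0 i) (Ne.symm hi))
              (lt_of_le_of_ne (hlam0 j) (Ne.symm hj)) hl, mul_zero]
          · intro i _
            by_cases hi : lam' i = 0
            · rw [hx i hi, zero_mul]
            · have := hinv (P₀ y) (hP₀.mem y) i l
              rw [hl, sub_zero] at this
              rw [(mul_eq_zero.1 this).resolve_left hi, mul_zero] }
    have hU : ∀ x, x ∈ U ↔ ∀ l, lam' l = 0 → T x (f' l) = 0 := fun x => Iff.rfl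
    have hUtop : U ≠ ⊤ := by
      intro h
      have h1 : f' l₀ ∈ U := h ▸ LieSubalgebra.mem_top _
      have h2 := (hU _).1 h1 l₀ hl₀
      rw [hf'.orth, if_pos rfl] at h2
      exact one_ne_zero h2
    obtain ⟨s, hs, hUs⟩ := (eq_top_or_exists_le_coatom U).resolve_left hUtop
    have hfU : ∀ i, lam' i ≠ 0 → f' i ∈ U := fun i hi l hl => by
      rw [hf'.orth, if_neg (fun h : i = l => hi (h ▸ hl))]
    have hs₀ : h₀ < s.toSubmodule := by
      refine lt_of_le_of_ne (fun x hx => hUs ((hU x).2 fun l _ => hT.ker x hx _)) fun h => ?_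
      obtain ⟨i, hi⟩ : ∃ i, lam' i ≠ 0 := by
        by_contra hne
        push Not at hne
        rw [Finset.sum_eq_zero fun i _ => hne i] at hlam1
        exact zero_ne_one hlam1
      have h1 : f' i ∈ h₀ := by
        rw [h]; exact hUs (hfU i hi)
      have h2 := hf'.orth i i
      rw [hT.ker _ h1, if_pos rfl] at h2
      exact zero_ne_one h2
    obtain ⟨P, hP⟩ := exists_isOrthProj hQ (ominus Q ⊤ s.toSubmodule)
    have hPs : ∀ x ∈ s, P x = 0 := fun x hx => hP.unique hQ (Submodule.zero_mem _) fun z hz => by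
      rw [sub_zero]; exact (mem_ominus.1 hz).2 x hx
    -- the part `δ` of the trace of `T` which is transverse to `s` tends to zero
    set δ : ℕ → ℝ := fun n => ∑ i, T (P (e (φ n) i)) (P (e (φ n) i)) with hδ
    have hδ' : ∀ n, δ n = ∑ i, lam (φ n) i * (T.comp P P) (f (φ n) i) (f (φ n) i) := by
      intro n
      have hμ : ∀ i, 0 < (lam (φ n) i)⁻¹ := fun i => inv_pos.2 (hlam _ i)
      have h1 := (he (φ n)).sum_eq ((hf (φ n)).rescale hμ (hgf (φ n))) (hg (φ n)).symm (T.comp P P)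
      rw [sum_rescale (T.comp P P) _ hμ] at h1
      simp only [inv_inv] at h1
      exact h1
    have hδ0 : Tendsto δ atTop (𝓝 0) := by
      rw [show δ = _ from funext hδ']
      have h1 : ∑ i, lam' i * (T.comp P P) (f' i) (f' i) = 0 := by
        refine Finset.sum_eq_zero fun i _ => ?_
        by_cases hi : lam' i = 0
        · rw [hi, zero_mul]
        · rw [LinearMap.BilinForm.comp_apply, hPs _ (hUs (hfU i hi))]; simp
      rw [← h1]
      exact tendsto_finset_sum _ fun i _ => (hlam' i).mul (hψ _ i i)
    have hle : ∀ n, r (φ n) ≤ (1 - δ n) * sigma A Q T h₀ s + C / 2 * δ n := by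
      intro n
      rw [← hsc]
      exact IsInvForm.scal_le hA hQ hT hC s hs₀ (hg (φ n))
        (fun x hx y hy => IsAdInvariant.eq_zero_of_maximal hA hQ hflag hs hs₀.le (hg (φ n)).skew
          hx hy) hP
        (fun x hx y hy => IsAdInvariant.eq_zero_of_maximal hA hQ hflag hs hs₀.le hT.skew hx hy)
        (he (φ n)) (htr (φ n))
    have hfin : sSup S ≤ (1 - 0) * sigma A Q T h₀ s + C / 2 * 0 :=
      le_of_tendsto_of_tendsto' hrφ
        (((hδ0.const_sub 1).mul_const _).add (hδ0.const_mul _)) hle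
    have := hσ s hs hs₀.le
    linarith

/-- The maximum of the scalar curvature on invariant forms with `tr_g T = 1` is attained, is
positive, and has Ricci form `scal g • T`. -/
theorem exists_einstein_form (hA : IsAdapted A h₀) (hQ : IsReductivePair Q h₀)
    (hT : IsInvForm h₀ T)
    (hflag : MaximalInequivalence A Q h₀) (k : LieSubalgebra ℝ L) (hk : IsApical A Q T h₀ k)
    (hineq : 4 * sigma A Q T h₀ k
          * trForm (restr Q (ominus Q ⊤ k.toSubmodule)) (restr T (ominus Q ⊤ k.toSubmodule))
        < -2 * trForm (restr Q (ominus Q ⊤ k.toSubmodule))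
              (restr (killingForm ℝ L) (ominus Q ⊤ k.toSubmodule))
          - structConst Q (ominus Q ⊤ k.toSubmodule) (ominus Q ⊤ k.toSubmodule)
            (ominus Q ⊤ k.toSubmodule)) :
    ∃ g, IsInvForm h₀ g ∧ ∃ e : Fin (Module.finrank ℝ (ominus Q ⊤ h₀)) → L,
      IsFrame g (ominus Q ⊤ h₀) e ∧ ∑ i, T (e i) (e i) = 1 ∧ 0 < scal g e ∧
      (∀ g', IsInvForm h₀ g' → ∀ e' : Fin (Module.finrank ℝ (ominus Q ⊤ h₀)) → L,
        IsFrame g' (ominus Q ⊤ h₀) e' → ∑ i, T (e' i) (e' i) = 1 → scal g' e' ≤ scal g e) ∧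
      ∀ X ∈ ominus Q ⊤ h₀, ∀ Y ∈ ominus Q ⊤ h₀, ricForm g e X Y = scal g e * T X Y := by
  obtain ⟨g₁, hg₁, e₁, he₁, htr₁, hgt⟩ := exists_scal_gt hA hQ hT k hk hineq
  obtain ⟨g, hg, e, he, htr, hpos, hmax⟩ := exists_scal_max hA hQ hT hflag hk.sigma_le hg₁ he₁
    htr₁ hgt
  refine ⟨g, hg, e, he, htr, (sigma_nonneg hA hQ hT k hk.lt).trans_lt hpos, hmax,
    fun X hX Y hY => IsInvForm.ricForm_eq_of_isMax hQ hT hg he htr (fun g' hg' e' he' => ?_) hX hY⟩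
  -- `hmax`, without the normalization `tr T = 1`, applied to `τ • g'`
  set τ := ∑ i, T (e' i) (e' i) with hτ
  have hne : (Finset.univ : Finset (Fin (Module.finrank ℝ (ominus Q ⊤ h₀)))).Nonempty := by
    by_contra h
    rw [Finset.not_nonempty_iff_eq_empty] at h
    rw [h, Finset.sum_empty] at htr
    exact zero_ne_one htr
  have hτ0 : 0 < τ := Finset.sum_pos (fun i _ => hT.pos _ fun h3 => by
    have h4 := he'.orth i i
    rw [hg'.ker _ h3] at h4
    simp at h4) hne
  have hsq : (Real.sqrt τ)⁻¹ * (Real.sqrt τ)⁻¹ = τ⁻¹ := by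
    rw [← mul_inv, Real.mul_self_sqrt hτ0.le]
  have hb : ∀ (b : LinearMap.BilinForm ℝ L) (x : L),
      b ((Real.sqrt τ)⁻¹ • x) ((Real.sqrt τ)⁻¹ • x) = τ⁻¹ * b x x := fun b x => by
    rw [map_smul, map_smul, LinearMap.smul_apply, smul_eq_mul, smul_eq_mul, ← mul_assoc, hsq]
  have h1 := hmax (τ • g') ⟨fun x y => by
      rw [LinearMap.smul_apply, LinearMap.smul_apply, LinearMap.smul_apply, LinearMap.smul_apply,
        hg'.symm],
    fun x hx => by
      rw [LinearMap.smul_apply, LinearMap.smul_apply]; exact mul_pos hτ0 (hg'.pos x hx),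
    fun x hx y => by
      rw [LinearMap.smul_apply, LinearMap.smul_apply, hg'.ker x hx, smul_zero],
    fun w hw x y => by
      simp only [LinearMap.smul_apply, ← smul_add, hg'.skew w hw x y, smul_zero]⟩ _ (he'.smul hτ0)
    (by simp only [hb, ← Finset.mul_sum, ← hτ]; exact inv_mul_cancel₀ hτ0.ne')
  have h2 : scal (τ • g') (fun i => (Real.sqrt τ)⁻¹ • e' i) = τ⁻¹ * scal g' e' := by
    have h3 : ∀ x y : L, (τ • g') ⁅(Real.sqrt τ)⁻¹ • x, (Real.sqrt τ)⁻¹ • y⁆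
        ⁅(Real.sqrt τ)⁻¹ • x, (Real.sqrt τ)⁻¹ • y⁆ = τ⁻¹ * g' ⁅x, y⁆ ⁅x, y⁆ := fun x y => by
      rw [smul_lie, lie_smul, LinearMap.smul_apply, LinearMap.smul_apply, hb, hb, smul_eq_mul,
        ← mul_assoc, mul_inv_cancel₀ hτ0.ne', one_mul]
    unfold scal
    simp only [hb, h3, ← Finset.mul_sum]
    ring
  rw [h2, inv_mul_le_iff₀ hτ0] at h1
  linarith

end Existence

/-! ### Local multiplications and local actions -/

section LocalActions

variable {E F : Type*} [NormedAddCommGroup E] [NormedSpace ℝ E]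
  [NormedAddCommGroup F] [NormedSpace ℝ F]

lemma contDiffAt_fderiv {f : E → F} {y : E} (h : ContDiffAt ℝ ∞ f y) :
    ContDiffAt ℝ ∞ (fderiv ℝ f) y :=
  h.fderiv_right (m := ∞) (by simp)

lemma differentiableAt_fderiv {f : E → F} {y : E} (h : ContDiffAt ℝ ∞ f y) :
    DifferentiableAt ℝ (fderiv ℝ f) y :=
  (contDiffAt_fderiv h).differentiableAt (by simp)

/-- The bracket determined by the second order part of a local multiplication `m` with unit `p`. -/
def germBracket (m : E × E → E) (p X Y : E) : E :=
  fderiv ℝ (fderiv ℝ m) (p, p) (X, 0) (0, Y) - fderiv ℝ (fderiv ℝ m) (p, p) (Y, 0) (0, X)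

/-- The vector field on `F` induced by `X` under the local action `φ` with unit `p`. -/
def actionField (φ : E × F → F) (p : E) (y : F) : E →L[ℝ] F :=
  (fderiv ℝ φ (p, y)).comp (ContinuousLinearMap.inl ℝ E F)

lemma actionField_apply (φ : E × F → F) (p : E) (y : F) (X : E) :
    actionField φ p y X = fderiv ℝ φ (p, y) (X, 0) := rfl

/-- A local multiplication near `p`, with unit `p`. Associativity is not required: the arguments
only need it for the actions, where it is `IsActionGerm.act`. -/
structure IsMulGerm (m : E × E → E) (p : E) : Prop where
  smooth : ∀ᶠ z in 𝓝 (p, p), ContDiffAt ℝ ∞ m z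
  left : ∀ᶠ q in 𝓝 p, m (p, q) = q
  right : ∀ᶠ q in 𝓝 p, m (q, p) = q

/-- A local action of the local multiplication `m`. -/
structure IsActionGerm (m : E × E → E) (p : E) (φ : E × F → F) (y₀ : F) : Prop where
  smooth : ∀ᶠ z in 𝓝 (p, y₀), ContDiffAt ℝ ∞ φ z
  unit : ∀ᶠ y in 𝓝 y₀, φ (p, y) = y
  act : ∀ᶠ z : E × E × F in 𝓝 (p, p, y₀), φ (m (z.1, z.2.1), z.2.2) = φ (z.1, φ (z.2.1, z.2.2))

variable {m : E × E → E} {p : E} {φ : E × F → F} {y₀ : F}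

lemma eventually_prod_right {α β : Type*} [TopologicalSpace α] [TopologicalSpace β] {a : α} {b : β}
    {P : α × β → Prop} (h : ∀ᶠ z in 𝓝 (a, b), P z) : ∀ᶠ y in 𝓝 b, P (a, y) :=
  (Continuous.prodMk_right a).continuousAt.eventually h

lemma eventually_prod_left {α β : Type*} [TopologicalSpace α] [TopologicalSpace β] {a : α} {b : β}
    {P : α × β → Prop} (h : ∀ᶠ z in 𝓝 (a, b), P z) : ∀ᶠ x in 𝓝 a, P (x, b) :=
  (Continuous.prodMk_left b).continuousAt.eventually h

/-- The derivative of a function of the first variable. -/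
lemma hasFDerivAt_comp_left {V : Type*} [NormedAddCommGroup V] [NormedSpace ℝ V] {f : E × F → V}
    {x : E} {y : F} (h : DifferentiableAt ℝ f (x, y)) :
    HasFDerivAt (fun x => f (x, y)) ((fderiv ℝ f (x, y)).comp (ContinuousLinearMap.inl ℝ E F)) x :=
  HasFDerivAt.comp (f := fun x => (x, y)) x h.hasFDerivAt
    ((hasFDerivAt_id x).prodMk (hasFDerivAt_const y x))

/-- The derivative of a function of the second variable. -/
lemma hasFDerivAt_comp_right {V : Type*} [NormedAddCommGroup V] [NormedSpace ℝ V] {f : E × F → V}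
    {x : E} {y : F} (h : DifferentiableAt ℝ f (x, y)) :
    HasFDerivAt (fun y => f (x, y)) ((fderiv ℝ f (x, y)).comp (ContinuousLinearMap.inr ℝ E F)) y :=
  HasFDerivAt.comp (f := fun y => (x, y)) y h.hasFDerivAt
    ((hasFDerivAt_const x y).prodMk (hasFDerivAt_id y))

lemma IsMulGerm.fderiv_right (hm : IsMulGerm m p) :
    ∀ᶠ q in 𝓝 p, ∀ X, fderiv ℝ m (p, q) (0, X) = X := by
  filter_upwards [eventually_prod_right hm.smooth, hm.left.eventually_nhds] with q h1 h2 X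
  have h3 := hasFDerivAt_comp_right (h1.differentiableAt (by simp))
  have h4 : HasFDerivAt (fun q => m (p, q)) (ContinuousLinearMap.id ℝ E) q :=
    (hasFDerivAt_id q).congr_of_eventuallyEq h2
  exact DFunLike.congr_fun (h3.unique h4) X

lemma IsMulGerm.fderiv_left (hm : IsMulGerm m p) :
    ∀ᶠ q in 𝓝 p, ∀ X, fderiv ℝ m (q, p) (X, 0) = X := by
  filter_upwards [eventually_prod_left hm.smooth, hm.right.eventually_nhds] with q h1 h2 X
  have h3 := hasFDerivAt_comp_left (h1.differentiableAt (by simp))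
  have h4 : HasFDerivAt (fun q => m (q, p)) (ContinuousLinearMap.id ℝ E) q :=
    (hasFDerivAt_id q).congr_of_eventuallyEq h2
  exact DFunLike.congr_fun (h3.unique h4) X

lemma IsActionGerm.apply_unit (hφ : IsActionGerm m p φ y₀) : φ (p, y₀) = y₀ :=
  hφ.unit.self_of_nhds

lemma IsActionGerm.fderiv_right (hφ : IsActionGerm m p φ y₀) :
    ∀ᶠ y in 𝓝 y₀, ∀ v, fderiv ℝ φ (p, y) (0, v) = v := by
  filter_upwards [eventually_prod_right hφ.smooth, hφ.unit.eventually_nhds] with y h1 h2 v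
  have h3 := hasFDerivAt_comp_right (h1.differentiableAt (by simp))
  have h4 : HasFDerivAt (fun y => φ (p, y)) (ContinuousLinearMap.id ℝ F) y :=
    (hasFDerivAt_id y).congr_of_eventuallyEq h2
  exact DFunLike.congr_fun (h3.unique h4) v

lemma IsActionGerm.contDiffAt_actionField (hφ : IsActionGerm m p φ y₀) :
    ∀ᶠ y in 𝓝 y₀, ContDiffAt ℝ ∞ (actionField φ p) y := by
  filter_upwards [eventually_prod_right hφ.smooth] with y hy
  have h1 : ContDiffAt ℝ ∞ (fun y => fderiv ℝ φ (p, y)) y :=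
    (contDiffAt_fderiv hy).comp y (contDiffAt_const.prodMk contDiffAt_id)
  exact h1.clm_comp contDiffAt_const

/-- The derivative of an induced field is a mixed second derivative of the action. -/
lemma IsActionGerm.fderiv_actionField (hφ : IsActionGerm m p φ y₀) :
    ∀ᶠ y in 𝓝 y₀, ∀ X v, fderiv ℝ (fun z => actionField φ p z X) y v
      = fderiv ℝ (fderiv ℝ φ) (p, y) (0, v) (X, 0) := by
  filter_upwards [eventually_prod_right hφ.smooth] with y hy X v
  have h1 := (hasFDerivAt_comp_right (differentiableAt_fderiv hy)).clm_apply
    (hasFDerivAt_const (X, (0 : F)) y)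
  rw [show (fun z => actionField φ p z X) = fun z => fderiv ℝ φ (p, z) (X, 0) from rfl, h1.fderiv]
  simp

/-- The fields induced by a local (left) action form an anti-homomorphism for the Lie bracket of
vector fields. -/
theorem IsActionGerm.bracket (hm : IsMulGerm m p) (hφ : IsActionGerm m p φ y₀) :
    ∀ᶠ z in 𝓝 y₀, ∀ X Y : E, fderiv ℝ (fun x => actionField φ p x X) z (actionField φ p z Y)
      - fderiv ℝ (fun x => actionField φ p x Y) z (actionField φ p z X)
      = actionField φ p z (germBracket m p X Y) := by
  have hcφ : ContinuousAt φ (p, y₀) := hφ.smooth.self_of_nhds.continuousAt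
  have hφ1 : ∀ᶠ z in 𝓝 (p, y₀), ContDiffAt ℝ ∞ φ (p, φ z) := by
    have h1 : Tendsto (fun z : E × F => (p, φ z)) (𝓝 (p, y₀)) (𝓝 (p, y₀)) := by
      have h2 := hcφ.tendsto
      rw [hφ.apply_unit] at h2
      exact tendsto_const_nhds.prodMk_nhds h2
    exact h1.eventually hφ.smooth
  -- differentiating the action law in the first variable
  have key : ∀ᶠ z in 𝓝 (p, y₀), ∀ X, fderiv ℝ φ z (fderiv ℝ m (p, z.1) (X, 0), 0)
      = fderiv ℝ φ (p, φ z) (X, 0) := by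
    have h1 := eventually_prod_right hφ.act.eventually_nhds
    have h2 : ∀ᶠ z : E × F in 𝓝 (p, y₀), ContDiffAt ℝ ∞ m (p, z.1) ∧ m (p, z.1) = z.1 :=
      (continuous_fst.tendsto (p, y₀)).eventually
        ((eventually_prod_right hm.smooth).and hm.left)
    filter_upwards [h1, h2, hφ.smooth, hφ1] with z h1 h2 h3 h4 X
    have e1 : HasFDerivAt (fun x => φ (m (x, z.1), z.2))
        ((fderiv ℝ φ z).comp (((fderiv ℝ m (p, z.1)).comp (ContinuousLinearMap.inl ℝ E E)).prod 0))
        p := by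
      have e2 := (hasFDerivAt_comp_left (h2.1.differentiableAt (by simp))).prodMk
        (hasFDerivAt_const z.2 p)
      have e3 : HasFDerivAt φ (fderiv ℝ φ z) (m (p, z.1), z.2) := by
        rw [h2.2]; exact (h3.differentiableAt (by simp)).hasFDerivAt
      exact HasFDerivAt.comp p e3 e2
    have e4 := hasFDerivAt_comp_left (h4.differentiableAt (by simp))
    have h5 : ∀ᶠ x in 𝓝 p, φ (m (x, z.1), z.2) = φ (x, φ z) :=
      (Continuous.prodMk_left z).continuousAt.eventually h1
    have e5 := (e4.congr_of_eventuallyEq h5).unique e1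
    exact (DFunLike.congr_fun e5 X).symm
  filter_upwards [eventually_prod_right key.eventually_nhds, hφ.unit, hφ.fderiv_actionField,
    eventually_prod_right hφ.smooth, hφ.contDiffAt_actionField] with z h1 h2 h3 h4 h5
  have cm := hm.smooth.self_of_nhds
  -- differentiating once more
  have main : ∀ X Y : E, fderiv ℝ (fun x => actionField φ p x X) z (actionField φ p z Y)
      = fderiv ℝ (fderiv ℝ φ) (p, z) (Y, 0) (X, 0)
        + fderiv ℝ φ (p, z) (fderiv ℝ (fderiv ℝ m) (p, p) (X, 0) (0, Y), 0) := by
    intro X Y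
    have e1 := hasFDerivAt_comp_left (h4.differentiableAt (by simp))
    have h5' : DifferentiableAt ℝ (fun x => actionField φ p x X) (φ (p, z)) := by
      rw [h2]
      exact (h5.differentiableAt (by simp)).clm_apply (differentiableAt_const _)
    have e2 := HasFDerivAt.comp p h5'.hasFDerivAt e1
    have e3 := (hasFDerivAt_comp_right (differentiableAt_fderiv cm)).clm_apply
      (hasFDerivAt_const (X, (0 : E)) p)
    have e4 := (hasFDerivAt_comp_left (differentiableAt_fderiv h4)).clm_apply
      (e3.prodMk (hasFDerivAt_const (0 : F) p))
    have h6 : ∀ᶠ q in 𝓝 p, fderiv ℝ φ (q, z) (fderiv ℝ m (p, q) (X, 0), 0)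
        = actionField φ p (φ (q, z)) X :=
      ((Continuous.prodMk_left z).continuousAt.eventually h1).mono fun q hq => hq X
    have e5 := DFunLike.congr_fun
      ((e2.congr_of_eventuallyEq (f₁ := fun q => fderiv ℝ φ (q, z) (fderiv ℝ m (p, q) (X, 0), 0))
        h6).unique e4) Y
    have e6 : fderiv ℝ m (p, p) (X, 0) = X := hm.fderiv_left.self_of_nhds X
    rw [h2] at e5
    simp [e6] at e5
    rw [actionField_apply _ _ _ Y, e5, fderiv_fderiv_symm cm (0, Y) (X, 0)]
    abel
  intro X Y
  rw [main, main, fderiv_fderiv_symm h4 (Y, 0) (X, 0), actionField_apply, germBracket]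
  have : ((fderiv ℝ (fderiv ℝ m) (p, p) (X, 0) (0, Y) - fderiv ℝ (fderiv ℝ m) (p, p) (Y, 0) (0, X),
      0) : E × F) = (fderiv ℝ (fderiv ℝ m) (p, p) (X, 0) (0, Y), 0)
        - (fderiv ℝ (fderiv ℝ m) (p, p) (Y, 0) (0, X), 0) := by simp
  rw [this, map_sub]
  abel

/-- The fields induced by a local isometric action are Killing. -/
theorem IsActionGerm.killing {G : F → F →L[ℝ] F →L[ℝ] ℝ} (hφ : IsActionGerm m p φ y₀)
    (hG : ∀ᶠ y in 𝓝 y₀, ContDiffAt ℝ ∞ G y)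
    (hinv : ∀ᶠ z in 𝓝 (p, y₀), ∀ v w,
      G (φ z) (fderiv ℝ φ z (0, v)) (fderiv ℝ φ z (0, w)) = G z.2 v w) (X : E) :
    ∀ᶠ y in 𝓝 y₀, ∀ v w, fderiv ℝ G y (actionField φ p y X) v w
      + G y (fderiv ℝ (fun z => actionField φ p z X) y v) w
      + G y v (fderiv ℝ (fun z => actionField φ p z X) y w) = 0 := by
  filter_upwards [eventually_prod_right hinv.eventually_nhds, hφ.unit, hφ.fderiv_actionField,
    eventually_prod_right hφ.smooth, hφ.fderiv_right, hG] with y h1 h2 h3 h4 h5 h6 v w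
  have e1 := hasFDerivAt_comp_left (h4.differentiableAt (by simp))
  have h6' : HasFDerivAt G (fderiv ℝ G y) (φ (p, y)) := by
    rw [h2]; exact (h6.differentiableAt (by simp)).hasFDerivAt
  have e2 := HasFDerivAt.comp (f := fun x => φ (x, y)) p h6' e1
  have e3 := fun v : F => (hasFDerivAt_comp_left (differentiableAt_fderiv h4)).clm_apply
    (hasFDerivAt_const ((0 : E), v) p)
  have e4 := (e2.clm_apply (e3 v)).clm_apply (e3 w)
  have h7 : ∀ᶠ q in 𝓝 p, G (φ (q, y)) (fderiv ℝ φ (q, y) (0, v)) (fderiv ℝ φ (q, y) (0, w))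
      = G y v w := ((Continuous.prodMk_left y).continuousAt.eventually h1).mono fun q hq => hq v w
  have e5 := DFunLike.congr_fun (((hasFDerivAt_const (G y v w) p).congr_of_eventuallyEq h7).unique
    e4) X
  simp [h2, h5] at e5
  rw [h3, h3, fderiv_fderiv_symm h4 (0, v), fderiv_fderiv_symm h4 (0, w), actionField_apply]
  linarith

end LocalActions

/-! ### Derivatives of maps between manifolds -/

section TangentMaps

variable {n n' n'' : ℕ} {M : Type*} [TopologicalSpace M]
  [ChartedSpace (EuclideanSpace ℝ (Fin n)) M]
  {M' : Type*} [TopologicalSpace M'] [ChartedSpace (EuclideanSpace ℝ (Fin n')) M']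
  {M'' : Type*} [TopologicalSpace M''] [ChartedSpace (EuclideanSpace ℝ (Fin n'')) M'']

/-- The derivative of a map between manifolds as a linear map between the model spaces, with which
the tangent spaces are identified by definition. -/
def tderiv (f : M → M') (x : M) : EuclideanSpace ℝ (Fin n) →L[ℝ] EuclideanSpace ℝ (Fin n') :=
  mfderiv (𝓡 n) (𝓡 n') f x

lemma tderiv_comp {g : M' → M''} {f : M → M'} {x : M} {y : M'} (hy : f x = y)
    (hg : MDifferentiableAt (𝓡 n') (𝓡 n'') g y) (hf : MDifferentiableAt (𝓡 n) (𝓡 n') f x) :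
    tderiv (n := n) (n' := n'') (fun z => g (f z)) x
      = (tderiv (n := n') (n' := n'') g y).comp (tderiv (n := n) (n' := n') f x) := by
  subst hy
  exact mfderiv_comp x hg hf

lemma tderiv_congr {f g : M → M'} {x : M} (h : f =ᶠ[𝓝 x] g) :
    tderiv (n := n) (n' := n') f x = tderiv (n := n) (n' := n') g x :=
  h.mfderiv_eq

lemma tderiv_id (x : M) : tderiv (n := n) (n' := n) (fun z : M => z) x = ContinuousLinearMap.id ℝ _ :=
  mfderiv_id

lemma tderiv_eq_fderiv (f : EuclideanSpace ℝ (Fin n) → EuclideanSpace ℝ (Fin n'))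
    (x : EuclideanSpace ℝ (Fin n)) : tderiv f x = fderiv ℝ f x :=
  mfderiv_eq_fderiv

lemma tderiv_eq {f : M → M'} {x : M} {y : M'} (hy : f x = y)
    (hf : MDifferentiableAt (𝓡 n) (𝓡 n') f x) :
    tderiv (n := n) (n' := n') f x = fderiv ℝ (fun z => extChartAt (𝓡 n') y
      (f ((extChartAt (𝓡 n) x).symm z))) (extChartAt (𝓡 n) x x) := by
  subst hy
  have h : tderiv (n := n) (n' := n') f x
      = fderivWithin ℝ (writtenInExtChartAt (𝓡 n) (𝓡 n') x f) (Set.range (𝓡 n))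
        (extChartAt (𝓡 n) x x) := hf.mfderiv
  rw [h, ModelWithCorners.range_eq_univ, fderivWithin_univ]
  rfl

lemma tderiv_extChartAt_self (x : M) :
    tderiv (n := n) (n' := n) (extChartAt (𝓡 n) x) x = ContinuousLinearMap.id ℝ _ := by
  rw [tderiv_eq rfl ((contMDiffAt_extChartAt (n := 1)).mdifferentiableAt one_ne_zero)]
  have h : (fun z => extChartAt (𝓡 n) (extChartAt (𝓡 n) x x) (extChartAt (𝓡 n) x
      ((extChartAt (𝓡 n) x).symm z))) =ᶠ[𝓝 (extChartAt (𝓡 n) x x)] fun z => z := by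
    filter_upwards [extChartAt_target_mem_nhds (I := 𝓡 n) x] with z hz
    rw [(extChartAt (𝓡 n) x).right_inv hz]
    rfl
  rw [h.fderiv_eq, fderiv_id']

variable [IsManifold (𝓡 n) ∞ M]

lemma contMDiffAt_chart {x y : M} (hy : y ∈ (extChartAt (𝓡 n) x).source) :
    ContMDiffAt (𝓡 n) (𝓡 n) ∞ (extChartAt (𝓡 n) x) y :=
  contMDiffAt_extChartAt' (by rwa [extChartAt_source] at hy)

lemma contMDiffAt_chart_symm {x : M} {y : EuclideanSpace ℝ (Fin n)}
    (hy : y ∈ (extChartAt (𝓡 n) x).target) :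
    ContMDiffAt (𝓡 n) (𝓡 n) ∞ (extChartAt (𝓡 n) x).symm y :=
  (contMDiffOn_extChartAt_symm x).contMDiffAt ((isOpen_extChartAt_target x).mem_nhds hy)

lemma mdiffAt_chart {x y : M} (hy : y ∈ (extChartAt (𝓡 n) x).source) :
    MDifferentiableAt (𝓡 n) (𝓡 n) (extChartAt (𝓡 n) x) y :=
  (contMDiffAt_chart hy).mdifferentiableAt (by simp)

lemma mdiffAt_chart_symm {x : M} {y : EuclideanSpace ℝ (Fin n)}
    (hy : y ∈ (extChartAt (𝓡 n) x).target) :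
    MDifferentiableAt (𝓡 n) (𝓡 n) (extChartAt (𝓡 n) x).symm y :=
  (contMDiffAt_chart_symm hy).mdifferentiableAt (by simp)

lemma tderiv_symm_comp {x : M} {y : EuclideanSpace ℝ (Fin n)}
    (hy : y ∈ (extChartAt (𝓡 n) x).target) :
    (tderiv (n := n) (n' := n) (extChartAt (𝓡 n) x).symm y).comp
      (tderiv (n := n) (n' := n) (extChartAt (𝓡 n) x) ((extChartAt (𝓡 n) x).symm y))
      = ContinuousLinearMap.id ℝ _ := by
  have hs := (extChartAt (𝓡 n) x).map_target hy
  rw [← tderiv_comp ((extChartAt (𝓡 n) x).right_inv hy) (mdiffAt_chart_symm hy) (mdiffAt_chart hs),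
    ← tderiv_id ((extChartAt (𝓡 n) x).symm y)]
  refine tderiv_congr ?_
  filter_upwards [(isOpen_extChartAt_source x).mem_nhds hs] with z hz
  exact (extChartAt (𝓡 n) x).left_inv hz

lemma tderiv_comp_symm {x : M} {y : EuclideanSpace ℝ (Fin n)}
    (hy : y ∈ (extChartAt (𝓡 n) x).target) :
    (tderiv (n := n) (n' := n) (extChartAt (𝓡 n) x) ((extChartAt (𝓡 n) x).symm y)).comp
      (tderiv (n := n) (n' := n) (extChartAt (𝓡 n) x).symm y)
      = ContinuousLinearMap.id ℝ _ := by
  have hs := (extChartAt (𝓡 n) x).map_target hy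
  rw [← tderiv_comp rfl (mdiffAt_chart hs) (mdiffAt_chart_symm hy), ← tderiv_id y]
  refine tderiv_congr ?_
  filter_upwards [(isOpen_extChartAt_target x).mem_nhds hy] with z hz
  exact (extChartAt (𝓡 n) x).right_inv hz

lemma tderiv_symm_self (x : M) :
    tderiv (n := n) (n' := n) (extChartAt (𝓡 n) x).symm (extChartAt (𝓡 n) x x)
      = ContinuousLinearMap.id ℝ _ := by
  have h := tderiv_symm_comp (mem_extChartAt_target (I := 𝓡 n) x)
  rw [extChartAt_to_inv, tderiv_extChartAt_self] at h
  exact h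

end TangentMaps

/-! ### Conjugation in a local group -/

section ConjugationGerm

variable {E : Type*} [NormedAddCommGroup E] [NormedSpace ℝ E] {m K : E × E → E} {p : E}

/-- The mixed second derivative at the unit of conjugation `K (q, x) = q x q⁻¹` is the bracket.
Inverses are avoided by the equation `K (q, x) q = q x`, which is differentiated in `x` (`key`) and
then in `q`. -/
lemma IsMulGerm.fderiv_conj (hm : IsMulGerm m p)
    (hK : ∀ᶠ z in 𝓝 (p, p), ContDiffAt ℝ ∞ K z) (hKr : ∀ᶠ q in 𝓝 p, K (q, p) = p)
    (hKl : ∀ᶠ q in 𝓝 p, K (p, q) = q) (hKm : ∀ᶠ z in 𝓝 (p, p), m (K z, z.1) = m z) (X Y : E) :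
    fderiv ℝ (fderiv ℝ K) (p, p) (X, 0) (0, Y) = germBracket m p X Y := by
  have key : ∀ᶠ q in 𝓝 p, fderiv ℝ m (p, q) (fderiv ℝ K (q, p) (0, Y), 0)
      = fderiv ℝ m (q, p) (0, Y) := by
    filter_upwards [eventually_prod_left hK, hKr, eventually_prod_left hKm.eventually_nhds,
      eventually_prod_right hm.smooth, eventually_prod_left hm.smooth] with q h1 h2 h3 h4 h5
    have e1 := (hasFDerivAt_comp_right (h1.differentiableAt (by simp))).prodMk
      (hasFDerivAt_const q p)
    have e2 : HasFDerivAt m (fderiv ℝ m (p, q)) (K (q, p), q) := by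
      rw [h2]; exact (h4.differentiableAt (by simp)).hasFDerivAt
    have e3 := HasFDerivAt.comp p e2 e1
    have e4 := hasFDerivAt_comp_right (h5.differentiableAt (by simp))
    have h6 : ∀ᶠ x in 𝓝 p, m (K (q, x), q) = m (q, x) :=
      (Continuous.prodMk_right q).continuousAt.eventually h3
    exact DFunLike.congr_fun ((e4.congr_of_eventuallyEq h6).unique e3) Y |>.symm
  have cm := hm.smooth.self_of_nhds
  have cK := hK.self_of_nhds
  have e1 := (hasFDerivAt_comp_left (differentiableAt_fderiv cK)).clm_apply
    (hasFDerivAt_const ((0 : E), Y) p)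
  have e2 := (hasFDerivAt_comp_right (differentiableAt_fderiv cm)).clm_apply
    (e1.prodMk (hasFDerivAt_const (0 : E) p))
  have e3 := (hasFDerivAt_comp_left (differentiableAt_fderiv cm)).clm_apply
    (hasFDerivAt_const ((0 : E), Y) p)
  have e4 := DFunLike.congr_fun ((e3.congr_of_eventuallyEq key).unique e2) X
  have h1 : fderiv ℝ K (p, p) (0, Y) = Y := by
    have h2 := hasFDerivAt_comp_right (cK.differentiableAt (by simp))
    have h3 : HasFDerivAt (fun q => K (p, q)) (ContinuousLinearMap.id ℝ E) p :=
      (hasFDerivAt_id p).congr_of_eventuallyEq hKl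
    exact DFunLike.congr_fun (h2.unique h3) Y
  have h2 : ∀ Z, fderiv ℝ m (p, p) (Z, 0) = Z := hm.fderiv_left.self_of_nhds
  simp [h1, h2] at e4
  rw [germBracket, e4, fderiv_fderiv_symm cm (0, X) (Y, 0)]
  abel

end ConjugationGerm

/-! ### The Lie group in the chart around the unit -/

section GroupChart

variable (d : ℕ) (G : Type*) [TopologicalSpace G] [ChartedSpace (EuclideanSpace ℝ (Fin d)) G]
  [Group G]

/-- The coordinates of the unit. -/
def unitChart : EuclideanSpace ℝ (Fin d) := extChartAt (𝓡 d) (1 : G) 1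

/-- The point of `G` with given coordinates in the chart around `1`. -/
def ofChart (y : EuclideanSpace ℝ (Fin d)) : G := (extChartAt (𝓡 d) (1 : G)).symm y

/-- The multiplication in the chart around `1`. -/
def mulChart (z : EuclideanSpace ℝ (Fin d) × EuclideanSpace ℝ (Fin d)) :
    EuclideanSpace ℝ (Fin d) :=
  extChartAt (𝓡 d) (1 : G) (ofChart d G z.1 * ofChart d G z.2)

/-- Conjugation in the chart around `1`. -/
def conjChart (z : EuclideanSpace ℝ (Fin d) × EuclideanSpace ℝ (Fin d)) :
    EuclideanSpace ℝ (Fin d) :=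
  extChartAt (𝓡 d) (1 : G) (ofChart d G z.1 * ofChart d G z.2 * (ofChart d G z.1)⁻¹)

variable {d G}

lemma ofChart_unitChart : ofChart d G (unitChart d G) = 1 := extChartAt_to_inv 1

lemma continuousAt_ofChart : ContinuousAt (ofChart d G) (unitChart d G) :=
  continuousAt_extChartAt_symm 1

lemma eventually_chart_ofChart :
    ∀ᶠ y in 𝓝 (unitChart d G), extChartAt (𝓡 d) (1 : G) (ofChart d G y) = y := by
  filter_upwards [extChartAt_target_mem_nhds (I := 𝓡 d) (1 : G)] with y hy
  exact (extChartAt (𝓡 d) (1 : G)).right_inv hy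

lemma eventually_ofChart_chart :
    ∀ᶠ a in 𝓝 (1 : G), ofChart d G (extChartAt (𝓡 d) (1 : G) a) = a := by
  filter_upwards [extChartAt_source_mem_nhds (I := 𝓡 d) (1 : G)] with y hy
  exact (extChartAt (𝓡 d) (1 : G)).left_inv hy

variable [LieGroup (𝓡 d) ∞ G]

lemma eventually_contMDiffAt_ofChart :
    ∀ᶠ y in 𝓝 (unitChart d G), ContMDiffAt (𝓡 d) (𝓡 d) ∞ (ofChart d G) y := by
  filter_upwards [extChartAt_target_mem_nhds (I := 𝓡 d) (1 : G)] with y hy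
  exact contMDiffAt_chart_symm hy

/-- A map to a manifold which is smooth near a point is smooth in a chart. -/
lemma eventually_contDiffAt_chart {V : Type*} [NormedAddCommGroup V] [NormedSpace ℝ V] {n : ℕ}
    {M : Type*} [TopologicalSpace M] [ChartedSpace (EuclideanSpace ℝ (Fin n)) M]
    [IsManifold (𝓡 n) ∞ M] {f : V → M} {x : V} {x₀ : M} (hx : f x = x₀)
    (hf : ∀ᶠ z in 𝓝 x, ContMDiffAt 𝓘(ℝ, V) (𝓡 n) ∞ f z) :
    ∀ᶠ z in 𝓝 x, ContDiffAt ℝ ∞ (fun z => extChartAt (𝓡 n) x₀ (f z)) z := by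
  have h1 : ∀ᶠ z in 𝓝 x, f z ∈ (extChartAt (𝓡 n) x₀).source :=
    hf.self_of_nhds.continuousAt.eventually
      (by rw [hx]; exact extChartAt_source_mem_nhds (I := 𝓡 n) x₀)
  filter_upwards [h1, hf] with z h2 h3
  exact contMDiffAt_iff_contDiffAt.1 ((contMDiffAt_chart h2).comp z h3)

lemma eventually_contMDiffAt_fst {V W : Type*} [NormedAddCommGroup V] [NormedSpace ℝ V]
    [NormedAddCommGroup W] [NormedSpace ℝ W] {f : V → G} {x : V × W}
    (hf : ∀ᶠ z in 𝓝 x.1, ContMDiffAt 𝓘(ℝ, V) (𝓡 d) ∞ f z) :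
    ∀ᶠ z in 𝓝 x, ContMDiffAt 𝓘(ℝ, V × W) (𝓡 d) ∞ (fun z => f z.1) z :=
  ((continuous_fst.tendsto x).eventually hf).mono fun z hz =>
    hz.comp z contDiff_fst.contMDiff.contMDiffAt

lemma eventually_contMDiffAt_snd {V W : Type*} [NormedAddCommGroup V] [NormedSpace ℝ V]
    [NormedAddCommGroup W] [NormedSpace ℝ W] {f : W → G} {x : V × W}
    (hf : ∀ᶠ z in 𝓝 x.2, ContMDiffAt 𝓘(ℝ, W) (𝓡 d) ∞ f z) :
    ∀ᶠ z in 𝓝 x, ContMDiffAt 𝓘(ℝ, V × W) (𝓡 d) ∞ (fun z => f z.2) z :=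
  ((continuous_snd.tendsto x).eventually hf).mono fun z hz =>
    hz.comp z contDiff_snd.contMDiff.contMDiffAt

lemma eventually_contDiffAt_mulChart :
    ∀ᶠ z in 𝓝 (unitChart d G, unitChart d G), ContDiffAt ℝ ∞ (mulChart d G) z := by
  refine eventually_contDiffAt_chart (by simp only [ofChart_unitChart, mul_one]) ?_
  filter_upwards [eventually_contMDiffAt_fst (x := (unitChart d G, unitChart d G))
      (eventually_contMDiffAt_ofChart (d := d) (G := G)),
    eventually_contMDiffAt_snd (x := (unitChart d G, unitChart d G))
      (eventually_contMDiffAt_ofChart (d := d) (G := G))] with z h1 h2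
  exact h1.mul h2

lemma eventually_contDiffAt_conjChart :
    ∀ᶠ z in 𝓝 (unitChart d G, unitChart d G), ContDiffAt ℝ ∞ (conjChart d G) z := by
  refine eventually_contDiffAt_chart (by simp only [ofChart_unitChart, mul_one, inv_one]) ?_
  filter_upwards [eventually_contMDiffAt_fst (x := (unitChart d G, unitChart d G))
      (eventually_contMDiffAt_ofChart (d := d) (G := G)),
    eventually_contMDiffAt_snd (x := (unitChart d G, unitChart d G))
      (eventually_contMDiffAt_ofChart (d := d) (G := G))] with z h1 h2
  exact (h1.mul h2).mul h1.inv

/-- `ofChart` is multiplicative near the unit. -/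
lemma eventually_ofChart_mulChart :
    ∀ᶠ z in 𝓝 (unitChart d G, unitChart d G),
      ofChart d G (mulChart d G z) = ofChart d G z.1 * ofChart d G z.2 := by
  have : IsTopologicalGroup G := topologicalGroup_of_lieGroup (𝓡 d) ∞
  have h1 : ContinuousAt (fun z : EuclideanSpace ℝ (Fin d) × EuclideanSpace ℝ (Fin d) =>
      ofChart d G z.1 * ofChart d G z.2) (unitChart d G, unitChart d G) :=
    (ContinuousAt.comp (g := ofChart d G) (f := Prod.fst) continuousAt_ofChart
      continuousAt_fst).mul
      (ContinuousAt.comp (g := ofChart d G) (f := Prod.snd) continuousAt_ofChart continuousAt_snd)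
  have h2 := h1.tendsto
  simp only [ofChart_unitChart, mul_one] at h2
  exact h2.eventually eventually_ofChart_chart

lemma eventually_ofChart_conjChart :
    ∀ᶠ z in 𝓝 (unitChart d G, unitChart d G), ofChart d G (conjChart d G z)
      = ofChart d G z.1 * ofChart d G z.2 * (ofChart d G z.1)⁻¹ := by
  have : IsTopologicalGroup G := topologicalGroup_of_lieGroup (𝓡 d) ∞
  have h0 := ContinuousAt.comp (g := ofChart d G) (f := Prod.fst)
    (x := (unitChart d G, unitChart d G)) continuousAt_ofChart continuousAt_fst
  have h1 : ContinuousAt (fun z : EuclideanSpace ℝ (Fin d) × EuclideanSpace ℝ (Fin d) =>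
      ofChart d G z.1 * ofChart d G z.2 * (ofChart d G z.1)⁻¹) (unitChart d G, unitChart d G) :=
    (h0.mul (ContinuousAt.comp (g := ofChart d G) (f := Prod.snd) continuousAt_ofChart
      continuousAt_snd)).mul h0.inv
  have h2 := h1.tendsto
  simp only [ofChart_unitChart, mul_one, inv_one] at h2
  exact h2.eventually eventually_ofChart_chart

lemma isMulGerm_mulChart : IsMulGerm (mulChart d G) (unitChart d G) where
  smooth := eventually_contDiffAt_mulChart
  left := by
    filter_upwards [eventually_chart_ofChart (d := d) (G := G)] with q hq
    simp only [mulChart, ofChart_unitChart, one_mul, hq]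
  right := by
    filter_upwards [eventually_chart_ofChart (d := d) (G := G)] with q hq
    simp only [mulChart, ofChart_unitChart, mul_one, hq]

/-- The left invariant vector field with value `X` at `1`, in the chart around `1`. -/
def invariantFieldChart (X : EuclideanSpace ℝ (Fin d)) (p : EuclideanSpace ℝ (Fin d)) :
    EuclideanSpace ℝ (Fin d) :=
  VectorField.mpullbackWithin 𝓘(ℝ, EuclideanSpace ℝ (Fin d)) (𝓡 d)
    (extChartAt (𝓡 d) (1 : G)).symm
    (mulInvariantVectorField (I := 𝓡 d) (G := G) X) (Set.range (𝓡 d)) p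

lemma invariantFieldChart_eq (X p : EuclideanSpace ℝ (Fin d)) :
    invariantFieldChart (G := G) X p = (tderiv (n := d) (n' := d) (ofChart d G) p).inverse
      (tderiv (n := d) (n' := d) (fun x : G => ofChart d G p * x) 1 X) := by
  have h : ∀ s : Set (EuclideanSpace ℝ (Fin d)), s = Set.univ →
      mfderivWithin 𝓘(ℝ, EuclideanSpace ℝ (Fin d)) (𝓡 d) (extChartAt (𝓡 d) (1 : G)).symm s p
        = mfderiv 𝓘(ℝ, EuclideanSpace ℝ (Fin d)) (𝓡 d) (extChartAt (𝓡 d) (1 : G)).symm p := by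
    rintro s rfl
    rw [mfderivWithin_univ]
  exact congrArg (fun D : EuclideanSpace ℝ (Fin d) →L[ℝ] EuclideanSpace ℝ (Fin d) => D.inverse
    (tderiv (n := d) (n' := d) (fun x : G => ofChart d G p * x) 1 X))
    (h _ (ModelWithCorners.range_eq_univ _))

lemma mdiff_mul_left (a x : G) : MDifferentiableAt (𝓡 d) (𝓡 d) (fun x : G => a * x) x :=
  (contMDiff_mul_left (I := 𝓡 d) (n := ∞) (a := a)).mdifferentiableAt (by simp)

/-- Left invariant fields are derivatives of the multiplication in the second variable. -/
lemma invariantFieldChart_eventuallyEq (X : EuclideanSpace ℝ (Fin d)) :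
    invariantFieldChart (G := G) X =ᶠ[𝓝 (unitChart d G)]
      fun p => fderiv ℝ (mulChart d G) (p, unitChart d G) (0, X) := by
  filter_upwards [eventually_prod_left (eventually_contDiffAt_mulChart (d := d) (G := G)),
    eventually_prod_left (eventually_ofChart_mulChart (d := d) (G := G)).eventually_nhds,
    extChartAt_target_mem_nhds (I := 𝓡 d) (1 : G),
    (isMulGerm_mulChart (d := d) (G := G)).right] with p h1 h2 h3 h4
  rw [invariantFieldChart_eq]
  have hinv : (tderiv (n := d) (n' := d) (ofChart d G) p).inverse
      = tderiv (n := d) (n' := d) (extChartAt (𝓡 d) (1 : G)) (ofChart d G p) :=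
    ContinuousLinearMap.inverse_eq (tderiv_symm_comp h3) (tderiv_comp_symm h3)
  have h5 := hasFDerivAt_comp_right (h1.differentiableAt (by simp))
  have h6 : (tderiv (n := d) (n' := d) (fun z => ofChart d G (mulChart d G (p, z)))
      (unitChart d G)) = tderiv (n := d) (n' := d) (fun z => ofChart d G p * ofChart d G z)
      (unitChart d G) :=
    tderiv_congr (((Continuous.prodMk_right p).continuousAt (x := unitChart d G)).eventually h2)
  rw [tderiv_comp (g := ofChart d G) (f := fun z => mulChart d G (p, z)) h4
      (mdiffAt_chart_symm h3) h5.differentiableAt.mdifferentiableAt,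
    tderiv_comp (g := fun x : G => ofChart d G p * x) (f := ofChart d G) ofChart_unitChart
      (mdiff_mul_left _ _) (mdiffAt_chart_symm (mem_extChartAt_target (I := 𝓡 d) (1 : G)))] at h6
  have h7 : tderiv (n := d) (n' := d) (ofChart d G) (unitChart d G) = ContinuousLinearMap.id ℝ _ :=
    tderiv_symm_self 1
  rw [h7, ContinuousLinearMap.comp_id] at h6
  rw [← h6, hinv, ContinuousLinearMap.comp_apply]
  refine (DFunLike.congr_fun (tderiv_comp_symm h3) _).trans ?_
  rw [tderiv_eq_fderiv, h5.fderiv]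
  rfl

/-- The Lie bracket of the Lie algebra of `G`, which is defined through left invariant vector
fields, is the bracket of the multiplication in the chart. -/
theorem lie_eq_germBracket (X Y : GroupLieAlgebra (𝓡 d) G) :
    ⁅X, Y⁆ = germBracket (mulChart d G) (unitChart d G) X Y := by
  have hd : ∀ X : EuclideanSpace ℝ (Fin d), HasFDerivAt
      (fun p => fderiv ℝ (mulChart d G) (p, unitChart d G) (0, X))
      (((fderiv ℝ (fderiv ℝ (mulChart d G)) (unitChart d G, unitChart d G)).comp
        (ContinuousLinearMap.inl ℝ _ _)).flip (0, X)) (unitChart d G) := fun X => by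
    have h := (hasFDerivAt_comp_left (differentiableAt_fderiv
      (eventually_contDiffAt_mulChart (d := d) (G := G)).self_of_nhds)).clm_apply
      (hasFDerivAt_const ((0 : EuclideanSpace ℝ (Fin d)), X) (unitChart d G))
    simpa using h
  have hu : ∀ X : EuclideanSpace ℝ (Fin d),
      fderiv ℝ (mulChart d G) (unitChart d G, unitChart d G) (0, X) = X :=
    isMulGerm_mulChart.fderiv_right.self_of_nhds
  have key : ∀ (D : EuclideanSpace ℝ (Fin d) →L[ℝ] EuclideanSpace ℝ (Fin d))
      (V W : EuclideanSpace ℝ (Fin d) → EuclideanSpace ℝ (Fin d))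
      (S : Set (EuclideanSpace ℝ (Fin d))) (p : EuclideanSpace ℝ (Fin d)),
      D = ContinuousLinearMap.id ℝ _ → S = Set.univ →
      D.inverse (VectorField.lieBracketWithin ℝ V W S p)
        = fderiv ℝ W p (V p) - fderiv ℝ V p (W p) := by
    rintro D V W S p rfl rfl
    rw [VectorField.lieBracketWithin_univ, ContinuousLinearMap.inverse_id]
    rfl
  have e1 : (⁅X, Y⁆ : GroupLieAlgebra (𝓡 d) G)
      = fderiv ℝ (invariantFieldChart (G := G) Y) (unitChart d G)
          (invariantFieldChart (G := G) X (unitChart d G))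
        - fderiv ℝ (invariantFieldChart (G := G) X) (unitChart d G)
          (invariantFieldChart (G := G) Y (unitChart d G)) := by
    refine (VectorField.mlieBracketWithin_apply (I := 𝓡 d)
      (V := mulInvariantVectorField (I := 𝓡 d) (G := G) X)
      (W := mulInvariantVectorField (I := 𝓡 d) (G := G) Y)
      (s := Set.univ) (x₀ := (1 : G))).trans ?_
    exact key _ (invariantFieldChart (G := G) X) (invariantFieldChart (G := G) Y) _ _
      (tderiv_extChartAt_self 1)
      (by rw [Set.preimage_univ, Set.univ_inter, ModelWithCorners.range_eq_univ])
  have e2 : ∀ X Y : EuclideanSpace ℝ (Fin d),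
      fderiv ℝ (invariantFieldChart (G := G) Y) (unitChart d G)
          (invariantFieldChart (G := G) X (unitChart d G))
        - fderiv ℝ (invariantFieldChart (G := G) X) (unitChart d G)
          (invariantFieldChart (G := G) Y (unitChart d G))
        = germBracket (mulChart d G) (unitChart d G) X Y := by
    intro X Y
    rw [(invariantFieldChart_eventuallyEq X).fderiv_eq,
      (invariantFieldChart_eventuallyEq Y).fderiv_eq,
      (invariantFieldChart_eventuallyEq X).self_of_nhds,
      (invariantFieldChart_eventuallyEq Y).self_of_nhds, (hd _).fderiv, (hd _).fderiv]
    simp [germBracket, hu]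
  exact e1.trans (e2 X Y)

/-- The adjoint representation as a continuous linear map. -/
def AdL (a : G) : EuclideanSpace ℝ (Fin d) →L[ℝ] EuclideanSpace ℝ (Fin d) :=
  tderiv (fun x : G => a * x * a⁻¹) 1

lemma contMDiff_conj (a : G) : ContMDiff (𝓡 d) (𝓡 d) ∞ (fun x : G => a * x * a⁻¹) :=
  (contMDiff_const.mul contMDiff_id).mul contMDiff_const

lemma mdiff_conj (a x : G) : MDifferentiableAt (𝓡 d) (𝓡 d) (fun x : G => a * x * a⁻¹) x :=
  (contMDiff_conj a).mdifferentiableAt (by simp)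

lemma AdL_one : AdL (d := d) (1 : G) = ContinuousLinearMap.id ℝ _ := by
  rw [AdL, ← tderiv_id (1 : G)]
  exact tderiv_congr (Eventually.of_forall fun x => by simp)

lemma AdL_mul (a b : G) : AdL (d := d) (a * b) = (AdL a).comp (AdL b) := by
  rw [AdL, AdL, AdL, ← tderiv_comp (by simp) (mdiff_conj a 1) (mdiff_conj b 1)]
  exact tderiv_congr (Eventually.of_forall fun x => by
    simp only [mul_inv_rev, mul_assoc])

/-- Near the unit, `Ad` is a derivative of conjugation in the chart. -/
lemma eventually_AdL :
    ∀ᶠ q in 𝓝 (unitChart d G), ∀ Y, AdL (ofChart d G q) Y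
      = fderiv ℝ (conjChart d G) (q, unitChart d G) (0, Y) := by
  filter_upwards [eventually_prod_left (eventually_contDiffAt_conjChart (d := d) (G := G))]
    with q hq Y
  have h1 := hasFDerivAt_comp_right (hq.differentiableAt (by simp))
  have h2 : AdL (ofChart d G q) = fderiv ℝ (fun z => conjChart d G (q, z)) (unitChart d G) :=
    tderiv_eq (by simp) (mdiff_conj _ _)
  rw [h2, h1.fderiv]
  rfl

/-- The derivative of the adjoint representation is the Lie bracket. -/
theorem hasFDerivAt_AdL (Y : EuclideanSpace ℝ (Fin d)) :
    ∃ D : EuclideanSpace ℝ (Fin d) →L[ℝ] EuclideanSpace ℝ (Fin d),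
      HasFDerivAt (fun q => AdL (ofChart d G q) Y) D (unitChart d G) ∧
      ∀ X, D X = germBracket (mulChart d G) (unitChart d G) X Y := by
  have h := (hasFDerivAt_comp_left (differentiableAt_fderiv
    (eventually_contDiffAt_conjChart (d := d) (G := G)).self_of_nhds)).clm_apply
    (hasFDerivAt_const ((0 : EuclideanSpace ℝ (Fin d)), Y) (unitChart d G))
  refine ⟨_, h.congr_of_eventuallyEq (eventually_AdL.mono fun q hq => hq Y), fun X => ?_⟩
  rw [← isMulGerm_mulChart.fderiv_conj eventually_contDiffAt_conjChart]
  · simp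
  · refine Eventually.of_forall fun q => ?_
    simp only [conjChart, ofChart_unitChart, mul_one, mul_inv_cancel]
    rfl
  · filter_upwards [eventually_chart_ofChart (d := d) (G := G)] with q hq
    simp only [conjChart, ofChart_unitChart, one_mul, inv_one, mul_one, hq]
  · filter_upwards [eventually_ofChart_conjChart (d := d) (G := G)] with z hz
    have e1 : mulChart d G (conjChart d G z, z.1) = extChartAt (𝓡 d) (1 : G)
      (ofChart d G (conjChart d G z) * ofChart d G z.1) := rfl
    rw [e1, hz, inv_mul_cancel_right]
    rfl

/-- The derivative of `Ad (c t) Z` along a curve through `1` with velocity `W` is `⁅W, Z⁆`. -/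
lemma hasDerivAt_AdL {c : ℝ → G} {t₀ : ℝ} {W : GroupLieAlgebra (𝓡 d) G} (hc : ContinuousAt c t₀)
    (h1 : c t₀ = 1)
    (hd : HasDerivAt (fun t => extChartAt (𝓡 d) (1 : G) (c t)) (W : EuclideanSpace ℝ (Fin d)) t₀)
    (Z : GroupLieAlgebra (𝓡 d) G) :
    HasDerivAt (fun t => AdL (d := d) (c t) Z) (⁅W, Z⁆ : GroupLieAlgebra (𝓡 d) G) t₀ := by
  obtain ⟨D, hD, hDX⟩ := hasFDerivAt_AdL (G := G) Z
  have h2 : unitChart d G = extChartAt (𝓡 d) (1 : G) (c t₀) := by rw [h1]; rfl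
  rw [h2] at hD
  have h3 := hD.comp_hasDerivAt t₀ hd
  rw [lie_eq_germBracket, ← hDX W]
  refine h3.congr_of_eventuallyEq ?_
  have h4 : ∀ᶠ a in 𝓝 (c t₀), ofChart d G (extChartAt (𝓡 d) (1 : G) a) = a := by
    rw [h1]; exact eventually_ofChart_chart
  filter_upwards [hc.eventually h4] with t ht
  simp only [Function.comp_apply, ht]

end GroupChart

/-! ### Submersions -/

section Submersion

variable {E F : Type*} [NormedAddCommGroup E] [NormedSpace ℝ E] [FiniteDimensional ℝ E]
  [NormedAddCommGroup F] [NormedSpace ℝ F] [FiniteDimensional ℝ F]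

/-- Submersions are linear in suitable coordinates `Θ` around a point; `Ψ` is a local inverse
of `Θ`. -/
theorem exists_submersion_chart {P : E → F} {u : E} (hP : ∀ᶠ p in 𝓝 u, ContDiffAt ℝ ∞ P p)
    (hs : Function.Surjective (fderiv ℝ P u)) :
    ∃ Θ Ψ : E → E, Θ 0 = u ∧ (∀ᶠ w in 𝓝 0, ContDiffAt ℝ ∞ Θ w) ∧
      HasFDerivAt Θ (ContinuousLinearMap.id ℝ E) 0 ∧
      (∀ᶠ w in 𝓝 0, P (Θ w) = P u + fderiv ℝ P u w) ∧ ContinuousAt Ψ u ∧ Ψ u = 0 ∧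
      ∀ᶠ p in 𝓝 u, Θ (Ψ p) = p ∧ fderiv ℝ P u (Ψ p) = P p - P u := by
  have : CompleteSpace E := FiniteDimensional.complete ℝ E
  set D := fderiv ℝ P u with hD
  obtain ⟨s', hs'⟩ := D.toLinearMap.exists_rightInverse_of_surjective
    (LinearMap.range_eq_top.2 hs)
  set s : F →L[ℝ] E := LinearMap.toContinuousLinearMap s' with hsdef
  have hDs : ∀ y, D (s y) = y := fun y => DFunLike.congr_fun hs' y
  -- `Ψ` replaces the component of `p - u` in the range of the right inverse `s` of `D` by
  -- `s (P p - P u)`, so that `D (Ψ p) = P p - P u`; its derivative at `u` is the identity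
  set Ψ : E → E := fun p => s (P p - P u) + (p - u) - s (D (p - u)) with hΨ
  have cΨ : ∀ᶠ p in 𝓝 u, ContDiffAt ℝ ∞ Ψ p := by
    filter_upwards [hP] with p hp
    exact ((s.contDiff.contDiffAt.comp p (hp.sub contDiffAt_const)).add
      (contDiffAt_id.sub contDiffAt_const)).sub
      (s.contDiff.contDiffAt.comp p (D.contDiff.contDiffAt.comp p
        (contDiffAt_id.sub contDiffAt_const)))
  have dP : HasFDerivAt P D u := (hP.self_of_nhds.differentiableAt (by simp)).hasFDerivAt
  have dΨ : HasFDerivAt Ψ (ContinuousLinearMap.id ℝ E) u := by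
    have hi : HasFDerivAt (fun p : E => p - u) (ContinuousLinearMap.id ℝ E) u :=
      (hasFDerivAt_id u).sub_const u
    have h1 := (((s.hasFDerivAt (x := P u - P u)).comp u (dP.sub_const (P u))).add
      hi).sub ((s.hasFDerivAt (x := D (u - u))).comp u
        (HasFDerivAt.comp (f := fun p => p - u) u D.hasFDerivAt hi))
    exact h1.congr_fderiv (by rw [ContinuousLinearMap.comp_id, add_sub_cancel_left])
  set e : E ≃L[ℝ] E := ContinuousLinearEquiv.refl ℝ E with he
  have dΨ' : HasFDerivAt Ψ (e : E →L[ℝ] E) u := dΨ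
  set f := cΨ.self_of_nhds.toOpenPartialHomeomorph Ψ dΨ' (by simp) with hf
  have hfΨ : (f : E → E) = Ψ := cΨ.self_of_nhds.toOpenPartialHomeomorph_coe dΨ' (by simp)
  have hu : u ∈ f.source := cΨ.self_of_nhds.mem_toOpenPartialHomeomorph_source dΨ' (by simp)
  have hΨu : Ψ u = 0 := by simp [hΨ]
  have hfu : f u = 0 := by rw [hfΨ, hΨu]
  have h0 : (0 : E) ∈ f.target := by rw [← hfu]; exact f.map_source hu
  have hΘ0 : f.symm 0 = u := by rw [← hfu]; exact f.left_inv hu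
  have ht : ∀ᶠ w in 𝓝 (0 : E), w ∈ f.target := f.open_target.mem_nhds h0
  have cont : Tendsto f.symm (𝓝 0) (𝓝 u) := by
    have h1 := (f.symm.continuousAt (x := 0) h0).tendsto
    rwa [hΘ0] at h1
  have inv : ∀ᶠ p in 𝓝 u, ∃ e' : E ≃L[ℝ] E, (e' : E →L[ℝ] E) = fderiv ℝ Ψ p := by
    have h1 : ContinuousAt (fderiv ℝ Ψ) u :=
      (cΨ.self_of_nhds.fderiv_right (m := 0) (by simp)).continuousAt
    have h2 : fderiv ℝ Ψ u = (e : E →L[ℝ] E) := dΨ'.fderiv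
    have h3 := e.nhds
    rw [← h2] at h3
    exact h1.eventually h3
  refine ⟨f.symm, Ψ, hΘ0, ?_, ?_, ?_, cΨ.self_of_nhds.continuousAt, hΨu, ?_⟩
  · filter_upwards [ht, cont.eventually cΨ, cont.eventually inv] with w h1 h2 h3
    obtain ⟨e', he'⟩ := h3
    refine f.contDiffAt_symm (f₀' := e') h1 ?_ (by rwa [hfΨ])
    rw [hfΨ, he']
    exact (h2.differentiableAt (by simp)).hasFDerivAt
  · have h1 : HasFDerivAt f (e : E →L[ℝ] E) (f.symm 0) := by
      rw [hfΨ, hΘ0]; exact dΨ'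
    exact f.hasFDerivAt_symm h0 h1
  · filter_upwards [ht] with w h1
    have h2 : Ψ (f.symm w) = w := by
      have h3 := f.right_inv h1
      rwa [hfΨ] at h3
    have h3 : D w = P (f.symm w) - P u := by
      conv_lhs => rw [← h2]
      simp [hΨ, hDs]
    rw [h3]; abel
  · filter_upwards [f.open_source.mem_nhds hu] with p hp
    refine ⟨?_, by simp [hΨ, hDs]⟩
    have h3 := f.left_inv hp
    rwa [hfΨ] at h3

end Submersion

/-! ### Curves in the group and bi-invariant metrics -/

section BiinvariantForm

variable {d : ℕ} {G : Type*} [TopologicalSpace G] [ChartedSpace (EuclideanSpace ℝ (Fin d)) G]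
  [Group G] [LieGroup (𝓡 d) ∞ G]

/-- A bilinear form on a finite-dimensional space as a continuous bilinear map. -/
def bilinToCLM {V : Type*} [NormedAddCommGroup V] [NormedSpace ℝ V] [FiniteDimensional ℝ V]
    (φ : LinearMap.BilinForm ℝ V) : V →L[ℝ] V →L[ℝ] ℝ :=
  LinearMap.toContinuousLinearMap
    ((LinearMap.toContinuousLinearMap (𝕜 := ℝ) (E := V) (F' := ℝ)).toLinearMap.comp φ)

lemma hasDerivAt_bilin {V : Type*} [NormedAddCommGroup V] [NormedSpace ℝ V]
    [FiniteDimensional ℝ V] (φ : LinearMap.BilinForm ℝ V) {f g : ℝ → V} {f' g' : V} {t : ℝ}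
    (hf : HasDerivAt f f' t) (hg : HasDerivAt g g' t) :
    HasDerivAt (fun t => φ (f t) (g t)) (φ f' (g t) + φ (f t) g') t := by
  have h1 : HasDerivAt (fun t => bilinToCLM φ (f t)) (bilinToCLM φ f') t :=
    (bilinToCLM φ).hasFDerivAt.comp_hasDerivAt t hf
  exact h1.clm_apply hg

/-- The velocity of a curve in `G`, which passes through `1` at `t`, is `W`. -/
structure HasVelocity (c : ℝ → G) (W : GroupLieAlgebra (𝓡 d) G) (t : ℝ) : Prop where
  one : c t = 1
  cont : ContinuousAt c t
  deriv : HasDerivAt (fun t => extChartAt (𝓡 d) (1 : G) (c t)) (W : EuclideanSpace ℝ (Fin d)) t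

/-- The derivative of `φ (Ad (c t) X, Ad (c t) Y)` at the unit: the derivative of `Ad` is `ad`. -/
lemma HasVelocity.hasDerivAt_form {c : ℝ → G} {W : GroupLieAlgebra (𝓡 d) G} {t : ℝ}
    (h : HasVelocity c W t) (φ : LinearMap.BilinForm ℝ (GroupLieAlgebra (𝓡 d) G))
    (X Y : GroupLieAlgebra (𝓡 d) G) :
    HasDerivAt (fun t => φ (Ad d (c t) X) (Ad d (c t) Y)) (φ ⁅W, X⁆ Y + φ X ⁅W, Y⁆) t := by
  have h1 := hasDerivAt_bilin (V := EuclideanSpace ℝ (Fin d)) φ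
    (hasDerivAt_AdL h.cont h.one h.deriv X) (hasDerivAt_AdL h.cont h.one h.deriv Y)
  have h2 : ∀ Z : EuclideanSpace ℝ (Fin d), AdL (d := d) (c t) Z = Z := fun Z => by
    rw [h.one, AdL_one]; rfl
  exact h1.congr_deriv (congrArg₂ (· + ·) (congrArg (φ ⁅W, X⁆) (h2 Y))
    (congrArg (fun z => φ z ⁅W, Y⁆) (h2 X)))

lemma exists_hasVelocity (W : GroupLieAlgebra (𝓡 d) G) : ∃ c : ℝ → G, HasVelocity c W 0 := by
  set v : EuclideanSpace ℝ (Fin d) := W with hv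
  have h0 : unitChart d G + (0 : ℝ) • v = unitChart d G := by simp
  have hl : ContinuousAt (fun t : ℝ => unitChart d G + t • v) 0 := by fun_prop
  refine ⟨fun t => ofChart d G (unitChart d G + t • v), ?_, ?_, ?_⟩
  · rw [h0, ofChart_unitChart]
  · refine ContinuousAt.comp (g := ofChart d G) ?_ hl
    rw [h0]; exact continuousAt_ofChart
  · have h1 : HasDerivAt (fun t : ℝ => unitChart d G + t • v) v 0 := by
      simpa using ((hasDerivAt_id (0 : ℝ)).smul_const v).const_add (unitChart d G)
    refine h1.congr_of_eventuallyEq ?_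
    have h2 : Tendsto (fun t : ℝ => unitChart d G + t • v) (𝓝 0) (𝓝 (unitChart d G)) := by
      have := hl.tendsto; rwa [h0] at this
    exact h2.eventually eventually_chart_ofChart

/-- `Ad a` is the derivative of a left translation followed by a right translation. -/
lemma inducedForm_Ad {q : SmoothMetric d G} (hq : IsBiinvariant q) (a : G)
    (X Y : GroupLieAlgebra (𝓡 d) G) :
    inducedForm q (Ad d a X) (Ad d a Y) = inducedForm q X Y := by
  set L : EuclideanSpace ℝ (Fin d) →L[ℝ] EuclideanSpace ℝ (Fin d) :=
    tderiv (fun y : G => a * y) 1 with hL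
  set R : EuclideanSpace ℝ (Fin d) →L[ℝ] EuclideanSpace ℝ (Fin d) :=
    tderiv (fun y : G => y * a⁻¹) (a * 1) with hR
  set b : G → EuclideanSpace ℝ (Fin d) →L[ℝ] EuclideanSpace ℝ (Fin d) →L[ℝ] ℝ :=
    fun x => q.inner x with hb
  have h1 : ∀ v w, b (a * 1) (L v) (L w) = b 1 v w := fun v w => hq.left a 1 v w
  have h2 : ∀ v w, b (a * 1 * a⁻¹) (R v) (R w) = b (a * 1) v w := fun v w =>
    hq.right a⁻¹ (a * 1) v w
  have h3 : AdL (d := d) a = R.comp L :=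
    tderiv_comp (g := fun y : G => y * a⁻¹) (f := fun y : G => a * y) rfl
      ((contMDiff_mul_right (I := 𝓡 d) (n := ∞) (a := a⁻¹)).mdifferentiableAt (by simp))
      (mdiff_mul_left a 1)
  have h4 : ∀ v w : EuclideanSpace ℝ (Fin d), b 1 (AdL (d := d) a v) (AdL (d := d) a w)
      = b 1 v w := by
    intro v w
    rw [h3, ← h1 v w, ← h2, mul_one, mul_inv_cancel]
    rfl
  exact h4 X Y

/-- `ad`-invariance is the derivative of `Ad`-invariance along a curve through `1`. -/
lemma inducedForm_skew {q : SmoothMetric d G} (hq : IsBiinvariant q)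
    (W X Y : GroupLieAlgebra (𝓡 d) G) :
    inducedForm q ⁅W, X⁆ Y + inducedForm q X ⁅W, Y⁆ = 0 := by
  obtain ⟨c, hc⟩ := exists_hasVelocity W
  have h1 := hc.hasDerivAt_form (inducedForm q) X Y
  simp only [inducedForm_Ad hq] at h1
  exact h1.unique (hasDerivAt_const _ _)

end BiinvariantForm

/-! ### The isotropy algebra and connected isotropy groups -/

section Projection

variable {d n : ℕ} {G : Type*} [TopologicalSpace G] [ChartedSpace (EuclideanSpace ℝ (Fin d)) G]
  [Group G] [LieGroup (𝓡 d) ∞ G] (H : Subgroup G) [ChartedSpace (EuclideanSpace ℝ (Fin n)) (G ⧸ H)]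

/-- The map `x ↦ a x H` in the charts around `1` and `a H`. -/
def projChart (a : G) (p : EuclideanSpace ℝ (Fin d)) : EuclideanSpace ℝ (Fin n) :=
  extChartAt (𝓡 n) (a : G ⧸ H) ((a * ofChart d G p : G) : G ⧸ H)

/-- The derivative at `1` of the map `x ↦ a x H`. -/
def lieProj (a : G) : EuclideanSpace ℝ (Fin d) →L[ℝ] EuclideanSpace ℝ (Fin n) :=
  tderiv (fun x : G => ((a * x : G) : G ⧸ H)) 1

lemma mem_isotropyAlgebra {W : GroupLieAlgebra (𝓡 d) G} :
    W ∈ isotropyAlgebra d n H ↔ lieProj (n := n) H 1 W = 0 := by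
  have h : lieProj (n := n) H (1 : G) = tderiv (n := d) (n' := n) (fun x : G => (x : G ⧸ H)) 1 :=
    tderiv_congr (Eventually.of_forall fun x => by simp)
  rw [h]
  rfl

variable {H} (hM : IsHomogeneousStructure d n H)

include hM in
lemma contMDiff_proj (a : G) :
    ContMDiff (𝓡 d) (𝓡 n) ∞ (fun x : G => ((a * x : G) : G ⧸ H)) :=
  hM.contMDiff.comp (contMDiff_mul_left (I := 𝓡 d) (n := ∞) (a := a))

include hM in
lemma lieProj_surjective (a : G) : Function.Surjective (lieProj (d := d) (n := n) H a) := by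
  have h1 : lieProj (d := d) (n := n) H a = (tderiv (n := d) (n' := n) (fun x : G => (x : G ⧸ H)) a).comp
      (tderiv (n := d) (n' := d) (fun x : G => a * x) 1) :=
    tderiv_comp (mul_one a) (hM.contMDiff.mdifferentiableAt (by simp)) (mdiff_mul_left a 1)
  have h2 : (tderiv (n := d) (n' := d) (fun x : G => a * x) 1).comp
      (tderiv (n := d) (n' := d) (fun x : G => a⁻¹ * x) a) = ContinuousLinearMap.id ℝ _ := by
    rw [← tderiv_comp (inv_mul_cancel a) (mdiff_mul_left a 1) (mdiff_mul_left a⁻¹ a),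
      ← tderiv_id a]
    exact tderiv_congr (Eventually.of_forall fun x => by simp)
  intro y
  obtain ⟨v, hv⟩ : ∃ v : EuclideanSpace ℝ (Fin d),
      tderiv (n := d) (n' := n) (fun x : G => (x : G ⧸ H)) a v = y := hM.surjective a y
  refine ⟨tderiv (n := d) (n' := d) (fun x : G => a⁻¹ * x) a v, ?_⟩
  rw [h1, ContinuousLinearMap.comp_apply, ← ContinuousLinearMap.comp_apply
    (tderiv (n := d) (n' := d) (fun x : G => a * x) 1), h2]
  exact hv

variable [IsManifold (𝓡 n) ∞ (G ⧸ H)]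

include hM in
lemma eventually_contDiffAt_projChart (a : G) :
    ∀ᶠ p in 𝓝 (unitChart d G), ContDiffAt ℝ ∞ (projChart (n := n) H a) p := by
  refine eventually_contDiffAt_chart (by rw [ofChart_unitChart, mul_one]) ?_
  filter_upwards [eventually_contMDiffAt_ofChart (d := d) (G := G)] with p hp
  exact (contMDiff_proj hM a).contMDiffAt.comp p hp

include hM in
lemma fderiv_projChart (a : G) :
    fderiv ℝ (projChart (n := n) H a) (unitChart d G) = lieProj H a :=
  (tderiv_eq (by rw [mul_one]) ((contMDiff_proj hM a).mdifferentiableAt (by simp))).symm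

lemma projChart_unit (a : G) :
    projChart (d := d) (n := n) H a (unitChart d G) = extChartAt (𝓡 n) (a : G ⧸ H) (a : G ⧸ H) := by
  rw [projChart, ofChart_unitChart, mul_one]

/-- Curves with constant projection to `G ⧸ H` have velocity in the isotropy algebra. -/
lemma HasVelocity.mem_isotropyAlgebra (hM : IsHomogeneousStructure d n H) {c : ℝ → G}
    {W : GroupLieAlgebra (𝓡 d) G} {t : ℝ} (h : HasVelocity c W t) (hc : ∀ᶠ s in 𝓝 t, c s ∈ H) :
    W ∈ isotropyAlgebra d n H := by
  rw [HomRicci.mem_isotropyAlgebra, ← fderiv_projChart hM]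
  have h1 : HasFDerivAt (projChart (n := n) H (1 : G)) (fderiv ℝ (projChart (n := n) H 1)
      (unitChart d G)) (extChartAt (𝓡 d) (1 : G) (c t)) := by
    rw [h.one]
    exact ((eventually_contDiffAt_projChart hM 1).self_of_nhds.differentiableAt
      (by simp)).hasFDerivAt
  refine (h1.comp_hasDerivAt t h.deriv).unique ((hasDerivAt_const t
    (extChartAt (𝓡 n) ((1 : G) : G ⧸ H) ((1 : G) : G ⧸ H))).congr_of_eventuallyEq ?_)
  have h2 : ∀ᶠ a in 𝓝 (c t), ofChart d G (extChartAt (𝓡 d) (1 : G) a) = a := by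
    rw [h.one]; exact eventually_ofChart_chart
  filter_upwards [h.cont.eventually h2, hc] with s h3 h4
  have h5 : ((c s : G) : G ⧸ H) = ((1 : G) : G ⧸ H) := by
    rw [QuotientGroup.eq]; simpa using h4
  rw [Function.comp_apply, projChart, h3, one_mul, h5]

/-- Coordinates `Θ` of `G` around `1`, in which `H` is a linear subspace. -/
lemma exists_subgroup_chart (hM : IsHomogeneousStructure d n H) :
    ∃ Θ Ψ : EuclideanSpace ℝ (Fin d) → EuclideanSpace ℝ (Fin d), Θ 0 = unitChart d G ∧
      HasFDerivAt Θ (ContinuousLinearMap.id ℝ _) 0 ∧ Tendsto Ψ (𝓝 (unitChart d G)) (𝓝 0) ∧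
      (∀ᶠ w in 𝓝 0, ContMDiffAt 𝓘(ℝ, EuclideanSpace ℝ (Fin d)) (𝓡 d) ∞
        (fun w => ofChart d G (Θ w)) w) ∧
      (∀ᶠ w in 𝓝 0, lieProj (n := n) H 1 w = 0 → ofChart d G (Θ w) ∈ H) ∧
      ∀ᶠ p in 𝓝 (unitChart d G), Θ (Ψ p) = p ∧
        (ofChart d G p ∈ H → lieProj (n := n) H 1 (Ψ p) = 0) := by
  obtain ⟨Θ, Ψ, h0, hsm, hd, hP, hΨc, hΨ0, hinv⟩ :=
    exists_submersion_chart (eventually_contDiffAt_projChart hM (1 : G))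
      (by rw [fderiv_projChart hM]; exact lieProj_surjective hM 1)
  rw [fderiv_projChart hM] at hP hinv
  have hΘ : Tendsto Θ (𝓝 0) (𝓝 (unitChart d G)) := by
    have := hd.continuousAt.tendsto
    rwa [h0] at this
  refine ⟨Θ, Ψ, h0, hd, by simpa [hΨ0] using hΨc.tendsto, ?_, ?_, ?_⟩
  · filter_upwards [hsm, hΘ.eventually (eventually_contMDiffAt_ofChart (d := d) (G := G))]
      with w h1 h2
    exact h2.comp w h1.contMDiffAt
  · have h1 : Tendsto (fun w => ((1 * ofChart d G (Θ w) : G) : G ⧸ H)) (𝓝 0)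
        (𝓝 ((1 : G) : G ⧸ H)) := by
      have h2 := ((contMDiff_proj hM 1).continuous.tendsto 1).comp
        ((continuousAt_ofChart (d := d) (G := G)).tendsto.comp hΘ |>.trans
          (by rw [ofChart_unitChart]))
      simpa [Function.comp_def] using h2
    filter_upwards [hP, h1.eventually (extChartAt_source_mem_nhds (I := 𝓡 n) ((1 : G) : G ⧸ H))]
      with w h2 h3 h4
    rw [h4, add_zero, projChart_unit, projChart] at h2
    have h5 := (extChartAt (𝓡 n) ((1 : G) : G ⧸ H)).injOn h3 (mem_extChartAt_source _) h2
    rw [eq_comm, QuotientGroup.eq] at h5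
    simpa using h5
  · filter_upwards [hinv] with p hp
    refine ⟨hp.1, fun h1 => ?_⟩
    have h5 : ((1 * ofChart d G p : G) : G ⧸ H) = ((1 : G) : G ⧸ H) := by
      rw [one_mul, eq_comm, QuotientGroup.eq]; simpa using h1
    rw [hp.2, projChart_unit, projChart, h5, sub_self]

/-- Every element of the isotropy algebra is the velocity of a curve in `H`. -/
lemma exists_hasVelocity_mem (hM : IsHomogeneousStructure d n H) {W : GroupLieAlgebra (𝓡 d) G}
    (hW : W ∈ isotropyAlgebra d n H) :
    ∃ c : ℝ → G, HasVelocity c W 0 ∧ ∀ᶠ t in 𝓝 0, c t ∈ H := by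
  obtain ⟨Θ, -, h0, hd, -, -, hH, -⟩ := exists_subgroup_chart hM
  rw [mem_isotropyAlgebra] at hW
  set v : EuclideanSpace ℝ (Fin d) := W with hv
  have hl : Tendsto (fun t : ℝ => t • v) (𝓝 0) (𝓝 0) := by
    have : ContinuousAt (fun t : ℝ => t • v) 0 := by fun_prop
    simpa using this.tendsto
  have h1 : HasDerivAt (fun t : ℝ => Θ (t • v)) v 0 := by
    have h2 : HasDerivAt (fun t : ℝ => t • v) v 0 := by
      simpa using (hasDerivAt_id (0 : ℝ)).smul_const v
    have h3 : HasFDerivAt Θ (ContinuousLinearMap.id ℝ (EuclideanSpace ℝ (Fin d)))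
      ((0 : ℝ) • v) := by rwa [zero_smul]
    exact h3.comp_hasDerivAt 0 h2
  have h2 : Tendsto (fun t : ℝ => Θ (t • v)) (𝓝 0) (𝓝 (unitChart d G)) := by
    have := h1.continuousAt.tendsto
    rwa [zero_smul, h0] at this
  refine ⟨fun t => ofChart d G (Θ (t • v)), ⟨?_, ?_, ?_⟩, ?_⟩
  · rw [zero_smul, h0, ofChart_unitChart]
  · refine ContinuousAt.comp (g := ofChart d G) ?_ h1.continuousAt
    rw [zero_smul, h0]; exact continuousAt_ofChart
  · exact h1.congr_of_eventuallyEq (h2.eventually eventually_chart_ofChart)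
  · filter_upwards [hl.eventually hH] with t ht
    refine ht ?_
    rw [map_smul]
    exact (congrArg (t • ·) hW).trans (smul_zero t)

/-- Conjugation by `a` acts on velocities by `Ad a`. -/
lemma HasVelocity.conj {c : ℝ → G} {W : GroupLieAlgebra (𝓡 d) G} {t : ℝ} (h : HasVelocity c W t)
    (a : G) : HasVelocity (fun s => a * c s * a⁻¹) (Ad d a W) t := by
  have hm := mdiff_conj (d := d) a (1 : G)
  refine ⟨by rw [h.one]; simp, ?_, ?_⟩
  · refine ContinuousAt.comp (g := fun x : G => a * x * a⁻¹) ?_ h.cont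
    exact (contMDiff_conj (d := d) a).continuous.continuousAt
  · have h1 : HasFDerivAt (fun z => extChartAt (𝓡 d) (1 : G) (a * ofChart d G z * a⁻¹))
        (AdL (d := d) a) (extChartAt (𝓡 d) (1 : G) (c t)) := by
      rw [h.one, AdL, tderiv_eq (y := (1 : G)) (by simp) hm]
      refine DifferentiableAt.hasFDerivAt ?_
      refine MDifferentiableAt.differentiableAt ?_
      refine MDifferentiableAt.comp (I' := 𝓡 d) (g := extChartAt (𝓡 d) (1 : G))
        (extChartAt (𝓡 d) (1 : G) (1 : G)) ?_ ?_
      · have e : a * ofChart d G (extChartAt (𝓡 d) (1 : G) (1 : G)) * a⁻¹ = 1 := by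
          rw [show ofChart d G (extChartAt (𝓡 d) (1 : G) (1 : G)) = 1 from ofChart_unitChart]
          simp
        rw [e]
        exact mdiffAt_chart (mem_extChartAt_source _)
      · exact MDifferentiableAt.comp (I' := 𝓡 d) (g := fun x : G => a * x * a⁻¹)
          (f := ofChart d G) (extChartAt (𝓡 d) (1 : G) (1 : G)) (mdiff_conj (d := d) a _)
          (mdiffAt_chart_symm (mem_extChartAt_target _))
    refine (h1.comp_hasDerivAt t h.deriv).congr_of_eventuallyEq ?_
    have h2 : ∀ᶠ a in 𝓝 (c t), ofChart d G (extChartAt (𝓡 d) (1 : G) a) = a := by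
      rw [h.one]; exact eventually_ofChart_chart
    filter_upwards [h.cont.eventually h2] with s hs
    rw [Function.comp_apply, hs]

/-- Conjugates of curves in `H` by elements of `H` are curves in `H`. -/
lemma Ad_mem_isotropyAlgebra (hM : IsHomogeneousStructure d n H) {a : G} (ha : a ∈ H)
    {W : GroupLieAlgebra (𝓡 d) G} (hW : W ∈ isotropyAlgebra d n H) :
    Ad d a W ∈ isotropyAlgebra d n H := by
  obtain ⟨c, hc, hcH⟩ := exists_hasVelocity_mem hM hW
  refine (hc.conj a).mem_isotropyAlgebra hM ?_
  filter_upwards [hcH] with s hs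
  exact H.mul_mem (H.mul_mem ha hs) (H.inv_mem ha)

/-- `⁅X, Y⁆` is the derivative of `Ad (c t) Y`, which stays in the isotropy algebra, along a curve `c`
in `H` with velocity `X`. -/
lemma lie_mem_isotropyAlgebra (hM : IsHomogeneousStructure d n H) {X Y : GroupLieAlgebra (𝓡 d) G}
    (hX : X ∈ isotropyAlgebra d n H) (hY : Y ∈ isotropyAlgebra d n H) :
    ⁅X, Y⁆ ∈ isotropyAlgebra d n H := by
  obtain ⟨c, hc, hcH⟩ := exists_hasVelocity_mem hM hX
  have h1 := hasDerivAt_AdL hc.cont hc.one hc.deriv Y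
  have h2 := (lieProj (n := n) H (1 : G)).hasFDerivAt.comp_hasDerivAt 0 h1
  rw [mem_isotropyAlgebra]
  refine h2.unique ((hasDerivAt_const (0 : ℝ)
    (0 : EuclideanSpace ℝ (Fin n))).congr_of_eventuallyEq ?_)
  filter_upwards [hcH] with t ht
  exact (mem_isotropyAlgebra H).1 (Ad_mem_isotropyAlgebra hM ht hY)

/-- Forms which are invariant under the isotropy algebra are invariant under elements of `H` close
to `1`: join such an element to `1` by a curve in `H`. -/
lemma eventually_form_Ad (hM : IsHomogeneousStructure d n H)
    {φ : LinearMap.BilinForm ℝ (GroupLieAlgebra (𝓡 d) G)}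
    (hφ : IsAdInvariant (isotropyAlgebra d n H) φ) :
    ∀ᶠ a in 𝓝 (1 : G), a ∈ H → ∀ X Y, φ (Ad d a X) (Ad d a Y) = φ X Y := by
  obtain ⟨Θ, Ψ, h0, -, hΨ, hsm, hH, hinv⟩ := exists_subgroup_chart hM
  obtain ⟨r, hr, hball⟩ := Metric.eventually_nhds_iff_ball.1 (hsm.and hH)
  have hchart : Tendsto (extChartAt (𝓡 d) (1 : G)) (𝓝 1) (𝓝 (unitChart d G)) :=
    continuousAt_extChartAt (I := 𝓡 d) (1 : G)
  filter_upwards [eventually_ofChart_chart (d := d) (G := G), hchart.eventually hinv,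
    (hΨ.comp hchart).eventually (Metric.ball_mem_nhds 0 hr)] with a h1 h2 h3 ha X Y
  set w := Ψ (extChartAt (𝓡 d) (1 : G) a) with hw
  have hw0 : lieProj (n := n) H 1 w = 0 := h2.2 (by rwa [h1])
  set γ : ℝ → G := fun t => ofChart d G (Θ (t • w)) with hγ
  have hγ0 : γ 0 = 1 := by simp only [hγ, zero_smul, h0, ofChart_unitChart]
  have hγ1 : γ 1 = a := by simp only [hγ, one_smul, h2.1, h1]
  have hb : ∀ t ∈ Set.Icc (0 : ℝ) 1, t • w ∈ Metric.ball (0 : EuclideanSpace ℝ (Fin d)) r := by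
    intro t ht
    have h4 : ‖w‖ < r := mem_ball_zero_iff.1 h3
    rw [mem_ball_zero_iff, norm_smul, Real.norm_of_nonneg ht.1]
    nlinarith [norm_nonneg w, ht.1, ht.2]
  have hγH : ∀ t, t • w ∈ Metric.ball (0 : EuclideanSpace ℝ (Fin d)) r → γ t ∈ H := by
    intro t ht
    exact (hball _ ht).2 (by rw [map_smul, hw0, smul_zero])
  have hder : ∀ t ∈ Set.Icc (0 : ℝ) 1,
      HasDerivAt (fun s => φ (Ad d (γ s) X) (Ad d (γ s) Y)) 0 t := by
    intro t ht
    -- `c` passes through `1` at time `t` and lies in `H`, so its velocity `W` belongs to the isotropy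
    -- algebra, and `ad W` preserves `φ`
    set c : ℝ → G := fun s => γ s * (γ t)⁻¹ with hc
    have hlin : ContDiff ℝ ∞ (fun s : ℝ => s • w) := contDiff_id.smul contDiff_const
    have hγs : ContMDiffAt 𝓘(ℝ, ℝ) (𝓡 d) ∞ γ t :=
      ContMDiffAt.comp (f := fun s : ℝ => s • w) t (hball _ (hb t ht)).1 hlin.contMDiff.contMDiffAt
    have hcs : ContMDiffAt 𝓘(ℝ, ℝ) (𝓡 d) ∞ c t := hγs.mul contMDiffAt_const
    have hc1 : c t = 1 := mul_inv_cancel _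
    have hd : DifferentiableAt ℝ (fun s => extChartAt (𝓡 d) (1 : G) (c s)) t := by
      have h5 : ContMDiffAt (𝓡 d) (𝓡 d) ∞ (extChartAt (𝓡 d) (1 : G)) (c t) := by
        rw [hc1]; exact contMDiffAt_chart (mem_extChartAt_source _)
      exact (contMDiffAt_iff_contDiffAt.1 (h5.comp t hcs)).differentiableAt (by simp)
    set W : EuclideanSpace ℝ (Fin d) := deriv (fun s => extChartAt (𝓡 d) (1 : G) (c s)) t
    have hv : HasVelocity c W t := ⟨hc1, hcs.continuousAt, hd.hasDerivAt⟩
    have hcH : ∀ᶠ s in 𝓝 t, c s ∈ H := by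
      have h6 : ∀ᶠ s in 𝓝 t, s • w ∈ Metric.ball (0 : EuclideanSpace ℝ (Fin d)) r :=
        hlin.continuous.continuousAt.eventually (Metric.isOpen_ball.mem_nhds (hb t ht))
      filter_upwards [h6] with s hs
      exact H.mul_mem (hγH s hs) (H.inv_mem (hγH t (hb t ht)))
    have h7 := hv.hasDerivAt_form φ (Ad d (γ t) X) (Ad d (γ t) Y)
    rw [hφ W (hv.mem_isotropyAlgebra hM hcH)] at h7
    refine h7.congr_of_eventuallyEq (Eventually.of_forall fun s => ?_)
    have h8 : ∀ Z : GroupLieAlgebra (𝓡 d) G, Ad d (γ s) Z = Ad d (c s) (Ad d (γ t) Z) := fun Z => by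
      have h9 : γ s = c s * γ t := by simp [hc]
      conv_lhs => rw [h9]
      exact DFunLike.congr_fun (AdL_mul (c s) (γ t)) Z
    simp only [h8]
  have key := constant_of_derivWithin_zero (f := fun s => φ (Ad d (γ s) X) (Ad d (γ s) Y))
    (a := 0) (b := 1) (fun t ht => (hder t ht).differentiableAt.differentiableWithinAt)
    (fun t ht => by
      have h9 : t ∈ Set.Icc (0 : ℝ) 1 := ⟨ht.1, ht.2.le⟩
      exact (hder t h9).hasDerivWithinAt.derivWithin (uniqueDiffOn_Icc zero_lt_one t h9))
    1 ⟨zero_le_one, le_rfl⟩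
  have h10 : ∀ Z : GroupLieAlgebra (𝓡 d) G, Ad d (1 : G) Z = Z := fun Z =>
    DFunLike.congr_fun (AdL_one (d := d) (G := G)) Z
  simpa only [hγ0, hγ1, h10] using key

/-- For connected `H`, invariance of forms under `Ad H` is the same as invariance under the isotropy
algebra. -/
theorem isAdapted_Ad (hM : IsHomogeneousStructure d n H) (hH : IsConnected (H : Set G)) :
    IsAdapted (fun a : H => Ad d (a : G)) (isotropyAlgebra d n H) where
  lin a := ⟨(AdL (d := d) (a : G)).toLinearMap, fun x => rfl⟩
  form φ := by
    have mul : ∀ (a b : G) (Z : GroupLieAlgebra (𝓡 d) G), Ad d (a * b) Z = Ad d a (Ad d b Z) :=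
      fun a b Z => DFunLike.congr_fun (AdL_mul a b) Z
    have one : ∀ Z : GroupLieAlgebra (𝓡 d) G, Ad d (1 : G) Z = Z := fun Z =>
      DFunLike.congr_fun (AdL_one (d := d) (G := G)) Z
    constructor
    · intro hφ
      have : IsTopologicalGroup G := topologicalGroup_of_lieGroup (𝓡 d) ∞
      have : ConnectedSpace H := isConnected_iff_connectedSpace.1 hH
      -- the stabilizer of `φ` is an open subgroup of the connected group `H`
      let S : Subgroup H :=
        { carrier := {a | ∀ X Y, φ (Ad d (a : G) X) (Ad d (a : G) Y) = φ X Y}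
          mul_mem' := fun {a b} ha hb X Y => by
            rw [Subgroup.coe_mul, mul, mul, ha, hb]
          one_mem' := fun X Y => by rw [Subgroup.coe_one, one, one]
          inv_mem' := fun {a} ha X Y => by
            rw [← ha, ← mul, ← mul, Subgroup.coe_inv, mul_inv_cancel, one, one] }
      have h1 : (S : Set H) ∈ 𝓝 (1 : H) := by
        have h2 : Tendsto (Subtype.val : H → G) (𝓝 1) (𝓝 (1 : G)) :=
          continuous_subtype_val.tendsto (1 : H)
        filter_upwards [h2.eventually (eventually_form_Ad hM hφ)] with a ha
        exact ha a.2
      have h2 : IsOpen (S : Set H) := Subgroup.isOpen_of_mem_nhds S h1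
      have h3 : (S : Set H) = Set.univ :=
        IsClopen.eq_univ ⟨S.isClosed_of_isOpen h2, h2⟩ ⟨1, S.one_mem⟩
      intro a
      exact (h3 ▸ Set.mem_univ a : a ∈ (S : Set H))
    · intro hφ W hW X Y
      obtain ⟨c, hc, hcH⟩ := exists_hasVelocity_mem hM hW
      refine (hc.hasDerivAt_form φ X Y).unique
        ((hasDerivAt_const (0 : ℝ) (φ X Y)).congr_of_eventuallyEq ?_)
      filter_upwards [hcH] with t ht
      exact hφ ⟨c t, ht⟩ X Y

lemma isReductivePair_inducedForm (hM : IsHomogeneousStructure d n H) {q : SmoothMetric d G}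
    (hq : IsBiinvariant q) : IsReductivePair (inducedForm q) (isotropyAlgebra d n H) where
  symm X Y := q.symm 1 X Y
  pos X hX := q.pos 1 X hX
  skew := inducedForm_skew hq
  lie_mem _ hX _ hY := lie_mem_isotropyAlgebra hM hX hY

end Projection

/-! ### The action on the homogeneous space in charts -/

section Action

variable {d n : ℕ} {G : Type*} [TopologicalSpace G] [ChartedSpace (EuclideanSpace ℝ (Fin d)) G]
  [Group G] [LieGroup (𝓡 d) ∞ G] {H : Subgroup G} [ChartedSpace (EuclideanSpace ℝ (Fin n)) (G ⧸ H)]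
  [IsManifold (𝓡 n) ∞ (G ⧸ H)]

/-- Smooth local sections of the projection `x ↦ a x H`. -/
lemma exists_section (hM : IsHomogeneousStructure d n H) (a : G) :
    ∃ σ : EuclideanSpace ℝ (Fin n) → EuclideanSpace ℝ (Fin d),
      σ (extChartAt (𝓡 n) (a : G ⧸ H) (a : G ⧸ H)) = unitChart d G ∧
      (∀ᶠ y in 𝓝 (extChartAt (𝓡 n) (a : G ⧸ H) (a : G ⧸ H)), ContDiffAt ℝ ∞ σ y) ∧
      ∀ᶠ y in 𝓝 (extChartAt (𝓡 n) (a : G ⧸ H) (a : G ⧸ H)),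
        (extChartAt (𝓡 n) (a : G ⧸ H)).symm y = ((a * ofChart d G (σ y) : G) : G ⧸ H) := by
  obtain ⟨Θ, -, h0, hsm, -, hP, -, -, -⟩ :=
    exists_submersion_chart (eventually_contDiffAt_projChart hM a)
      (by rw [fderiv_projChart hM]; exact lieProj_surjective hM a)
  rw [fderiv_projChart hM] at hP
  obtain ⟨s', hs'⟩ := (lieProj (d := d) (n := n) H a).toLinearMap.exists_rightInverse_of_surjective
    (LinearMap.range_eq_top.2 (lieProj_surjective hM a))
  set s := LinearMap.toContinuousLinearMap s' with hsdef
  have hDs : ∀ y, lieProj H a (s y) = y := fun y => DFunLike.congr_fun hs' y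
  set y₀ := extChartAt (𝓡 n) (a : G ⧸ H) (a : G ⧸ H) with hy₀
  have hl : ContDiff ℝ ∞ (fun y => s (y - y₀)) :=
    s.contDiff.comp (contDiff_id.sub contDiff_const)
  have ht : Tendsto (fun y => s (y - y₀)) (𝓝 y₀) (𝓝 0) := by
    simpa using hl.continuous.tendsto y₀
  have h1 : (fun y => Θ (s (y - y₀))) y₀ = unitChart d G := by simp [h0]
  have c1 : ∀ᶠ y in 𝓝 y₀, ContDiffAt ℝ ∞ (fun y => Θ (s (y - y₀))) y := by
    filter_upwards [ht.eventually hsm] with y hy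
    exact hy.comp y hl.contDiffAt
  refine ⟨fun y => Θ (s (y - y₀)), h1, c1, ?_⟩
  have h2 : Tendsto (fun y => ((a * ofChart d G (Θ (s (y - y₀))) : G) : G ⧸ H)) (𝓝 y₀)
      (𝓝 ((a : G) : G ⧸ H)) := by
    have h3 := c1.self_of_nhds.continuousAt.tendsto
    rw [show Θ (s (y₀ - y₀)) = unitChart d G from h1] at h3
    have h4 := ((contMDiff_proj hM a).continuous.tendsto 1).comp
      ((continuousAt_ofChart (d := d) (G := G)).tendsto.comp h3 |>.trans
        (by rw [ofChart_unitChart]))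
    simpa [Function.comp_def] using h4
  filter_upwards [ht.eventually hP, h2.eventually (extChartAt_source_mem_nhds (I := 𝓡 n) _)]
    with y h3 h4
  rw [hDs, projChart_unit, ← hy₀, add_sub_cancel, projChart] at h3
  conv_lhs => rw [← h3]
  exact (extChartAt (𝓡 n) (a : G ⧸ H)).left_inv h4

/-- The action is smooth: on a smooth local section, it is multiplication in `G` followed by the
projection. -/
lemma contMDiff_smul_quotient (hM : IsHomogeneousStructure d n H) (b : G) :
    ContMDiff (𝓡 n) (𝓡 n) ∞ (fun x : G ⧸ H => b • x) := by
  intro x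
  obtain ⟨a, rfl⟩ := QuotientGroup.mk_surjective x
  obtain ⟨σ, h0, hsm, hσ⟩ := exists_section hM a
  have hc : ContMDiffAt (𝓡 n) (𝓡 n) ∞ (extChartAt (𝓡 n) (a : G ⧸ H)) (a : G ⧸ H) :=
    contMDiffAt_chart (mem_extChartAt_source _)
  have h1 : ContMDiffAt (𝓡 n) (𝓡 d) ∞
      (fun x => ofChart d G (σ (extChartAt (𝓡 n) (a : G ⧸ H) x))) (a : G ⧸ H) := by
    refine ContMDiffAt.comp (I' := 𝓡 d) (g := ofChart d G) _ ?_
      (ContMDiffAt.comp (I' := 𝓡 n) (g := σ) _ hsm.self_of_nhds.contMDiffAt hc)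
    rw [h0]
    exact eventually_contMDiffAt_ofChart.self_of_nhds
  refine ((contMDiff_proj hM (b * a)).contMDiffAt.comp _ h1).congr_of_eventuallyEq ?_
  filter_upwards [hc.continuousAt.eventually hσ, extChartAt_source_mem_nhds (I := 𝓡 n) (a : G ⧸ H)]
    with x h2 h3
  rw [(extChartAt (𝓡 n) (a : G ⧸ H)).left_inv h3] at h2
  conv_lhs => rw [h2]
  rw [Function.comp_apply, mul_assoc]
  rfl

lemma mdiff_smul (hM : IsHomogeneousStructure d n H) (b : G) (x : G ⧸ H) :
    MDifferentiableAt (𝓡 n) (𝓡 n) (fun x : G ⧸ H => b • x) x :=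
  (contMDiff_smul_quotient hM b).mdifferentiableAt (by simp)

/-- The derivative of the action of `b` at `a H`. -/
lemma lieProj_mul (hM : IsHomogeneousStructure d n H) (b a : G) :
    lieProj (d := d) (n := n) H (b * a) = (tderiv (n := n) (n' := n) (fun x : G ⧸ H => b • x)
      (a : G ⧸ H)).comp (lieProj H a) :=
  (tderiv_congr (Eventually.of_forall fun x => by rw [mul_assoc]; rfl)).trans
    (tderiv_comp (g := fun x : G ⧸ H => b • x) (f := fun x : G => ((a * x : G) : G ⧸ H))
      (x := (1 : G)) (by rw [mul_one]) (mdiff_smul hM b _)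
      ((contMDiff_proj hM a).mdifferentiableAt (by simp)))

/-- For `h ∈ H` the maps `x ↦ a (h x h⁻¹) H` and `x ↦ a h x H` agree. -/
lemma lieProj_comp_AdL (hM : IsHomogeneousStructure d n H) (a : G) {h : G} (hh : h ∈ H) :
    (lieProj (d := d) (n := n) H a).comp (AdL (d := d) h) = lieProj H (a * h) := by
  refine (tderiv_comp (g := fun x : G => ((a * x : G) : G ⧸ H))
    (f := fun x : G => h * x * h⁻¹) (x := (1 : G)) (by simp)
    ((contMDiff_proj hM a).mdifferentiableAt (by simp)) (mdiff_conj h 1)).symm.trans ?_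
  refine tderiv_congr (Eventually.of_forall fun x => ?_)
  rw [eq_comm, QuotientGroup.eq]
  simpa [mul_assoc] using hh

lemma lieProj_eq_zero_iff (hM : IsHomogeneousStructure d n H) (a : G)
    {X : GroupLieAlgebra (𝓡 d) G} : lieProj (n := n) H a X = 0 ↔ X ∈ isotropyAlgebra d n H := by
  have h1 : ∀ (b a : G) (Z : EuclideanSpace ℝ (Fin d)), lieProj (n := n) H a Z = 0 →
      lieProj (n := n) H (b * a) Z = 0 := by
    intro b a Z hZ
    rw [lieProj_mul hM, ContinuousLinearMap.comp_apply, hZ, map_zero]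
  rw [mem_isotropyAlgebra]
  constructor
  · intro h
    have h2 := h1 a⁻¹ a X h
    rwa [inv_mul_cancel] at h2
  · intro h
    have h2 := h1 a 1 X h
    rwa [mul_one] at h2

/-- The element `a p a⁻¹` of `G`, where `p` is given in coordinates. -/
def conjPoint (a : G) (p : EuclideanSpace ℝ (Fin d)) : G := a * ofChart d G p * a⁻¹

variable (H) in
/-- The action of `G` on `G ⧸ H` near `a H` in coordinates; `G` is identified with its conjugate
under `a`. -/
def actChart (a : G) (z : EuclideanSpace ℝ (Fin d) × EuclideanSpace ℝ (Fin n)) :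
    EuclideanSpace ℝ (Fin n) :=
  extChartAt (𝓡 n) (a : G ⧸ H) (conjPoint a z.1 • (extChartAt (𝓡 n) (a : G ⧸ H)).symm z.2)

/-- The action near `a H` coincides, in coordinates, with a smooth map `f`, which is built from a local
section of the projection. -/
lemma eventually_smul_eq (hM : IsHomogeneousStructure d n H) (a : G) :
    ∃ f : EuclideanSpace ℝ (Fin d) × EuclideanSpace ℝ (Fin n) → G ⧸ H,
      f (unitChart d G, extChartAt (𝓡 n) (a : G ⧸ H) (a : G ⧸ H)) = (a : G ⧸ H) ∧
      (∀ᶠ z in 𝓝 (unitChart d G, extChartAt (𝓡 n) (a : G ⧸ H) (a : G ⧸ H)),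
        ContMDiffAt 𝓘(ℝ, EuclideanSpace ℝ (Fin d) × EuclideanSpace ℝ (Fin n)) (𝓡 n) ∞ f z) ∧
      ∀ᶠ z in 𝓝 (unitChart d G, extChartAt (𝓡 n) (a : G ⧸ H) (a : G ⧸ H)),
        conjPoint a z.1 • (extChartAt (𝓡 n) (a : G ⧸ H)).symm z.2 = f z := by
  obtain ⟨σ, h0, hsm, hσ⟩ := exists_section hM a
  refine ⟨fun z => ((a * (ofChart d G z.1 * ofChart d G (σ z.2)) : G) : G ⧸ H), ?_, ?_, ?_⟩
  · simp only [h0, ofChart_unitChart, mul_one]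
  · have h1 : ∀ᶠ y in 𝓝 (extChartAt (𝓡 n) (a : G ⧸ H) (a : G ⧸ H)),
        ContMDiffAt (𝓡 n) (𝓡 d) ∞ (fun y => ofChart d G (σ y)) y := by
      have h2 : Tendsto σ (𝓝 (extChartAt (𝓡 n) (a : G ⧸ H) (a : G ⧸ H))) (𝓝 (unitChart d G)) := by
        have := hsm.self_of_nhds.continuousAt.tendsto
        rwa [h0] at this
      filter_upwards [hsm, h2.eventually (eventually_contMDiffAt_ofChart (d := d) (G := G))]
        with y h3 h4
      exact h4.comp y h3.contMDiffAt
    filter_upwards [eventually_contMDiffAt_fst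
        (x := (unitChart d G, extChartAt (𝓡 n) (a : G ⧸ H) (a : G ⧸ H)))
        (eventually_contMDiffAt_ofChart (d := d) (G := G)),
      eventually_contMDiffAt_snd
        (x := (unitChart d G, extChartAt (𝓡 n) (a : G ⧸ H) (a : G ⧸ H))) h1] with z h3 h4
    exact (contMDiff_proj hM a).contMDiffAt.comp z (h3.mul h4)
  · filter_upwards [(continuous_snd.tendsto
      (unitChart d G, extChartAt (𝓡 n) (a : G ⧸ H) (a : G ⧸ H))).eventually hσ] with z hz
    rw [hz, conjPoint, MulAction.Quotient.smul_coe]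
    congr 1
    simp only [smul_eq_mul, mul_assoc, inv_mul_cancel_left]

lemma tendsto_smul (hM : IsHomogeneousStructure d n H) (a : G) :
    Tendsto (fun z : EuclideanSpace ℝ (Fin d) × EuclideanSpace ℝ (Fin n) =>
      conjPoint a z.1 • (extChartAt (𝓡 n) (a : G ⧸ H)).symm z.2)
      (𝓝 (unitChart d G, extChartAt (𝓡 n) (a : G ⧸ H) (a : G ⧸ H))) (𝓝 (a : G ⧸ H)) := by
  obtain ⟨f, h0, hf, he⟩ := eventually_smul_eq hM a
  have h := hf.self_of_nhds.continuousAt.tendsto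
  rw [h0] at h
  exact h.congr' (he.mono fun z hz => hz.symm)

lemma eventually_symm_actChart (hM : IsHomogeneousStructure d n H) (a : G) :
    ∀ᶠ z in 𝓝 (unitChart d G, extChartAt (𝓡 n) (a : G ⧸ H) (a : G ⧸ H)),
      actChart H a z ∈ (extChartAt (𝓡 n) (a : G ⧸ H)).target ∧
      (extChartAt (𝓡 n) (a : G ⧸ H)).symm (actChart H a z)
        = conjPoint a z.1 • (extChartAt (𝓡 n) (a : G ⧸ H)).symm z.2 := by
  filter_upwards [(tendsto_smul hM a).eventually (extChartAt_source_mem_nhds (I := 𝓡 n) _)]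
    with z hz
  exact ⟨(extChartAt (𝓡 n) (a : G ⧸ H)).map_source hz,
    (extChartAt (𝓡 n) (a : G ⧸ H)).left_inv hz⟩

lemma conjPoint_unit (a : G) : conjPoint a (unitChart d G) = a * a⁻¹ := by
  rw [conjPoint, ofChart_unitChart, mul_one]

lemma isActionGerm_actChart (hM : IsHomogeneousStructure d n H) (a : G) :
    IsActionGerm (mulChart d G) (unitChart d G) (actChart (n := n) H a)
      (extChartAt (𝓡 n) (a : G ⧸ H) (a : G ⧸ H)) where
  smooth := by
    obtain ⟨f, h0, hf, he⟩ := eventually_smul_eq hM a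
    filter_upwards [eventually_contDiffAt_chart h0 hf, he.eventually_nhds] with z h1 h2
    exact h1.congr_of_eventuallyEq (h2.mono fun w hw => by rw [actChart, hw])
  unit := by
    filter_upwards [extChartAt_target_mem_nhds (I := 𝓡 n) (a : G ⧸ H)] with y hy
    rw [actChart, conjPoint_unit, mul_inv_cancel, one_smul]
    exact (extChartAt (𝓡 n) (a : G ⧸ H)).right_inv hy
  act := by
    set y₀ := extChartAt (𝓡 n) (a : G ⧸ H) (a : G ⧸ H) with hy₀
    have c1 : Tendsto (fun z : EuclideanSpace ℝ (Fin d) × EuclideanSpace ℝ (Fin d) ×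
        EuclideanSpace ℝ (Fin n) => (z.1, z.2.1)) (𝓝 (unitChart d G, unitChart d G, y₀))
        (𝓝 (unitChart d G, unitChart d G)) :=
      Continuous.tendsto (by fun_prop) (unitChart d G, unitChart d G, y₀)
    have c2 : Tendsto (fun z : EuclideanSpace ℝ (Fin d) × EuclideanSpace ℝ (Fin d) ×
        EuclideanSpace ℝ (Fin n) => z.2) (𝓝 (unitChart d G, unitChart d G, y₀))
        (𝓝 (unitChart d G, y₀)) :=
      Continuous.tendsto (by fun_prop) (unitChart d G, unitChart d G, y₀)
    filter_upwards [c1.eventually eventually_ofChart_mulChart,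
      c2.eventually (eventually_symm_actChart hM a)] with z h1 h2
    have e1 : actChart H a (mulChart d G (z.1, z.2.1), z.2.2) = extChartAt (𝓡 n) (a : G ⧸ H)
        (conjPoint a (mulChart d G (z.1, z.2.1)) •
          (extChartAt (𝓡 n) (a : G ⧸ H)).symm z.2.2) := rfl
    have e2 : actChart H a (z.1, actChart H a (z.2.1, z.2.2)) = extChartAt (𝓡 n) (a : G ⧸ H)
        (conjPoint a z.1 • (extChartAt (𝓡 n) (a : G ⧸ H)).symm (actChart H a z.2)) := rfl
    rw [e1, e2, h2.2, smul_smul, conjPoint, conjPoint, conjPoint, h1]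
    congr 2
    simp only [mul_assoc, inv_mul_cancel_left]

/-- At `a H`, the field of the action of the conjugates `a p a⁻¹` is the derivative of `p ↦ a p H`. -/
lemma actionField_actChart (hM : IsHomogeneousStructure d n H) (a : G) :
    actionField (actChart (n := n) H a) (unitChart d G)
      (extChartAt (𝓡 n) (a : G ⧸ H) (a : G ⧸ H)) = lieProj H a := by
  have h1 := hasFDerivAt_comp_left
    ((isActionGerm_actChart hM a).smooth.self_of_nhds.differentiableAt (by simp))
  have h2 : (fun p => actChart (d := d) (n := n) H a
      (p, extChartAt (𝓡 n) (a : G ⧸ H) (a : G ⧸ H))) = projChart H a := by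
    funext p
    rw [actChart, projChart, extChartAt_to_inv, conjPoint, MulAction.Quotient.smul_coe]
    simp
  rw [h2] at h1
  rw [← fderiv_projChart hM, h1.fderiv]
  rfl

end Action

/-! ### Invariant fields of bilinear forms -/

section InvariantForms

variable {d n : ℕ} {G : Type*} [TopologicalSpace G] [ChartedSpace (EuclideanSpace ℝ (Fin d)) G]
  [Group G] [LieGroup (𝓡 d) ∞ G] {H : Subgroup G} [ChartedSpace (EuclideanSpace ℝ (Fin n)) (G ⧸ H)]
  [IsManifold (𝓡 n) ∞ (G ⧸ H)]

/-- The coordinate expression of a field of bilinear forms on a manifold. -/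
def chartForm {M : Type*} [TopologicalSpace M] [ChartedSpace (EuclideanSpace ℝ (Fin n)) M]
    (b : M → EuclideanSpace ℝ (Fin n) →L[ℝ] EuclideanSpace ℝ (Fin n) →L[ℝ] ℝ) (x : M)
    (y : EuclideanSpace ℝ (Fin n)) :
    EuclideanSpace ℝ (Fin n) →L[ℝ] EuclideanSpace ℝ (Fin n) →L[ℝ] ℝ :=
  (b ((extChartAt (𝓡 n) x).symm y)).bilinearComp
    (tderiv (n := n) (n' := n) (extChartAt (𝓡 n) x).symm y)
    (tderiv (n := n) (n' := n) (extChartAt (𝓡 n) x).symm y)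

/-- A field of bilinear forms on `G ⧸ H`, not assumed to be continuous, which is invariant
under `G`. -/
def IsInvariantField
    (b : G ⧸ H → EuclideanSpace ℝ (Fin n) →L[ℝ] EuclideanSpace ℝ (Fin n) →L[ℝ] ℝ) : Prop :=
  ∀ (a : G) (x : G ⧸ H) (v w : EuclideanSpace ℝ (Fin n)),
    b (a • x) (tderiv (n := n) (n' := n) (fun y : G ⧸ H => a • y) x v)
      (tderiv (n := n) (n' := n) (fun y : G ⧸ H => a • y) x w) = b x v w

lemma chartForm_self {M : Type*} [TopologicalSpace M] [ChartedSpace (EuclideanSpace ℝ (Fin n)) M]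
    [IsManifold (𝓡 n) ∞ M]
    (b : M → EuclideanSpace ℝ (Fin n) →L[ℝ] EuclideanSpace ℝ (Fin n) →L[ℝ] ℝ) (x : M) :
    chartForm b x (extChartAt (𝓡 n) x x) = b x := by
  rw [chartForm, tderiv_symm_self, extChartAt_to_inv]
  rfl

variable {b : G ⧸ H → EuclideanSpace ℝ (Fin n) →L[ℝ] EuclideanSpace ℝ (Fin n) →L[ℝ] ℝ}

/-- Invariance of a field of forms under the action in coordinates. -/
lemma IsInvariantField.chartForm_actChart (hb : IsInvariantField b)
    (hM : IsHomogeneousStructure d n H) (a : G) :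
    ∀ᶠ z in 𝓝 (unitChart d G, extChartAt (𝓡 n) (a : G ⧸ H) (a : G ⧸ H)), ∀ v w,
      chartForm b (a : G ⧸ H) (actChart H a z) (fderiv ℝ (actChart H a) z (0, v))
        (fderiv ℝ (actChart H a) z (0, w)) = chartForm b (a : G ⧸ H) z.2 v w := by
  have h0 : ∀ᶠ z : EuclideanSpace ℝ (Fin d) × EuclideanSpace ℝ (Fin n)
      in 𝓝 (unitChart d G, extChartAt (𝓡 n) (a : G ⧸ H) (a : G ⧸ H)),
      z.2 ∈ (extChartAt (𝓡 n) (a : G ⧸ H)).target :=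
    (continuous_snd.tendsto _).eventually (extChartAt_target_mem_nhds (I := 𝓡 n) (a : G ⧸ H))
  filter_upwards [(isActionGerm_actChart hM a).smooth,
    (eventually_symm_actChart hM a).eventually_nhds, h0] with z h1 h2 h3 v w
  have h4 := hasFDerivAt_comp_right (h1.differentiableAt (by simp))
  have h5 : (tderiv (n := n) (n' := n) (extChartAt (𝓡 n) (a : G ⧸ H)).symm (actChart H a z)).comp
      (fderiv ℝ (fun y => actChart H a (z.1, y)) z.2)
      = (tderiv (n := n) (n' := n) (fun x : G ⧸ H => conjPoint a z.1 • x)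
        ((extChartAt (𝓡 n) (a : G ⧸ H)).symm z.2)).comp
        (tderiv (n := n) (n' := n) (extChartAt (𝓡 n) (a : G ⧸ H)).symm z.2) := by
    rw [← tderiv_eq_fderiv, ← tderiv_comp (f := fun y => actChart H a (z.1, y))
        (y := actChart H a z) rfl
      (mdiffAt_chart_symm h2.self_of_nhds.1) h4.differentiableAt.mdifferentiableAt,
      ← tderiv_comp rfl (mdiff_smul hM _ _) (mdiffAt_chart_symm h3)]
    refine tderiv_congr ?_
    have h6 : Tendsto (fun y => (z.1, y)) (𝓝 z.2) (𝓝 z) :=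
      (Continuous.prodMk_right z.1).tendsto z.2
    filter_upwards [h6.eventually h2] with y hy
    exact hy.2
  have h6 : ∀ v, fderiv ℝ (actChart H a) z (0, v)
      = fderiv ℝ (fun y => actChart H a (z.1, y)) z.2 v := fun v => by
    rw [h4.fderiv]; rfl
  have h7 : ∀ v, tderiv (n := n) (n' := n) (extChartAt (𝓡 n) (a : G ⧸ H)).symm (actChart H a z)
      (fderiv ℝ (actChart H a) z (0, v)) = tderiv (n := n) (n' := n)
        (fun x : G ⧸ H => conjPoint a z.1 • x) ((extChartAt (𝓡 n) (a : G ⧸ H)).symm z.2)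
        (tderiv (n := n) (n' := n) (extChartAt (𝓡 n) (a : G ⧸ H)).symm z.2 v) := fun v => by
    rw [h6]; exact DFunLike.congr_fun h5 v
  have h8 : ∀ y v w, chartForm b (a : G ⧸ H) y v w = b ((extChartAt (𝓡 n) (a : G ⧸ H)).symm y)
      (tderiv (n := n) (n' := n) (extChartAt (𝓡 n) (a : G ⧸ H)).symm y v)
      (tderiv (n := n) (n' := n) (extChartAt (𝓡 n) (a : G ⧸ H)).symm y w) := fun _ _ _ => rfl
  rw [h8, h8, h7, h7, h2.self_of_nhds.2]
  exact hb _ _ _ _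

/-- Invariant fields of forms are smooth: near `a H` such a field is obtained from its value at
`a H` by the derivatives of the action of the elements `σ y` of a smooth local section. -/
lemma IsInvariantField.eventually_contDiffAt (hb : IsInvariantField b)
    (hM : IsHomogeneousStructure d n H) (a : G) :
    ∀ᶠ y in 𝓝 (extChartAt (𝓡 n) (a : G ⧸ H) (a : G ⧸ H)),
      ContDiffAt ℝ ∞ (chartForm b (a : G ⧸ H)) y := by
  obtain ⟨σ, h0, hsm, hσ⟩ := exists_section hM a
  set y₀ := extChartAt (𝓡 n) (a : G ⧸ H) (a : G ⧸ H) with hy₀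
  have hag := isActionGerm_actChart hM a
  set B : EuclideanSpace ℝ (Fin d) → EuclideanSpace ℝ (Fin n) →L[ℝ] EuclideanSpace ℝ (Fin n) :=
    fun p => (fderiv ℝ (actChart H a) (p, y₀)).comp (ContinuousLinearMap.inr ℝ _ _) with hB
  have cB : ∀ᶠ p in 𝓝 (unitChart d G), ContDiffAt ℝ ∞ B p := by
    filter_upwards [eventually_prod_left hag.smooth] with p hp
    exact ((contDiffAt_fderiv hp).comp p (contDiffAt_id.prodMk contDiffAt_const)).clm_comp
      contDiffAt_const
  have hB1 : B (unitChart d G) = (ContinuousLinearEquiv.refl ℝ (EuclideanSpace ℝ (Fin n)) :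
      EuclideanSpace ℝ (Fin n) →L[ℝ] EuclideanSpace ℝ (Fin n)) := by
    ext1 v
    exact hag.fderiv_right.self_of_nhds v
  have hσt : Tendsto σ (𝓝 y₀) (𝓝 (unitChart d G)) := by
    have := hsm.self_of_nhds.continuousAt.tendsto
    rwa [h0] at this
  have inv : ∀ᶠ p in 𝓝 (unitChart d G), ∃ e : EuclideanSpace ℝ (Fin n) ≃L[ℝ]
      EuclideanSpace ℝ (Fin n), (e : EuclideanSpace ℝ (Fin n) →L[ℝ] EuclideanSpace ℝ (Fin n))
        = B p := by
    have h3 := (ContinuousLinearEquiv.refl ℝ (EuclideanSpace ℝ (Fin n))).nhds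
    rw [← hB1] at h3
    exact cB.self_of_nhds.continuousAt.eventually h3
  have key : ∀ᶠ y in 𝓝 y₀, chartForm b (a : G ⧸ H) y
      = (b (a : G ⧸ H)).bilinearComp (B (σ y)).inverse (B (σ y)).inverse := by
    filter_upwards [hσt.eventually (eventually_prod_left (hb.chartForm_actChart hM a)),
      hσt.eventually inv, hσ, extChartAt_target_mem_nhds (I := 𝓡 n) (a : G ⧸ H)]
      with y h1 h2 h3 h4
    obtain ⟨e, he⟩ := h2
    have h5 : actChart H a (σ y, y₀) = y := by
      rw [actChart]
      simp only [hy₀, extChartAt_to_inv]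
      rw [conjPoint, MulAction.Quotient.smul_coe, smul_eq_mul, inv_mul_cancel_right, ← h3]
      exact (extChartAt (𝓡 n) (a : G ⧸ H)).right_inv h4
    rw [h5] at h1
    have h6 : ∀ v w, chartForm b (a : G ⧸ H) y (e v) (e w) = b (a : G ⧸ H) v w := by
      intro v w
      rw [← chartForm_self b (a : G ⧸ H), ← h1 v w]
      have h7 : ∀ v, e v = B (σ y) v := fun v => by rw [← he]; rfl
      rw [h7, h7]
      rfl
    ext v w
    rw [← he, ContinuousLinearMap.inverse_equiv]
    have h8 := h6 (e.symm v) (e.symm w)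
    rw [e.apply_symm_apply, e.apply_symm_apply] at h8
    exact h8
  filter_upwards [key.eventually_nhds, hσt.eventually cB, hσt.eventually inv, hsm]
    with y h1 h2 h3 h4
  refine ContDiffAt.congr_of_eventuallyEq ?_ h1
  obtain ⟨e, he⟩ := h3
  have h5 : ContDiffAt ℝ ∞ (fun y => (B (σ y)).inverse) y := by
    have h6 := contDiffAt_map_inverse (𝕜 := ℝ) (n := ∞) e
    rw [he] at h6
    exact h6.comp y (h2.comp y h4)
  have h6 : ContDiffAt ℝ ∞ (fun y => ((b (a : G ⧸ H)).comp (B (σ y)).inverse).flip) y :=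
    (ContinuousLinearMap.flipₗᵢ ℝ (EuclideanSpace ℝ (Fin n)) (EuclideanSpace ℝ (Fin n))
      ℝ).contDiff.contDiffAt.comp y (contDiffAt_const.clm_comp h5)
  exact (ContinuousLinearMap.flipₗᵢ ℝ (EuclideanSpace ℝ (Fin n)) (EuclideanSpace ℝ (Fin n))
      ℝ).contDiff.contDiffAt.comp y (h6.clm_comp h5)

end InvariantForms

/-! ### The curvature of invariant metrics -/

/-- The Ricci curvature in directions of Killing fields, for a metric which corresponds to an
invariant form on a Lie algebra. -/
lemma chartRicci_eq_ricForm {n : ℕ} {L : Type*} [LieRing L] [LieAlgebra ℝ L] [Module.Finite ℝ L]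
    {b : EuclideanSpace ℝ (Fin n) → EuclideanSpace ℝ (Fin n) →L[ℝ] EuclideanSpace ℝ (Fin n) →L[ℝ] ℝ}
    {y : EuclideanSpace ℝ (Fin n)} {Q q : LinearMap.BilinForm ℝ L} {h₀ : Submodule ℝ L}
    (hQ : IsReductivePair Q h₀) (hqi : IsInvForm h₀ q)
    (ξ : EuclideanSpace ℝ (Fin n) → L →ₗ[ℝ] EuclideanSpace ℝ (Fin n))
    (hb : IsMetricNear b y) (hK : ∀ X, IsKillingNear b (fun z => ξ z X) y)
    (hbr : ∀ᶠ z in 𝓝 y, ∀ X Y : L, fderiv ℝ (fun x => ξ x X) z (ξ z Y)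
      - fderiv ℝ (fun x => ξ x Y) z (ξ z X) = ξ z ⁅X, Y⁆)
    (hsurj : Function.Surjective (ξ y)) (hq : ∀ X Y, q X Y = b y (ξ y X) (ξ y Y))
    {ι : Type*} [Fintype ι] [DecidableEq ι] {e : ι → L} (he : IsFrame q (ominus Q ⊤ h₀) e)
    (hf : IsFrame (pointForm b y) ⊤ (fun i => ξ y (e i))) {X Y : L}
    (hX : X ∈ ominus Q ⊤ h₀) (hY : Y ∈ ominus Q ⊤ h₀) :
    chartRicci b y (ξ y X) (ξ y Y) = ricForm q e X Y := by
  obtain ⟨Z, hZ⟩ := chartRicci_eq ξ hb hK hbr hsurj q hq e hf X Y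
  rw [hZ, ricForm_eq hQ hqi he hX hY Z]

section InvariantMetrics

variable {d n : ℕ} {G : Type*} [TopologicalSpace G] [ChartedSpace (EuclideanSpace ℝ (Fin d)) G]
  [Group G] [LieGroup (𝓡 d) ∞ G] {H : Subgroup G} [ChartedSpace (EuclideanSpace ℝ (Fin n)) (G ⧸ H)]
  [IsManifold (𝓡 n) ∞ (G ⧸ H)]

/-- The field of scalar products underlying a Riemannian metric. -/
def SmoothMetric.field {M : Type*} [TopologicalSpace M] [ChartedSpace (EuclideanSpace ℝ (Fin n)) M]
    [IsManifold (𝓡 n) ∞ M] (g : SmoothMetric n M) (x : M) :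
    EuclideanSpace ℝ (Fin n) →L[ℝ] EuclideanSpace ℝ (Fin n) →L[ℝ] ℝ := g.inner x

lemma SmoothMetric.field_symm {M : Type*} [TopologicalSpace M]
    [ChartedSpace (EuclideanSpace ℝ (Fin n)) M] [IsManifold (𝓡 n) ∞ M] (g : SmoothMetric n M) (x : M)
    (v w : EuclideanSpace ℝ (Fin n)) :
    SmoothMetric.field g x v w = SmoothMetric.field g x w v := g.symm x v w

lemma SmoothMetric.field_pos {M : Type*} [TopologicalSpace M]
    [ChartedSpace (EuclideanSpace ℝ (Fin n)) M] [IsManifold (𝓡 n) ∞ M] (g : SmoothMetric n M) (x : M)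
    {v : EuclideanSpace ℝ (Fin n)} (hv : v ≠ 0) : 0 < SmoothMetric.field g x v v := g.pos x v hv

lemma IsInvariantMetric.field {g : SmoothMetric n (G ⧸ H)} (hg : IsInvariantMetric g) :
    IsInvariantField (SmoothMetric.field g) := hg

lemma IsInvariantMetric.isMetricNear {g : SmoothMetric n (G ⧸ H)} (hg : IsInvariantMetric g)
    (hM : IsHomogeneousStructure d n H) (a : G) :
    IsMetricNear (chartForm (SmoothMetric.field g) (a : G ⧸ H))
      (extChartAt (𝓡 n) (a : G ⧸ H) (a : G ⧸ H)) where
  smooth := hg.field.eventually_contDiffAt hM a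
  symm := Eventually.of_forall fun y v w => SmoothMetric.field_symm g _ _ _
  pos := by
    filter_upwards [extChartAt_target_mem_nhds (I := 𝓡 n) (a : G ⧸ H)] with y hy v hv
    refine SmoothMetric.field_pos g _ fun h => hv ?_
    have h1 := DFunLike.congr_fun (tderiv_comp_symm hy) v
    rw [ContinuousLinearMap.comp_apply] at h1
    exact h1.symm.trans ((congrArg _ h).trans (map_zero _))

/-- The vector fields on `G ⧸ H` induced by the Lie algebra, in coordinates. -/
def lieField (H : Subgroup G) [ChartedSpace (EuclideanSpace ℝ (Fin n)) (G ⧸ H)] (a : G)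
    (y : EuclideanSpace ℝ (Fin n)) :
    GroupLieAlgebra (𝓡 d) G →ₗ[ℝ] EuclideanSpace ℝ (Fin n) :=
  (actionField (actChart (d := d) (n := n) H a) (unitChart d G) y).toLinearMap

lemma lieField_base (hM : IsHomogeneousStructure d n H) (a : G) (X : GroupLieAlgebra (𝓡 d) G) :
    lieField (n := n) H a (extChartAt (𝓡 n) (a : G ⧸ H) (a : G ⧸ H)) X = lieProj H a X :=
  DFunLike.congr_fun (actionField_actChart hM a) X

lemma isKillingNear_lieField (hM : IsHomogeneousStructure d n H) {g : SmoothMetric n (G ⧸ H)}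
    (hg : IsInvariantMetric g) (a : G) (X : GroupLieAlgebra (𝓡 d) G) :
    IsKillingNear (chartForm (SmoothMetric.field g) (a : G ⧸ H)) (fun y => lieField H a y X)
      (extChartAt (𝓡 n) (a : G ⧸ H) (a : G ⧸ H)) where
  smooth := (isActionGerm_actChart hM a).contDiffAt_actionField.mono fun y hy =>
    hy.clm_apply contDiffAt_const
  eq := (isActionGerm_actChart hM a).killing (hg.field.eventually_contDiffAt hM a)
    (hg.field.chartForm_actChart hM a) X

/-- The vector fields induced by the Lie algebra form an anti-homomorphism. -/
lemma lieField_bracket (hM : IsHomogeneousStructure d n H) (a : G) :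
    ∀ᶠ z in 𝓝 (extChartAt (𝓡 n) (a : G ⧸ H) (a : G ⧸ H)), ∀ X Y : GroupLieAlgebra (𝓡 d) G,
      fderiv ℝ (fun x => lieField (n := n) H a x X) z (lieField H a z Y)
        - fderiv ℝ (fun x => lieField H a x Y) z (lieField H a z X) = lieField H a z ⁅X, Y⁆ := by
  filter_upwards [(isActionGerm_actChart (n := n) hM a).bracket isMulGerm_mulChart] with z hz X Y
  rw [lie_eq_germBracket]
  exact hz X Y

/-- By invariance, the form on the Lie algebra obtained by pulling back the metric at `a H` along
`x ↦ a x H` does not depend on `a`. -/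
lemma field_lieProj (hM : IsHomogeneousStructure d n H) {g : SmoothMetric n (G ⧸ H)}
    (hg : IsInvariantMetric g) (a : G) (X Y : GroupLieAlgebra (𝓡 d) G) :
    SmoothMetric.field g (a : G ⧸ H) (lieProj H a X) (lieProj H a Y) = liftedForm d g X Y := by
  have h2 : ∀ X : EuclideanSpace ℝ (Fin d), tderiv (n := n) (n' := n) (fun y : G ⧸ H => a • y)
      ((1 : G) : G ⧸ H) (lieProj H 1 X) = lieProj H a X := fun X => by
    rw [← ContinuousLinearMap.comp_apply, ← lieProj_mul hM, mul_one]
  have h3 : a • ((1 : G) : G ⧸ H) = (a : G ⧸ H) := by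
    rw [MulAction.Quotient.smul_coe, smul_eq_mul, mul_one]
  have h4 : lieProj (d := d) (n := n) H (1 : G)
      = tderiv (n := d) (n' := n) (fun x : G => (x : G ⧸ H)) 1 :=
    tderiv_congr (Eventually.of_forall fun x => by simp)
  have h5 : ∀ X Y : EuclideanSpace ℝ (Fin d), SmoothMetric.field g (a : G ⧸ H) (lieProj H a X) (lieProj H a Y)
      = SmoothMetric.field g ((1 : G) : G ⧸ H) (lieProj H 1 X) (lieProj H 1 Y) := by
    intro X Y
    have h1 := hg.field a ((1 : G) : G ⧸ H) (lieProj H 1 X) (lieProj H 1 Y)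
    rwa [h2, h2, h3] at h1
  refine (h5 X Y).trans ?_
  rw [h4]
  rfl

/-- `G`-invariant metrics induce `ad`-invariant forms on the Lie algebra. -/
lemma isInvForm_liftedForm (hM : IsHomogeneousStructure d n H) (hH : IsConnected (H : Set G))
    {g : SmoothMetric n (G ⧸ H)} (hg : IsInvariantMetric g) :
    IsInvForm (isotropyAlgebra d n H) (liftedForm d g) where
  symm X Y := g.symm _ _ _
  pos X hX := g.pos _ _ fun h => hX h
  ker X hX Y := by
    have h1 : quotientDeriv d n H X = 0 := hX
    change g.inner _ (quotientDeriv d n H X) (quotientDeriv d n H Y) = 0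
    rw [h1, map_zero]
    rfl
  skew := by
    refine ((isAdapted_Ad hM hH).form (liftedForm d g)).2 fun a X Y => ?_
    have h1 : (lieProj (d := d) (n := n) H (1 : G)).comp (AdL (d := d) (a : G))
        = lieProj H (a : G) := by rw [lieProj_comp_AdL hM 1 a.2, one_mul]
    have h2 : ((a : G) : G ⧸ H) = ((1 : G) : G ⧸ H) := by
      rw [eq_comm, QuotientGroup.eq]; simp
    have h3 : ∀ X Y : EuclideanSpace ℝ (Fin d), SmoothMetric.field g ((1 : G) : G ⧸ H)
        (lieProj H 1 (AdL (d := d) (a : G) X)) (lieProj H 1 (AdL (d := d) (a : G) Y))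
        = SmoothMetric.field g ((a : G) : G ⧸ H) (lieProj H (a : G) X) (lieProj H (a : G) Y) := by
      intro X Y
      rw [← h1, h2]
      rfl
    exact (field_lieProj hM hg 1 _ _).symm.trans ((h3 X Y).trans (field_lieProj hM hg a X Y))

variable {ι : Type*} [Fintype ι] [DecidableEq ι] {Q : LinearMap.BilinForm ℝ (GroupLieAlgebra (𝓡 d) G)}
  {g : SmoothMetric n (G ⧸ H)} {e : ι → GroupLieAlgebra (𝓡 d) G}

/-- An orthonormal frame of the complement of the isotropy algebra is mapped to an orthonormal frame of
the tangent space at `a H`. -/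
lemma isFrame_lieProj (hM : IsHomogeneousStructure d n H)
    (hQ : IsReductivePair Q (isotropyAlgebra d n H)) (hH : IsConnected (H : Set G))
    (hg : IsInvariantMetric g) (he : IsFrame (liftedForm d g) (ominus Q ⊤ (isotropyAlgebra d n H)) e)
    (a : G) (φ : LinearMap.BilinForm ℝ (EuclideanSpace ℝ (Fin n)))
    (hφ : ∀ v w, φ v w = SmoothMetric.field g (a : G ⧸ H) v w) :
    IsFrame φ ⊤ (fun i => lieProj H a (e i)) where
  mem i := trivial
  orth i j := by
    rw [hφ]
    exact (field_lieProj hM hg a (e i) (e j)).trans (he.orth i j)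
  expand x _ := by
    obtain ⟨X, rfl⟩ : ∃ X : GroupLieAlgebra (𝓡 d) G, lieProj (n := n) H a X = x :=
      lieProj_surjective hM a x
    obtain ⟨v, hv⟩ := exists_frame Q (isotropyAlgebra d n H) hQ.symm (fun x _ => hQ.pos x)
    have h1 := (isInvForm_liftedForm hM hH hg).expand hQ he hv X
    set f : GroupLieAlgebra (𝓡 d) G →ₗ[ℝ] EuclideanSpace ℝ (Fin n) :=
      (lieProj (d := d) (n := n) H a).toLinearMap with hf
    have h2 := congrArg f h1
    rw [map_add, map_sum, map_sum, Finset.sum_eq_zero, zero_add] at h2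
    · refine h2.trans (Finset.sum_congr rfl fun i _ => ?_)
      rw [map_smul, hφ]
      exact congrArg (· • f (e i)) (field_lieProj hM hg a X (e i)).symm
    · intro i _
      rw [map_smul]
      exact (congrArg _ ((lieProj_eq_zero_iff hM a).2 (hv.mem i))).trans (smul_zero _)

omit [LieGroup (𝓡 d) ∞ G] in
/-- The derivative of a chart at its base point is the identity, so that `ricci` is the Ricci
curvature of the coordinate expression of the metric. -/
lemma ricci_eq_chartRicci {M : Type*} [TopologicalSpace M]
    [ChartedSpace (EuclideanSpace ℝ (Fin n)) M] [IsManifold (𝓡 n) ∞ M] (g : SmoothMetric n M) (x : M)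
    (v w : EuclideanSpace ℝ (Fin n)) :
    ricci g x v w
      = chartRicci (chartForm (SmoothMetric.field g) x) (extChartAt (𝓡 n) x x) v w := by
  have key : ∀ (D : EuclideanSpace ℝ (Fin n) →L[ℝ] EuclideanSpace ℝ (Fin n)),
      D = ContinuousLinearMap.id ℝ _ →
      chartRicci (chartForm (SmoothMetric.field g) x) (extChartAt (𝓡 n) x x) (D v) (D w)
        = chartRicci (chartForm (SmoothMetric.field g) x) (extChartAt (𝓡 n) x x) v w := by
    rintro D rfl; rfl
  exact key _ (tderiv_extChartAt_self x)

/-- The Ricci curvature of an invariant metric in terms of the Lie algebra. -/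
theorem ricci_lieProj (hM : IsHomogeneousStructure d n H)
    (hQ : IsReductivePair Q (isotropyAlgebra d n H)) (hH : IsConnected (H : Set G))
    (hg : IsInvariantMetric g) (he : IsFrame (liftedForm d g) (ominus Q ⊤ (isotropyAlgebra d n H)) e)
    (a : G) {X Y : GroupLieAlgebra (𝓡 d) G} (hX : X ∈ ominus Q ⊤ (isotropyAlgebra d n H))
    (hY : Y ∈ ominus Q ⊤ (isotropyAlgebra d n H)) :
    ricci g (a : G ⧸ H) (lieProj (n := n) H a X) (lieProj (n := n) H a Y)
      = ricForm (liftedForm d g) e X Y := by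
  have hself := chartForm_self (SmoothMetric.field g) (a : G ⧸ H)
  have hξ := lieField_base (n := n) hM a
  have hq : ∀ X Y : GroupLieAlgebra (𝓡 d) G, liftedForm d g X Y
      = chartForm (SmoothMetric.field g) (a : G ⧸ H)
        (extChartAt (𝓡 n) (a : G ⧸ H) (a : G ⧸ H))
        (lieField H a (extChartAt (𝓡 n) (a : G ⧸ H) (a : G ⧸ H)) X)
        (lieField H a (extChartAt (𝓡 n) (a : G ⧸ H) (a : G ⧸ H)) Y) := fun X Y => by
    rw [hξ, hξ, hself]
    exact (field_lieProj hM hg a X Y).symm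
  have hfr : IsFrame (pointForm (chartForm (SmoothMetric.field g) (a : G ⧸ H))
      (extChartAt (𝓡 n) (a : G ⧸ H) (a : G ⧸ H))) ⊤
      (fun i => lieField H a (extChartAt (𝓡 n) (a : G ⧸ H) (a : G ⧸ H)) (e i)) := by
    simp only [hξ]
    refine isFrame_lieProj hM hQ hH hg he a _ fun v w => ?_
    rw [← hself]
    rfl
  have h1 := chartRicci_eq_ricForm hQ (isInvForm_liftedForm hM hH hg) (lieField (n := n) H a)
    (hg.isMetricNear hM a) (isKillingNear_lieField hM hg a) (lieField_bracket hM a)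
    (fun y => (lieProj_surjective hM a y).imp fun X hX => (hξ X).trans hX) hq he hfr hX hY
  rw [hξ, hξ] at h1
  exact (ricci_eq_chartRicci g (a : G ⧸ H) _ _).trans h1

/-- The trace of an invariant metric with respect to another one in terms of the Lie algebra. -/
lemma metricTrace_eq (hM : IsHomogeneousStructure d n H)
    (hQ : IsReductivePair Q (isotropyAlgebra d n H)) (hH : IsConnected (H : Set G))
    (hg : IsInvariantMetric g) (he : IsFrame (liftedForm d g) (ominus Q ⊤ (isotropyAlgebra d n H)) e)
    {T : SmoothMetric n (G ⧸ H)} (hT : IsInvariantMetric T) (x : G ⧸ H) :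
    metricTrace g T x = ∑ i, liftedForm d T (e i) (e i) := by
  obtain ⟨a, rfl⟩ := QuotientGroup.mk_surjective x
  have h1 := trForm_eq_sum (V := EuclideanSpace ℝ (Fin n))
    (X := fun v w => SmoothMetric.field g (a : G ⧸ H) v w)
    (Y := fun v w => SmoothMetric.field T (a : G ⧸ H) v w)
    (pointForm (fun _ => SmoothMetric.field g (a : G ⧸ H)) 0)
    (pointForm (fun _ => SmoothMetric.field T (a : G ⧸ H)) 0) (fun _ _ => rfl) (fun _ _ => rfl)
    (isFrame_lieProj hM hQ hH hg he a _ (fun _ _ => rfl)) (SmoothMetric.field_symm g _)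
  refine h1.trans (Finset.sum_congr rfl fun i _ => ?_)
  exact field_lieProj hM hT a (e i) (e i)

/-- A linear right inverse of `lieProj H a` with values in the complement of the isotropy
algebra. -/
lemma exists_mem_lieProj_eq (hM : IsHomogeneousStructure d n H)
    (hQ : IsReductivePair Q (isotropyAlgebra d n H)) (a : G) :
    ∃ s : EuclideanSpace ℝ (Fin n) →ₗ[ℝ] GroupLieAlgebra (𝓡 d) G,
      ∀ v, s v ∈ ominus Q ⊤ (isotropyAlgebra d n H) ∧ lieProj H a (s v) = v := by
  obtain ⟨s, hs⟩ := (lieProj (d := d) (n := n) H a).toLinearMap.exists_rightInverse_of_surjective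
    (LinearMap.range_eq_top.2 (lieProj_surjective hM a))
  obtain ⟨P, hP⟩ := exists_isOrthProj hQ (isotropyAlgebra d n H)
  set s' : EuclideanSpace ℝ (Fin n) →ₗ[ℝ] GroupLieAlgebra (𝓡 d) G := s with hs'
  refine ⟨s' - P ∘ₗ s', fun v => ⟨⟨trivial, fun w hw => ?_⟩, ?_⟩⟩
  · exact (hQ.symm _ _).trans (hP.orth (s' v) w hw)
  · set f : GroupLieAlgebra (𝓡 d) G →ₗ[ℝ] EuclideanSpace ℝ (Fin n) :=
      (lieProj (d := d) (n := n) H a).toLinearMap with hf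
    have h1 : f (s' v) = v := DFunLike.congr_fun hs v
    have h2 : f (P (s' v)) = 0 := (lieProj_eq_zero_iff hM a).2 (hP.mem _)
    change f ((s' - P ∘ₗ s') v) = v
    rw [LinearMap.sub_apply, map_sub, LinearMap.comp_apply, h1, h2, sub_zero]

/-- The scalar curvature of an invariant metric in terms of the Lie algebra. -/
lemma scalarFunctional_eq (hM : IsHomogeneousStructure d n H)
    (hQ : IsReductivePair Q (isotropyAlgebra d n H)) (hH : IsConnected (H : Set G))
    (hg : IsInvariantMetric g) (he : IsFrame (liftedForm d g) (ominus Q ⊤ (isotropyAlgebra d n H)) e) :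
    scalarFunctional g = scal (liftedForm d g) e := by
  obtain ⟨s, hs⟩ := exists_mem_lieProj_eq hM hQ (1 : G)
  set β : LinearMap.BilinForm ℝ (EuclideanSpace ℝ (Fin n)) :=
    (ricBilin (liftedForm d g) e).compl₁₂ s s with hβ
  have h1 : ∀ v w : EuclideanSpace ℝ (Fin n), ricci g ((1 : G) : G ⧸ H) v w = β v w := fun v w => by
    have h2 := ricci_lieProj hM hQ hH hg he 1 (hs v).1 (hs w).1
    rw [(hs v).2, (hs w).2] at h2
    exact h2
  have h2 := trForm_eq_sum (V := EuclideanSpace ℝ (Fin n))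
    (X := fun v w => SmoothMetric.field g ((1 : G) : G ⧸ H) v w)
    (Y := fun v w => ricci g ((1 : G) : G ⧸ H) v w)
    (pointForm (fun _ => SmoothMetric.field g ((1 : G) : G ⧸ H)) 0) β (fun _ _ => rfl) h1
    (isFrame_lieProj hM hQ hH hg he 1 _ (fun _ _ => rfl)) (SmoothMetric.field_symm g _)
  refine h2.trans ?_
  rw [← sum_ricForm hQ (isInvForm_liftedForm hM hH hg) he]
  refine Finset.sum_congr rfl fun i _ => ?_
  exact (h1 _ _).symm.trans (ricci_lieProj hM hQ hH hg he 1 (he.mem i) (he.mem i))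

end InvariantMetrics

/-! ### Smoothness of fields of forms -/

section SmoothFields

variable {n : ℕ} {M : Type*} [TopologicalSpace M] [ChartedSpace (EuclideanSpace ℝ (Fin n)) M]
  [IsManifold (𝓡 n) ∞ M]

/-- The trivialization of the tangent bundle around `x₀` is the derivative of the chart. -/
lemma trivializationAt_symm_apply {x₀ x : M} (hx : x ∈ (chartAt (EuclideanSpace ℝ (Fin n)) x₀).source)
    (v : EuclideanSpace ℝ (Fin n)) :
    (trivializationAt (EuclideanSpace ℝ (Fin n)) (TangentSpace (𝓡 n)) x₀).symm x v
      = tderiv (n := n) (n' := n) (extChartAt (𝓡 n) x₀).symm (extChartAt (𝓡 n) x₀ x) v := by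
  have h1 := TangentBundle.symmL_trivializationAt (I := 𝓡 n) hx
  have h2 : ∀ s : Set (EuclideanSpace ℝ (Fin n)), s = Set.univ →
      mfderivWithin 𝓘(ℝ, EuclideanSpace ℝ (Fin n)) (𝓡 n) (extChartAt (𝓡 n) x₀).symm s
        (extChartAt (𝓡 n) x₀ x)
        = mfderiv 𝓘(ℝ, EuclideanSpace ℝ (Fin n)) (𝓡 n) (extChartAt (𝓡 n) x₀).symm
          (extChartAt (𝓡 n) x₀ x) := by
    rintro s rfl
    rw [mfderivWithin_univ]
  have h3 := h1.trans (h2 _ (ModelWithCorners.range_eq_univ _))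
  exact (Bundle.Trivialization.symmL_apply (R := ℝ) _ hx v).symm.trans (DFunLike.congr_fun h3 v)

/-- A field of bilinear forms on the tangent spaces is smooth if its coordinate expressions are. -/
lemma contMDiff_of_chartForm
    (b : (x : M) → TangentSpace (𝓡 n) x →L[ℝ] TangentSpace (𝓡 n) x →L[ℝ] ℝ)
    (h : ∀ x : M, ContDiffAt ℝ ∞ (chartForm (n := n) b x) (extChartAt (𝓡 n) x x)) :
    ContMDiff (𝓡 n) ((𝓡 n).prod 𝓘(ℝ, EuclideanSpace ℝ (Fin n) →L[ℝ]
      EuclideanSpace ℝ (Fin n) →L[ℝ] ℝ)) ∞ (fun x => Bundle.TotalSpace.mk'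
      (EuclideanSpace ℝ (Fin n) →L[ℝ] EuclideanSpace ℝ (Fin n) →L[ℝ] ℝ) x (b x)) := by
  intro x₀
  refine (contMDiffAt_hom_bundle _).2 ⟨contMDiffAt_id, ?_⟩
  have h1 : ContMDiffAt (𝓡 n) 𝓘(ℝ, EuclideanSpace ℝ (Fin n) →L[ℝ]
      EuclideanSpace ℝ (Fin n) →L[ℝ] ℝ) ∞
      (fun x => chartForm (n := n) b x₀ (extChartAt (𝓡 n) x₀ x)) x₀ :=
    ContMDiffAt.comp (I' := 𝓡 n) (g := chartForm (n := n) b x₀) x₀ (h x₀).contMDiffAt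
      (contMDiffAt_chart (mem_extChartAt_source x₀))
  refine h1.congr_of_eventuallyEq ?_
  filter_upwards [chart_source_mem_nhds (EuclideanSpace ℝ (Fin n)) x₀] with x hx
  have hx' : x ∈ (trivializationAt (EuclideanSpace ℝ (Fin n)) (TangentSpace (𝓡 n)) x₀).baseSet := hx
  ext1 v
  ext1 w
  have h4 : ∀ r : ℝ, (trivializationAt ℝ (Bundle.Trivial M ℝ) x₀).linearMapAt ℝ x r = r := by
    simp
  refine ((inCoordinates_apply_eq₂ hx' hx' (Set.mem_univ _)).trans (h4 _)).trans ?_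
  rw [trivializationAt_symm_apply hx, trivializationAt_symm_apply hx]
  have h2 : (extChartAt (𝓡 n) x₀).symm (extChartAt (𝓡 n) x₀ x) = x :=
    (extChartAt (𝓡 n) x₀).left_inv (by rwa [extChartAt_source])
  have h3 : ∀ (y : M) (v w : EuclideanSpace ℝ (Fin n)), y = x →
      (b x : EuclideanSpace ℝ (Fin n) →L[ℝ] EuclideanSpace ℝ (Fin n) →L[ℝ] ℝ) v w
        = (b y : EuclideanSpace ℝ (Fin n) →L[ℝ] EuclideanSpace ℝ (Fin n) →L[ℝ] ℝ) v w := by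
    rintro y v w rfl; rfl
  exact h3 _ _ _ h2

end SmoothFields

/-! ### Construction of invariant metrics -/

section Construction

variable {d n : ℕ} {G : Type*} [TopologicalSpace G] [ChartedSpace (EuclideanSpace ℝ (Fin d)) G]
  [Group G] [LieGroup (𝓡 d) ∞ G] {H : Subgroup G} [ChartedSpace (EuclideanSpace ℝ (Fin n)) (G ⧸ H)]
  [IsManifold (𝓡 n) ∞ (G ⧸ H)]

lemma IsInvForm.apply_eq {L : Type*} [LieRing L] [LieAlgebra ℝ L] {h₀ : Submodule ℝ L}
    {φ : LinearMap.BilinForm ℝ L} (hφ : IsInvForm h₀ φ) {X X' Y Y' : L} (hX : X - X' ∈ h₀)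
    (hY : Y - Y' ∈ h₀) : φ X Y = φ X' Y' := by
  have h1 := hφ.ker _ hX Y
  have h2 := hφ.ker' X' hY
  rw [map_sub, LinearMap.sub_apply] at h1
  rw [map_sub] at h2
  linarith

/-- An invariant form on the Lie algebra defines a form on every tangent space of `G ⧸ H`. -/
lemma exists_field (hM : IsHomogeneousStructure d n H) (hH : IsConnected (H : Set G))
    {φ : LinearMap.BilinForm ℝ (GroupLieAlgebra (𝓡 d) G)}
    (hφ : IsInvForm (isotropyAlgebra d n H) φ) :
    ∃ b : G ⧸ H → EuclideanSpace ℝ (Fin n) →L[ℝ] EuclideanSpace ℝ (Fin n) →L[ℝ] ℝ,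
      ∀ (a : G) (X Y : GroupLieAlgebra (𝓡 d) G),
        b (a : G ⧸ H) (lieProj H a X) (lieProj H a Y) = φ X Y := by
  have h1 : ∀ x : G ⧸ H, ∃ s : EuclideanSpace ℝ (Fin n) →ₗ[ℝ] GroupLieAlgebra (𝓡 d) G,
      ∀ v, lieProj H x.out (s v) = v := fun x => by
    obtain ⟨s, hs⟩ := (lieProj (d := d) (n := n) H x.out).toLinearMap.exists_rightInverse_of_surjective
      (LinearMap.range_eq_top.2 (lieProj_surjective hM _))
    exact ⟨s, fun v => DFunLike.congr_fun hs v⟩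
  choose s hs using h1
  refine ⟨fun x => bilinToCLM (φ.compl₁₂ (s x) (s x)), fun a X Y => ?_⟩
  set x : G ⧸ H := (a : G ⧸ H) with hx
  have hh : a⁻¹ * x.out ∈ H := by
    rw [← QuotientGroup.eq, QuotientGroup.out_eq']
  set h : G := a⁻¹ * x.out with hhdef
  -- independence of the representative `x.out = a h` follows from `lieProj (a h) = lieProj a ∘ Ad h`
  -- and the `Ad h`-invariance of `φ`
  have key : ∀ Z : GroupLieAlgebra (𝓡 d) G,
      Z - Ad d h (s x (lieProj H a Z)) ∈ isotropyAlgebra d n H := by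
    intro Z
    rw [← lieProj_eq_zero_iff hM a]
    have h2 := hs x (lieProj H a Z)
    have h3 : lieProj (d := d) (n := n) H x.out = (lieProj H a).comp (AdL (d := d) h) := by
      rw [lieProj_comp_AdL hM a hh, hhdef, mul_inv_cancel_left]
    have h4 : lieProj (n := n) H a (Ad d h (s x (lieProj H a Z))) = lieProj H a Z :=
      (DFunLike.congr_fun h3 (s x (lieProj H a Z))).symm.trans h2
    exact (map_sub (lieProj (d := d) (n := n) H a) Z (Ad d h (s x (lieProj H a Z)))).trans
      (sub_eq_zero.2 h4.symm)
  have h5 := ((isAdapted_Ad hM hH).form φ).1 hφ.skew ⟨h, hh⟩ (s x (lieProj H a X))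
    (s x (lieProj H a Y))
  exact h5.symm.trans (hφ.apply_eq (key X) (key Y)).symm

/-- The coordinates of `v` in a `b`-orthonormal frame have absolute value at most `1` if `b v v < 1`. -/
lemma isVonNBounded_of_pos (b : EuclideanSpace ℝ (Fin n) →L[ℝ] EuclideanSpace ℝ (Fin n) →L[ℝ] ℝ)
    (hs : ∀ v w, b v w = b w v) (hp : ∀ v, v ≠ 0 → 0 < b v v) :
    Bornology.IsVonNBounded ℝ {v : EuclideanSpace ℝ (Fin n) | b v v < 1} := by
  obtain ⟨e, he⟩ := exists_frame (pointForm (fun _ => b) 0) ⊤ hs (fun x _ => hp x)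
  refine (NormedSpace.isVonNBounded_closedBall ℝ (EuclideanSpace ℝ (Fin n))
    (∑ i, ‖e i‖)).subset fun v hv => ?_
  have h1 : v = ∑ i, b v (e i) • e i := he.expand v trivial
  have h2 : b v v = ∑ i, b v (e i) * b v (e i) := by
    refine (congrArg (b v) h1).trans ?_
    simp only [map_sum, map_smul, smul_eq_mul]
  have h3 : ∀ i, |b v (e i)| ≤ 1 := by
    intro i
    have h4 : b v (e i) * b v (e i) ≤ b v v := by
      rw [h2]
      exact Finset.single_le_sum (f := fun i => b v (e i) * b v (e i))
        (fun i _ => mul_self_nonneg _) (Finset.mem_univ i)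
    have h5 : b v v < 1 := hv
    rw [abs_le]
    constructor <;> nlinarith
  rw [mem_closedBall_zero_iff]
  conv_lhs => rw [h1]
  refine (norm_sum_le _ _).trans (Finset.sum_le_sum fun i _ => ?_)
  rw [norm_smul, Real.norm_eq_abs]
  exact mul_le_of_le_one_left (norm_nonneg _) (h3 i)

/-- Every invariant form on the Lie algebra comes from a `G`-invariant metric on `G ⧸ H`. -/
theorem exists_invariantMetric (hM : IsHomogeneousStructure d n H) (hH : IsConnected (H : Set G))
    {φ : LinearMap.BilinForm ℝ (GroupLieAlgebra (𝓡 d) G)}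
    (hφ : IsInvForm (isotropyAlgebra d n H) φ) :
    ∃ g : SmoothMetric n (G ⧸ H), IsInvariantMetric g ∧ liftedForm d g = φ := by
  obtain ⟨b, hb⟩ := exists_field hM hH hφ
  have hinv : IsInvariantField b := by
    intro a x v w
    obtain ⟨c, rfl⟩ := QuotientGroup.mk_surjective x
    obtain ⟨X, rfl⟩ := lieProj_surjective hM c v
    obtain ⟨Y, rfl⟩ := lieProj_surjective hM c w
    have h1 := lieProj_mul hM a c
    refine Eq.trans ?_ (hb c X Y).symm
    refine Eq.trans ?_ (hb (a * c) X Y)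
    rw [h1]
    rfl
  have hsymm : ∀ x v w, b x v w = b x w v := by
    intro x v w
    obtain ⟨c, rfl⟩ := QuotientGroup.mk_surjective x
    obtain ⟨X, rfl⟩ := lieProj_surjective hM c v
    obtain ⟨Y, rfl⟩ := lieProj_surjective hM c w
    exact (hb c X Y).trans ((hφ.symm X Y).trans (hb c Y X).symm)
  have hpos : ∀ x v, v ≠ 0 → 0 < b x v v := by
    intro x v hv
    obtain ⟨c, rfl⟩ := QuotientGroup.mk_surjective x
    obtain ⟨X, rfl⟩ := lieProj_surjective hM c v
    exact (hφ.pos X fun h => hv ((lieProj_eq_zero_iff hM c).2 h)).trans_eq (hb c X X).symm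
  let g : SmoothMetric n (G ⧸ H) :=
    { inner := fun x => b x
      symm := hsymm
      pos := hpos
      isVonNBounded := fun x => isVonNBounded_of_pos (b x) (hsymm x) (hpos x)
      contMDiff := contMDiff_of_chartForm _ fun x => by
        obtain ⟨c, rfl⟩ := QuotientGroup.mk_surjective x
        exact (hinv.eventually_contDiffAt hM c).self_of_nhds }
  have hg : IsInvariantMetric g := hinv
  refine ⟨g, hg, ?_⟩
  ext X Y
  exact (field_lieProj hM hg 1 X Y).symm.trans (hb 1 X Y)

end Construction

end HomRicci

end

theorem theorem3p2
    {d n : ℕ} (hn : 3 ≤ n)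
    -- a compact connected Lie group
    {G : Type*} [TopologicalSpace G] [T2Space G] [ChartedSpace (EuclideanSpace ℝ (Fin d)) G]
    [Group G] [LieGroup (𝓡 d) ∞ G] [CompactSpace G] [ConnectedSpace G]
    -- a closed connected subgroup and the homogeneous space `G ⧸ H`
    (H : Subgroup G) (hHclosed : IsClosed (H : Set G)) (hHconn : IsConnected (H : Set G))
    [ChartedSpace (EuclideanSpace ℝ (Fin n)) (G ⧸ H)] [IsManifold (𝓡 n) ∞ (G ⧸ H)]
    (hM : HomRicci.IsHomogeneousStructure d n H)
    -- the scalar product `Q` comes from a bi-invariant metric `q`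
    (q : HomRicci.SmoothMetric d G) (hq : HomRicci.IsBiinvariant q)
    (Q : LinearMap.BilinForm ℝ (GroupLieAlgebra (𝓡 d) G)) (hQ : Q = HomRicci.inducedForm q)
    -- the `G`-invariant metric `T` and the form it induces
    (T : HomRicci.SmoothMetric n (G ⧸ H)) (hT : HomRicci.IsInvariantMetric T)
    (Tm : LinearMap.BilinForm ℝ (GroupLieAlgebra (𝓡 d) G)) (hTm : Tm = HomRicci.liftedForm d T)
    -- the hypothesis on maximal subalgebras
    (hflag : HomRicci.MaximalInequivalence (fun a : H => HomRicci.Ad d (a : G)) Q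
      (HomRicci.isotropyAlgebra d n H))
    -- the apical subalgebra `k` and `l = g ⊖ k`
    (k : LieSubalgebra ℝ (GroupLieAlgebra (𝓡 d) G))
    (hk : HomRicci.IsApical (fun a : H => HomRicci.Ad d (a : G)) Q Tm
      (HomRicci.isotropyAlgebra d n H) k)
    (l : Submodule ℝ (GroupLieAlgebra (𝓡 d) G)) (hl : l = HomRicci.ominus Q ⊤ k.toSubmodule)
    (hineq :
      4 * HomRicci.sigma (fun a : H => HomRicci.Ad d (a : G)) Q Tm
            (HomRicci.isotropyAlgebra d n H) k
          * HomRicci.trForm (HomRicci.restr Q l) (HomRicci.restr Tm l)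
        < -2 * HomRicci.trForm (HomRicci.restr Q l)
              (HomRicci.restr (killingForm ℝ (GroupLieAlgebra (𝓡 d) G)) l)
          - HomRicci.structConst Q l l l) :
    ∃ g ∈ HomRicci.MT T,
      (∀ g' ∈ HomRicci.MT T, HomRicci.scalarFunctional g' ≤ HomRicci.scalarFunctional g) ∧
      ∃ c : ℝ, 0 < c ∧ ∀ (x : G ⧸ H) (v w : TangentSpace (𝓡 n) x),
        HomRicci.ricci g x v w = c * T.inner x v w := by
  subst hQ hTm hl
  have hred := HomRicci.isReductivePair_inducedForm hM hq
  obtain ⟨φ, hφ, e, he, htr, hpos, hmax, hric⟩ := HomRicci.exists_einstein_form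
    (HomRicci.isAdapted_Ad hM hHconn) hred (HomRicci.isInvForm_liftedForm hM hHconn hT) hflag k hk
    hineq
  obtain ⟨g, hg, rfl⟩ := HomRicci.exists_invariantMetric hM hHconn hφ
  refine ⟨g, ⟨hg, fun x => ?_⟩, fun g' hg' => ?_, _, hpos, fun x v w => ?_⟩
  · rw [HomRicci.metricTrace_eq hM hred hHconn hg he hT, htr]
  · have hφ' := HomRicci.isInvForm_liftedForm hM hHconn hg'.1
    obtain ⟨e', he'⟩ := HomRicci.exists_frame (HomRicci.liftedForm d g')
      (HomRicci.ominus (HomRicci.inducedForm q) ⊤ (HomRicci.isotropyAlgebra d n H)) hφ'.symm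
      (hφ'.pos_compl hred)
    rw [HomRicci.scalarFunctional_eq hM hred hHconn hg he,
      HomRicci.scalarFunctional_eq hM hred hHconn hg'.1 he']
    refine hmax _ hφ' e' he' ?_
    rw [← HomRicci.metricTrace_eq hM hred hHconn hg'.1 he' hT ((1 : G) : G ⧸ H)]
    exact hg'.2 _
  · obtain ⟨a, rfl⟩ := QuotientGroup.mk_surjective x
    obtain ⟨s, hs⟩ := HomRicci.exists_mem_lieProj_eq (n := n) hM hred a
    have h1 := HomRicci.ricci_lieProj hM hred hHconn hg he a (hs v).1 (hs w).1
    rw [hric _ (hs v).1 _ (hs w).1, ← HomRicci.field_lieProj hM hT a] at h1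
    rw [(hs v).2, (hs w).2] at h1
    exact h1
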